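/- Let $k$ be a field of characteristic $0$ and let $\delta,\varepsilon\in\{1,-1\}$. For a sign $\eta$ write $\chi_\eta$ for the trivial character of a symmetric group if $\eta=1$ and for the sign character if $\eta=-1$. All categories below have finite sets (resp. pairs of finite sets) as objects and are $k$-linear; a module over such a category is a $k$-linear functor to $k$-vector spaces. **Categories.** The upward directed Brauer category $D_\varepsilon$ is $k$-linearly generated, as morphisms $A\to B$, by the bijections $f\colon A\sqcup(\{1,2\}\times\{1,\dots,t\})\to B$, $t\ge 0$ (with ordered directed pairs $(f(1,j),f(2,j))$), modulo $[f\cdot\sigma]=\chi_\varepsilon(\sigma)[f]$ for $\sigma\in S_t$ permuting the pairs; composition is composition of bijections, the pairs of the first morphism preceding those of the second. The upward Brauer category $U_{(\delta;\varepsilon)}$ is obtained in the same way, but modulo $[f\cdot(\tau,\sigma)]=\chi_\delta(\tau)\chi_\varepsilon(\sigma)[f]$ for $(\tau,\sigma)\in S_2\wr S_t$, where $\chi_\delta(\tau)=\prod_j\chi_\delta(\tau_j)$. The upward walled Brauer category $W_\varepsilon$ has pairs of finite sets as objects; its morphisms $(X,Y)\to(U,V)$ are spanned by pairs of bijections $X\sqcup\{1,\dots,t\}\to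 U$, $Y\sqcup\{1,\dots,t\}\to V$, modulo the relations $[f\cdot\sigma]=\chi_\varepsilon(\sigma)[f]$ for $\sigma \in S_t$ acting diagonally. The downward categories are the opposite categories. **Functors.** Let $\Upsilon_\varepsilon\colon W_\varepsilon\to D_\varepsilon$ be given by $(X,Y)\mapsto X\sqcup Y$, a walled pair $(u,v)\in U\times V$ becoming the directed pair $(u,v)$; let $D_\varepsilon\to U_{(\delta;\varepsilon)}$ be the projection and $\upsilon_{(\delta;\varepsilon)}\colon W_\varepsilon\to U_{(\delta;\varepsilon)}$ the composite. Let $L_{(\delta;\varepsilon)}$ be the left adjoint of the restriction functor $\upsilon_{(\delta;\varepsilon)}^*$ from $U_{(\delta;\varepsilon)}$-modules to $W_\varepsilon$-modules. Let $\mathrm{Tr}_{(\delta;\varepsilon)}\colon U_{(\delta;\varepsilon)}\to D_\varepsilon$ be the identity on objects and $[f]\mapsto\sum_{\tau\in S_2^t}\chi_\delta(\tau)[f\cdot\tau]$ on morphisms with $t$ pairs. Let $\mathsf dJ_{(\delta;\varepsilon)}=(\mathrm{Tr}_{(\delta;\varepsilon)}^{op})^*\circ(\Upsilon_\varepsilon^{op})_*$,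 a functor from $W_\varepsilon^{op}$-modules to $U_{(\delta;\varepsilon)}^{op}$-modules, where $(\Upsilon_\varepsilon^{op})_*$ is the right adjoint of the restriction $(\Upsilon_\varepsilon^{op})^*$. **Koszul complexes.** For a $U_{(\delta;\varepsilon)}^{op}$-module $M$, the first Koszul complex of $M$ is the complex of $U_{(\delta;-\varepsilon)}$-modules with terms $U_{(\delta;-\varepsilon)}(\mathbf n,-)\otimes_{kS_n}M(\mathbf n)$, $n\ge 0$, and differential (from $n+2$ to $n$) $g\otimes m\mapsto\sum_{i<j}g[\alpha_{ij}]\otimes[\alpha_{ij}]m$, where $\alpha_{ij}\colon\mathbf n\to\mathbf{n+2}$ is the diagram with the single pair $(i,j)$ that is order preserving on $\mathbf n$. For a $W_\varepsilon^{op}$-module $F$, the walled first Koszul complex of $F$ is the complex of $W_{-\varepsilon}$-modules with terms $\bigoplus_{m+n=N}W_{-\varepsilon}((\mathbf m,\mathbf n),-)\otimes_{k(S_m\times S_n)}F(\mathbf m,\mathbf n)$ and differential (from $(m+1,n+1)$ to $(m,n)$) $g\otimes x\mapsto\sum_{i,j}g[\beta_{ij}]\otimes[\beta_{ij}]x$,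 where $1\le i\le m+1$, $1\le j\le n+1$ and $\beta_{ij}\colon(\mathbf m,\mathbf n)\to(\mathbf{m+1},\mathbf{n+1})$ is the walled diagram with the single pair $(i,j)$ that is order preserving on $\mathbf m$ and on $\mathbf n$; it vanishes on the summands with $m=0$ or $n=0$. **Theorem.** There is an isomorphism of complexes of $U_{(\delta;-\varepsilon)}$-modules, natural in the $W_\varepsilon^{op}$-module $F$, between the first Koszul complex of $\mathsf dJ_{(\delta;\varepsilon)}F$ and the complex obtained by applying $L_{(\delta;-\varepsilon)}$ to the walled first Koszul complex of $F$. -/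

import Mathlib

open CategoryTheory Opposite TensorProduct

universe w v u

set_option linter.unusedSectionVars false

noncomputable section

namespace WalledBrauer

/-! ### Modules over `k`-linear categories -/

/-- The opposite of a `k`-linear category is `k`-linear. -/
instance linearOpposite (k : Type u) [Field k] (A : Type w) [Category.{v} A] [Preadditive A]
    [Linear k A] : Linear k Aᵒᵖ where
  homModule _ _ :=
    { smul := fun a f => (a • f.unop).op
      one_smul := fun f => Quiver.Hom.unop_inj (one_smul k f.unop)
      mul_smul := fun a b f => Quiver.Hom.unop_inj (mul_smul a b f.unop)
      smul_zero := fun a => Quiver.Hom.unop_inj (smul_zero a)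
      smul_add := fun a f g => Quiver.Hom.unop_inj (smul_add a f.unop g.unop)
      add_smul := fun a b f => Quiver.Hom.unop_inj (add_smul a b f.unop)
      zero_smul := fun f => Quiver.Hom.unop_inj (zero_smul k f.unop) }
  smul_comp _ _ _ a f g := Quiver.Hom.unop_inj (Linear.comp_smul _ _ _ g.unop a f.unop)
  comp_smul _ _ _ f a g := Quiver.Hom.unop_inj (Linear.smul_comp _ _ _ a g.unop f.unop)

theorem unop_smul (k : Type u) [Field k] {A : Type w} [Category.{v} A] [Preadditive A]
    [Linear k A] {X Y : Aᵒᵖ} (a : k) (f : X ⟶ Y) : (a • f).unop = a • f.unop := rfl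

theorem op_smul (k : Type u) [Field k] {A : Type w} [Category.{v} A] [Preadditive A]
    [Linear k A] {X Y : A} (a : k) (f : X ⟶ Y) : (a • f).op = a • f.op := rfl

instance linear_op (k : Type u) [Field k] {A : Type w} [Category.{v} A] [Preadditive A]
    [Linear k A] {B : Type w} [Category.{v} B] [Preadditive B] [Linear k B]
    (Φ : A ⥤ B) [Φ.Additive] [Φ.Linear k] : Φ.op.Linear k where
  map_smul f r := Quiver.Hom.unop_inj (Φ.map_smul r f.unop)

/-- Left modules over a `k`-linear category `A`: the category of `k`-linear functors from `A` to
`k`-vector spaces. -/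
abbrev LMod (k : Type u) [Field k] (A : Type w) [Category.{v} A] [Preadditive A] [Linear k A] :=
  ObjectProperty.FullSubcategory
    (fun F : A ⥤ ModuleCat.{u} k => F.Additive ∧ F.Linear k)

namespace LMod

section Basics

variable {k : Type u} [Field k] {A : Type w} [Category.{v} A] [Preadditive A] [Linear k A]

instance (M : LMod k A) : M.obj.Additive := M.property.1
instance (M : LMod k A) : M.obj.Linear k := M.property.2

/-- The value of a module at an object. -/
abbrev val (M : LMod k A) (X : A) : Type u := M.obj.obj X

/-- The action of the morphisms, as a linear map. -/
def act (M : LMod k A) {X Y : A} (f : X ⟶ Y) : M.val X →ₗ[k] M.val Y := (M.obj.map f).hom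

theorem act_id (M : LMod k A) (X : A) (m : M.val X) : M.act (𝟙 X) m = m := by
  simp [act]

theorem act_comp (M : LMod k A) {X Y Z : A} (f : X ⟶ Y) (g : Y ⟶ Z) (m : M.val X) :
    M.act (f ≫ g) m = M.act g (M.act f m) := by
  simp [act]

theorem act_add (M : LMod k A) {X Y : A} (f g : X ⟶ Y) (m : M.val X) :
    M.act (f + g) m = M.act f m + M.act g m := by
  simp [act, Functor.map_add]

theorem act_smul (M : LMod k A) {X Y : A} (a : k) (f : X ⟶ Y) (m : M.val X) :
    M.act (a • f) m = a • M.act f m := by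
  simp [act]

/-- The component at `X` of a morphism of modules, as a linear map. -/
def homAt {M N : LMod k A} (φ : M ⟶ N) (X : A) : M.val X →ₗ[k] N.val X := (φ.hom.app X).hom

theorem homAt_act {M N : LMod k A} (φ : M ⟶ N) {X Y : A} (f : X ⟶ Y) (m : M.val X) :
    homAt φ Y (M.act f m) = N.act f (homAt φ X m) := by
  have := φ.hom.naturality f
  exact congrArg (fun t => t.hom m) this

theorem homAt_comp {M N P : LMod k A} (φ : M ⟶ N) (ψ : N ⟶ P) (X : A) (m : M.val X) :
    homAt (φ ≫ ψ) X m = homAt ψ X (homAt φ X m) := rfl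

theorem homAt_id (M : LMod k A) (X : A) (m : M.val X) : homAt (𝟙 M) X m = m := rfl

theorem homAt_add {M N : LMod k A} (φ ψ : M ⟶ N) (X : A) (m : M.val X) :
    homAt (φ + ψ) X m = homAt φ X m + homAt ψ X m := rfl

theorem homAt_zero {M N : LMod k A} (X : A) (m : M.val X) :
    homAt (0 : M ⟶ N) X m = 0 := rfl

theorem hom_ext {M N : LMod k A} {φ ψ : M ⟶ N}
    (h : ∀ X (m : M.val X), homAt φ X m = homAt ψ X m) : φ = ψ := by
  apply ObjectProperty.hom_ext
  ext X m
  exact h X m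

/-- Constructor for modules from elementary data. -/
def of (V : A → Type u) [∀ X, AddCommGroup (V X)] [∀ X, Module k (V X)]
    (a : ∀ {X Y : A}, (X ⟶ Y) → V X →ₗ[k] V Y)
    (a_id : ∀ X (m : V X), a (𝟙 X) m = m)
    (a_comp : ∀ {X Y Z : A} (f : X ⟶ Y) (g : Y ⟶ Z) (m : V X), a (f ≫ g) m = a g (a f m))
    (a_add : ∀ {X Y : A} (f g : X ⟶ Y) (m : V X), a (f + g) m = a f m + a g m)
    (a_smul : ∀ {X Y : A} (c : k) (f : X ⟶ Y) (m : V X), a (c • f) m = c • a f m) :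
    LMod k A where
  obj :=
    { obj := fun X => ModuleCat.of k (V X)
      map := fun f => ModuleCat.ofHom (a f)
      map_id := fun X => by ext m; exact a_id X m
      map_comp := fun f g => by ext m; exact a_comp f g m }
  property :=
    ⟨{ map_add := fun {X Y f g} => by ext m; exact a_add f g m },
     { map_smul := fun f c => by ext m; exact a_smul c f m }⟩

/-- Constructor for morphisms of modules from elementary data. -/
def mkHom {M N : LMod k A} (φ : ∀ X, M.val X →ₗ[k] N.val X)
    (h : ∀ {X Y : A} (f : X ⟶ Y) (m : M.val X), φ Y (M.act f m) = N.act f (φ X m)) : M ⟶ N :=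
  ObjectProperty.homMk
    { app := fun X => ModuleCat.ofHom (φ X)
      naturality := fun X Y f => by ext m; exact h f m }

theorem homAt_mkHom {M N : LMod k A} (φ : ∀ X, M.val X →ₗ[k] N.val X)
    (h : ∀ {X Y : A} (f : X ⟶ Y) (m : M.val X), φ Y (M.act f m) = N.act f (φ X m)) (X : A)
    (m : M.val X) : homAt (mkHom φ h) X m = φ X m := rfl

/-- The direct sum of a family of modules, computed objectwise. -/
def dsum {ι : Type} [DecidableEq ι] (N : ι → LMod k A) : LMod k A :=
  of (fun X => DirectSum ι fun i => (N i).val X)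
    (fun f => DirectSum.lmap fun i => (N i).act f)
    (fun X m => by
      have : (DirectSum.lmap fun i => (N i).act (𝟙 X)) = LinearMap.id := by
        ext i x : 2
        simp [act_id]
      rw [this]; rfl)
    (fun f g m => by
      have : (DirectSum.lmap fun i => (N i).act (f ≫ g)) =
          (DirectSum.lmap fun i => (N i).act g) ∘ₗ (DirectSum.lmap fun i => (N i).act f) := by
        ext i x : 2
        simp [act_comp]
      rw [this]; rfl)
    (fun f g m => by
      have : (DirectSum.lmap fun i => (N i).act (f + g)) =
          (DirectSum.lmap fun i => (N i).act f) + (DirectSum.lmap fun i => (N i).act g) := by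
        ext i x : 2
        simp [act_add]
      rw [this]; rfl)
    (fun c f m => by
      have : (DirectSum.lmap fun i => (N i).act (c • f)) =
          c • (DirectSum.lmap fun i => (N i).act f) := by
        ext i x : 2
        simp [act_smul]
      rw [this]; rfl)

/-- The inclusion of a summand. -/
def dsumIncl {ι : Type} [DecidableEq ι] (N : ι → LMod k A) (i : ι) : N i ⟶ dsum N :=
  mkHom (fun X => DirectSum.lof k ι (fun i => (N i).val X) i) (fun f m =>
    (DirectSum.lmap_lof (fun i => (N i).act f) i m).symm)

/-- The morphism out of a direct sum with given components. -/
def dsumDesc {ι : Type} [DecidableEq ι] {N : ι → LMod k A} {P : LMod k A}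
    (φ : ∀ i, N i ⟶ P) : dsum N ⟶ P :=
  mkHom (fun X => DirectSum.toModule k ι (P.val X) fun i => homAt (φ i) X) (fun {X Y} f m => by
    have : (DirectSum.toModule k ι (P.val Y) fun i => homAt (φ i) Y) ∘ₗ (dsum N).act f =
        P.act f ∘ₗ (DirectSum.toModule k ι (P.val X) fun i => homAt (φ i) X) := by
      apply DirectSum.linearMap_ext
      intro i
      ext x
      change DirectSum.toModule k ι (P.val Y) (fun i => homAt (φ i) Y)
        (DirectSum.lmap (fun i => (N i).act f)
        (DirectSum.lof k ι (fun i => (N i).val X) i x)) = P.act f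
        (DirectSum.toModule k ι (P.val X) (fun i => homAt (φ i) X)
        (DirectSum.lof k ι (fun i => (N i).val X) i x))
      rw [DirectSum.lmap_lof, DirectSum.toModule_lof, DirectSum.toModule_lof, homAt_act]
    exact LinearMap.congr_fun this m)

theorem dsumIncl_desc {ι : Type} [DecidableEq ι] {N : ι → LMod k A} {P : LMod k A}
    (φ : ∀ i, N i ⟶ P) (i : ι) : dsumIncl N i ≫ dsumDesc φ = φ i :=
  hom_ext fun X m => DirectSum.toModule_lof k (φ := fun i => homAt (φ i) X) i m

theorem dsum_hom_ext {ι : Type} [DecidableEq ι] {N : ι → LMod k A} {P : LMod k A}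
    {φ ψ : dsum N ⟶ P} (h : ∀ i, dsumIncl N i ≫ φ = dsumIncl N i ≫ ψ) : φ = ψ := by
  refine hom_ext fun X m => ?_
  have : homAt φ X = homAt ψ X := by
    apply DirectSum.linearMap_ext
    intro i
    ext x
    exact congrArg (fun t => homAt t X x) (h i)
  exact LinearMap.congr_fun this m

variable {B : Type w} [Category.{v} B] [Preadditive B] [Linear k B]

/-- Restriction of modules along a `k`-linear functor. -/
def restr (Φ : A ⥤ B) [Φ.Additive] [Φ.Linear k] : LMod k B ⥤ LMod k A where
  obj M := ⟨Φ ⋙ M.obj, inferInstance, inferInstance⟩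
  map φ := ObjectProperty.homMk (Functor.whiskerLeft Φ φ.hom)

theorem restr_act (Φ : A ⥤ B) [Φ.Additive] [Φ.Linear k] (M : LMod k B) {X Y : A} (f : X ⟶ Y)
    (m : M.val (Φ.obj X)) : ((restr Φ).obj M).act f m = M.act (Φ.map f) m := rfl

instance (Φ : A ⥤ B) [Φ.Additive] [Φ.Linear k] : (restr (k := k) Φ).Additive where
  map_add := rfl

end Basics

/-! ### Existence of the adjoints of restriction functors

`s` is a small family of objects that meets every isomorphism class of `A`. -/

section Adjoints

variable {k : Type u} [Field k] {A : Type w} [Category.{u} A] [Preadditive A] [Linear k A]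
  {B : Type w} [Category.{u} B] [Preadditive B] [Linear k B] (Φ : A ⥤ B) [Φ.Additive] [Φ.Linear k]
  {I : Type} (s : I → A)

/-- Natural families of maps `B(b, Φ a) → M(a)`. -/
def coindSub (M : LMod k A) (b : B) :
    Submodule k (∀ i, (b ⟶ Φ.obj (s i)) →ₗ[k] M.val (s i)) where
  carrier := {φ | ∀ (i j : I) (t : s i ⟶ s j) (f : b ⟶ Φ.obj (s i)),
    M.act t (φ i f) = φ j (f ≫ Φ.map t)}
  add_mem' {φ ψ} hφ hψ i j t f := by
    change M.act t (φ i f + ψ i f) = φ j _ + ψ j _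
    rw [map_add, hφ, hψ]
  zero_mem' i j t f := by
    change M.act t 0 = 0
    rw [map_zero]
  smul_mem' c φ hφ i j t f := by
    change M.act t (c • φ i f) = c • φ j _
    rw [map_smul, hφ]

/-- The coinduced module. -/
def coind (M : LMod k A) : LMod k B :=
  of (fun b => coindSub Φ s M b)
    (fun {b b'} g =>
      { toFun := fun φ => ⟨fun i => (φ.1 i) ∘ₗ Linear.leftComp k _ g, fun i j t f => by
          change M.act t (φ.1 i (g ≫ f)) = φ.1 j (g ≫ f ≫ Φ.map t)
          rw [φ.2, Category.assoc]⟩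
        map_add' := fun φ ψ => rfl
        map_smul' := fun c φ => rfl })
    (fun b φ => by
      apply Subtype.ext
      funext i
      ext f
      change φ.1 i (𝟙 b ≫ f) = φ.1 i f
      rw [Category.id_comp])
    (fun f g φ => by
      apply Subtype.ext
      funext i
      ext h
      change φ.1 i ((f ≫ g) ≫ h) = φ.1 i (f ≫ g ≫ h)
      rw [Category.assoc])
    (fun f g φ => by
      apply Subtype.ext
      funext i
      ext h
      change φ.1 i ((f + g) ≫ h) = φ.1 i (f ≫ h) + φ.1 i (g ≫ h)
      rw [Preadditive.add_comp, map_add])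
    (fun c f φ => by
      apply Subtype.ext
      funext i
      ext h
      change φ.1 i ((c • f) ≫ h) = c • φ.1 i (f ≫ h)
      rw [Linear.smul_comp, map_smul])

/-- A morphism out of a restricted module, as a family of linear maps. -/
def outAt {N : LMod k B} {M : LMod k A} (ψ : (restr Φ).obj N ⟶ M) (a : A) :
    N.val (Φ.obj a) →ₗ[k] M.val a := homAt ψ a

theorem outAt_act {N : LMod k B} {M : LMod k A} (ψ : (restr Φ).obj N ⟶ M) {a a' : A}
    (t : a ⟶ a') (x : N.val (Φ.obj a)) :
    outAt Φ ψ a' (N.act (Φ.map t) x) = M.act t (outAt Φ ψ a x) := homAt_act ψ t x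

/-- Constructor for morphisms out of a restricted module. -/
def mkOut {N : LMod k B} {M : LMod k A} (φ : ∀ a, N.val (Φ.obj a) →ₗ[k] M.val a)
    (h : ∀ {a a' : A} (t : a ⟶ a') (x : N.val (Φ.obj a)),
      φ a' (N.act (Φ.map t) x) = M.act t (φ a x)) : (restr Φ).obj N ⟶ M := mkHom φ h

theorem outAt_mkOut {N : LMod k B} {M : LMod k A} (φ : ∀ a, N.val (Φ.obj a) →ₗ[k] M.val a)
    (h : ∀ {a a' : A} (t : a ⟶ a') (x : N.val (Φ.obj a)),
      φ a' (N.act (Φ.map t) x) = M.act t (φ a x)) (a : A) : outAt Φ (mkOut Φ φ h) a = φ a := rfl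

theorem out_ext {N : LMod k B} {M : LMod k A} {φ ψ : (restr Φ).obj N ⟶ M}
    (h : ∀ a x, outAt Φ φ a x = outAt Φ ψ a x) : φ = ψ := hom_ext h

/-- A morphism to a coinduced module, as a family of maps. -/
def coindAt {N : LMod k B} {M : LMod k A} (θ : N ⟶ coind Φ s M) (b : B) (x : N.val b) (i : I) :
    (b ⟶ Φ.obj (s i)) →ₗ[k] M.val (s i) :=
  (show coindSub Φ s M b from homAt θ b x).1 i

theorem coindAt_add {N : LMod k B} {M : LMod k A} (θ : N ⟶ coind Φ s M) (b : B) (x y : N.val b)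
    (i : I) : coindAt Φ s θ b (x + y) i = coindAt Φ s θ b x i + coindAt Φ s θ b y i := by
  unfold coindAt
  rw [map_add]
  rfl

theorem coindAt_smul {N : LMod k B} {M : LMod k A} (θ : N ⟶ coind Φ s M) (b : B) (c : k)
    (x : N.val b) (i : I) : coindAt Φ s θ b (c • x) i = c • coindAt Φ s θ b x i := by
  unfold coindAt
  rw [map_smul]
  rfl

theorem coindAt_act {N : LMod k B} {M : LMod k A} (θ : N ⟶ coind Φ s M) {b b' : B} (g : b ⟶ b')
    (x : N.val b) (i : I) (f : b' ⟶ Φ.obj (s i)) :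
    coindAt Φ s θ b' (N.act g x) i f = coindAt Φ s θ b x i (g ≫ f) := by
  unfold coindAt
  rw [homAt_act]
  rfl

theorem coindAt_nat {N : LMod k B} {M : LMod k A} (θ : N ⟶ coind Φ s M) (b : B) (x : N.val b)
    {i j : I} (t : s i ⟶ s j) (f : b ⟶ Φ.obj (s i)) :
    M.act t (coindAt Φ s θ b x i f) = coindAt Φ s θ b x j (f ≫ Φ.map t) :=
  (show coindSub Φ s M b from homAt θ b x).2 i j t f

theorem coind_hom_ext {N : LMod k B} {M : LMod k A} {θ θ' : N ⟶ coind Φ s M}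
    (h : ∀ b x i f, coindAt Φ s θ b x i f = coindAt Φ s θ' b x i f) : θ = θ' :=
  hom_ext fun b x => Subtype.ext (funext fun i => LinearMap.ext (h b x i))

/-- Constructor for morphisms to a coinduced module. -/
def mkCoind {N : LMod k B} {M : LMod k A}
    (φ : ∀ b i, N.val b →ₗ[k] (b ⟶ Φ.obj (s i)) →ₗ[k] M.val (s i))
    (h : ∀ b (x : N.val b) i j (t : s i ⟶ s j) (f : b ⟶ Φ.obj (s i)),
      M.act t (φ b i x f) = φ b j x (f ≫ Φ.map t))
    (h' : ∀ {b b'} (g : b ⟶ b') (x : N.val b) i (f : b' ⟶ Φ.obj (s i)),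
      φ b' i (N.act g x) f = φ b i x (g ≫ f)) : N ⟶ coind Φ s M :=
  mkHom (fun b => LinearMap.codRestrict (coindSub Φ s M b) (LinearMap.pi fun i => φ b i)
    (fun x => h b x))
    (fun g x => Subtype.ext (funext fun i => LinearMap.ext (h' g x i)))

theorem coindAt_mk {N : LMod k B} {M : LMod k A}
    (φ : ∀ b i, N.val b →ₗ[k] (b ⟶ Φ.obj (s i)) →ₗ[k] M.val (s i))
    (h : ∀ b (x : N.val b) i j (t : s i ⟶ s j) (f : b ⟶ Φ.obj (s i)),
      M.act t (φ b i x f) = φ b j x (f ≫ Φ.map t))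
    (h' : ∀ {b b'} (g : b ⟶ b') (x : N.val b) i (f : b' ⟶ Φ.obj (s i)),
      φ b' i (N.act g x) f = φ b i x (g ≫ f)) (b : B) (x : N.val b) (i : I) :
    coindAt Φ s (mkCoind Φ s φ h h') b x i = φ b i x := rfl

/-- The adjunction bijection for coinduction. -/
def coindEquiv (i₀ : A → I) (u₀ : ∀ a, s (i₀ a) ≅ a) (N : LMod k B) (M : LMod k A) :
    ((restr Φ).obj N ⟶ M) ≃ (N ⟶ coind Φ s M) where
  toFun ψ := mkCoind Φ s
    (fun b i => LinearMap.mk₂ k (fun x f => outAt Φ ψ (s i) (N.act f x))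
      (fun x y f => by rw [map_add, map_add]) (fun c x f => by rw [map_smul, map_smul])
      (fun x f g => by rw [act_add, map_add]) (fun c x f => by rw [act_smul, map_smul]))
    (fun b x i j t f => by
      change M.act t (outAt Φ ψ (s i) (N.act f x)) = outAt Φ ψ (s j) (N.act (f ≫ Φ.map t) x)
      rw [act_comp, outAt_act])
    (fun g x i f => by
      change outAt Φ ψ (s i) (N.act f (N.act g x)) = outAt Φ ψ (s i) (N.act (g ≫ f) x)
      rw [act_comp])
  invFun θ := mkOut Φ
    (fun a =>
      { toFun := fun x => M.act (u₀ a).hom (coindAt Φ s θ (Φ.obj a) x (i₀ a) (Φ.map (u₀ a).inv))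
        map_add' := fun x y => by rw [coindAt_add, LinearMap.add_apply, map_add]
        map_smul' := fun c x => by
          rw [coindAt_smul, LinearMap.smul_apply, map_smul, RingHom.id_apply] })
    (fun {a a'} t x => by
      change M.act (u₀ a').hom (coindAt Φ s θ (Φ.obj a') (N.act (Φ.map t) x) (i₀ a')
          (Φ.map (u₀ a').inv)) =
        M.act t (M.act (u₀ a).hom (coindAt Φ s θ (Φ.obj a) x (i₀ a) (Φ.map (u₀ a).inv)))
      have h := coindAt_nat Φ s θ (Φ.obj a) x ((u₀ a).hom ≫ t ≫ (u₀ a').inv) (Φ.map (u₀ a).inv)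
      rw [← Φ.map_comp, Iso.inv_hom_id_assoc, Φ.map_comp] at h
      rw [coindAt_act, ← h, ← act_comp, ← act_comp, Category.assoc, Category.assoc,
        Iso.inv_hom_id, Category.comp_id])
  left_inv ψ := out_ext Φ fun a x => by
    rw [outAt_mkOut]
    change M.act (u₀ a).hom (outAt Φ ψ (s (i₀ a)) (N.act (Φ.map (u₀ a).inv) x)) = outAt Φ ψ a x
    rw [← outAt_act, ← act_comp, ← Φ.map_comp, Iso.inv_hom_id, Φ.map_id, act_id]
  right_inv θ := coind_hom_ext Φ s fun b x i f => by
    rw [coindAt_mk]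
    change M.act (u₀ (s i)).hom (coindAt Φ s θ (Φ.obj (s i)) (N.act f x) (i₀ (s i))
      (Φ.map (u₀ (s i)).inv)) = coindAt Φ s θ b x i f
    rw [coindAt_act, coindAt_nat, Category.assoc, ← Φ.map_comp, Iso.inv_hom_id, Φ.map_id,
      Category.comp_id]

theorem restr_isLeftAdjoint (hs : ∀ a : A, ∃ i, Nonempty (s i ≅ a)) :
    (restr (k := k) Φ).IsLeftAdjoint := by
  choose i₀ u₀ using hs
  exact (Adjunction.adjunctionOfEquivRight (coindEquiv Φ s i₀ fun a => (u₀ a).some)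
    (fun N' N M f g => coind_hom_ext Φ s fun b x i h =>
      congrArg (outAt Φ g (s i)) (homAt_act f h x))).isLeftAdjoint

/-- The relations `f Φ(t) ⊗ m = f ⊗ t m` that define `B ⊗_A M`. -/
def indSub [DecidableEq I] (M : LMod k A) (b : B) :
    Submodule k (DirectSum I fun i => (Φ.obj (s i) ⟶ b) ⊗[k] M.val (s i)) :=
  Submodule.span k {z | ∃ (i j : I) (t : s i ⟶ s j) (f : Φ.obj (s j) ⟶ b) (m : M.val (s i)),
    z = DirectSum.lof k I (fun i => (Φ.obj (s i) ⟶ b) ⊗[k] M.val (s i)) i ((Φ.map t ≫ f) ⊗ₜ m) -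
      DirectSum.lof k I (fun i => (Φ.obj (s i) ⟶ b) ⊗[k] M.val (s i)) j (f ⊗ₜ M.act t m)}

/-- The class of `f ⊗ m`. -/
def indMk [DecidableEq I] (M : LMod k A) (b : B) (i : I) :
    (Φ.obj (s i) ⟶ b) →ₗ[k] M.val (s i) →ₗ[k] (_ ⧸ indSub Φ s M b) :=
  (TensorProduct.mk k (Φ.obj (s i) ⟶ b) (M.val (s i))).compr₂
    ((indSub Φ s M b).mkQ ∘ₗ DirectSum.lof k I (fun i => (Φ.obj (s i) ⟶ b) ⊗[k] M.val (s i)) i)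

theorem indMk_rel [DecidableEq I] (M : LMod k A) (b : B) {i j : I} (t : s i ⟶ s j)
    (f : Φ.obj (s j) ⟶ b) (m : M.val (s i)) :
    indMk Φ s M b i (Φ.map t ≫ f) m = indMk Φ s M b j f (M.act t m) :=
  (Submodule.Quotient.eq _).2 (Submodule.subset_span ⟨i, j, t, f, m, rfl⟩)

theorem ind_hom_ext [DecidableEq I] (M : LMod k A) (b : B) {V : Type u} [AddCommGroup V]
    [Module k V] {φ ψ : (_ ⧸ indSub Φ s M b) →ₗ[k] V}
    (h : ∀ i f m, φ (indMk Φ s M b i f m) = ψ (indMk Φ s M b i f m)) : φ = ψ := by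
  apply Submodule.linearMap_qext
  apply DirectSum.linearMap_ext
  intro i
  apply TensorProduct.ext'
  intro f m
  exact h i f m

/-- Linear maps out of the induced module. -/
def indLift [DecidableEq I] (M : LMod k A) (b : B) {V : Type u} [AddCommGroup V]
    [Module k V] (φ : ∀ i, (Φ.obj (s i) ⟶ b) →ₗ[k] M.val (s i) →ₗ[k] V)
    (h : ∀ (i j : I) (t : s i ⟶ s j) (f : Φ.obj (s j) ⟶ b) (m : M.val (s i)),
      φ i (Φ.map t ≫ f) m = φ j f (M.act t m)) : (_ ⧸ indSub Φ s M b) →ₗ[k] V :=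
  (indSub Φ s M b).liftQ (DirectSum.toModule k I V fun i => TensorProduct.lift (φ i)) (by
    rw [indSub, Submodule.span_le]
    rintro _ ⟨i, j, t, f, m, rfl⟩
    rw [SetLike.mem_coe, LinearMap.mem_ker, map_sub, DirectSum.toModule_lof,
      DirectSum.toModule_lof, TensorProduct.lift.tmul, TensorProduct.lift.tmul, h, sub_self])

theorem indLift_mk [DecidableEq I] (M : LMod k A) (b : B) {V : Type u} [AddCommGroup V]
    [Module k V] (φ : ∀ i, (Φ.obj (s i) ⟶ b) →ₗ[k] M.val (s i) →ₗ[k] V)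
    (h : ∀ (i j : I) (t : s i ⟶ s j) (f : Φ.obj (s j) ⟶ b) (m : M.val (s i)),
      φ i (Φ.map t ≫ f) m = φ j f (M.act t m)) (i : I) (f : Φ.obj (s i) ⟶ b) (m : M.val (s i)) :
    indLift Φ s M b φ h (indMk Φ s M b i f m) = φ i f m := by
  change (DirectSum.toModule k I V fun i => TensorProduct.lift (φ i))
    (DirectSum.lof k I (fun i => (Φ.obj (s i) ⟶ b) ⊗[k] M.val (s i)) i (f ⊗ₜ m)) = _
  rw [DirectSum.toModule_lof, TensorProduct.lift.tmul]

/-- The action of a morphism on the induced module. -/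
def indAct [DecidableEq I] (M : LMod k A) {b b' : B} (g : b ⟶ b') :
    (_ ⧸ indSub Φ s M b) →ₗ[k] (_ ⧸ indSub Φ s M b') :=
  indLift Φ s M b (fun i => (indMk Φ s M b' i) ∘ₗ Linear.rightComp k _ g) (fun i j t f m => by
    change indMk Φ s M b' i ((Φ.map t ≫ f) ≫ g) m = indMk Φ s M b' j (f ≫ g) (M.act t m)
    rw [Category.assoc, indMk_rel])

theorem indAct_mk [DecidableEq I] (M : LMod k A) {b b' : B} (g : b ⟶ b') (i : I)
    (f : Φ.obj (s i) ⟶ b) (m : M.val (s i)) :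
    indAct Φ s M g (indMk Φ s M b i f m) = indMk Φ s M b' i (f ≫ g) m :=
  indLift_mk _ _ _ _ _ _ _ _ _

/-- The induced module `B ⊗_A M`. -/
def ind [DecidableEq I] (M : LMod k A) : LMod k B :=
  of (fun b => _ ⧸ indSub Φ s M b) (fun g => indAct Φ s M g)
    (fun b => LinearMap.congr_fun (g := LinearMap.id) (ind_hom_ext Φ s M b fun i f m => by
      rw [indAct_mk, Category.comp_id]; rfl))
    (fun {b b' b''} g g' => LinearMap.congr_fun (g := indAct Φ s M g' ∘ₗ indAct Φ s M g)
      (ind_hom_ext Φ s M b fun i f m => by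
        rw [LinearMap.comp_apply, indAct_mk, indAct_mk, indAct_mk, Category.assoc]))
    (fun {b b'} g g' => LinearMap.congr_fun (g := indAct Φ s M g + indAct Φ s M g')
      (ind_hom_ext Φ s M b fun i f m => by
        rw [LinearMap.add_apply, indAct_mk, indAct_mk, indAct_mk, Preadditive.comp_add, map_add,
          LinearMap.add_apply]))
    (fun {b b'} c g => LinearMap.congr_fun (g := c • indAct Φ s M g)
      (ind_hom_ext Φ s M b fun i f m => by
        rw [LinearMap.smul_apply, indAct_mk, indAct_mk, Linear.comp_smul, map_smul,
          LinearMap.smul_apply]))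

/-- A morphism to a restricted module, as a family of linear maps. -/
def inAt {M : LMod k A} {N : LMod k B} (ψ : M ⟶ (restr Φ).obj N) (a : A) :
    M.val a →ₗ[k] N.val (Φ.obj a) := homAt ψ a

theorem inAt_act {M : LMod k A} {N : LMod k B} (ψ : M ⟶ (restr Φ).obj N) {a a' : A}
    (t : a ⟶ a') (x : M.val a) :
    inAt Φ ψ a' (M.act t x) = N.act (Φ.map t) (inAt Φ ψ a x) := homAt_act ψ t x

/-- Constructor for morphisms to a restricted module. -/
def mkIn {M : LMod k A} {N : LMod k B} (φ : ∀ a, M.val a →ₗ[k] N.val (Φ.obj a))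
    (h : ∀ {a a' : A} (t : a ⟶ a') (x : M.val a),
      φ a' (M.act t x) = N.act (Φ.map t) (φ a x)) : M ⟶ (restr Φ).obj N := mkHom φ h

theorem inAt_mkIn {M : LMod k A} {N : LMod k B} (φ : ∀ a, M.val a →ₗ[k] N.val (Φ.obj a))
    (h : ∀ {a a' : A} (t : a ⟶ a') (x : M.val a),
      φ a' (M.act t x) = N.act (Φ.map t) (φ a x)) (a : A) : inAt Φ (mkIn Φ φ h) a = φ a := rfl

theorem in_ext {M : LMod k A} {N : LMod k B} {φ ψ : M ⟶ (restr Φ).obj N}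
    (h : ∀ a x, inAt Φ φ a x = inAt Φ ψ a x) : φ = ψ := hom_ext h

/-- A morphism out of an induced module, as a family of linear maps. -/
def indAt [DecidableEq I] {M : LMod k A} {N : LMod k B} (θ : ind Φ s M ⟶ N) (b : B) :
    (_ ⧸ indSub Φ s M b) →ₗ[k] N.val b := homAt θ b

theorem indAt_act [DecidableEq I] {M : LMod k A} {N : LMod k B} (θ : ind Φ s M ⟶ N) {b b' : B}
    (g : b ⟶ b') (i : I) (f : Φ.obj (s i) ⟶ b) (m : M.val (s i)) :
    N.act g (indAt Φ s θ b (indMk Φ s M b i f m)) =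
      indAt Φ s θ b' (indMk Φ s M b' i (f ≫ g) m) := by
  rw [← indAct_mk]
  exact (homAt_act θ g _).symm

theorem ind_ext [DecidableEq I] {M : LMod k A} {N : LMod k B} {θ θ' : ind Φ s M ⟶ N}
    (h : ∀ b i f m, indAt Φ s θ b (indMk Φ s M b i f m) = indAt Φ s θ' b (indMk Φ s M b i f m)) :
    θ = θ' :=
  hom_ext fun b => LinearMap.congr_fun (f := indAt Φ s θ b) (g := indAt Φ s θ' b)
    (ind_hom_ext Φ s M b (h b))

/-- Constructor for morphisms out of an induced module. -/
def mkInd [DecidableEq I] {M : LMod k A} {N : LMod k B}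
    (φ : ∀ b i, (Φ.obj (s i) ⟶ b) →ₗ[k] M.val (s i) →ₗ[k] N.val b)
    (h : ∀ b (i j : I) (t : s i ⟶ s j) (f : Φ.obj (s j) ⟶ b) (m : M.val (s i)),
      φ b i (Φ.map t ≫ f) m = φ b j f (M.act t m))
    (h' : ∀ {b b'} (g : b ⟶ b') (i : I) (f : Φ.obj (s i) ⟶ b) (m : M.val (s i)),
      φ b' i (f ≫ g) m = N.act g (φ b i f m)) : ind Φ s M ⟶ N :=
  mkHom (fun b => indLift Φ s M b (φ b) (h b)) (fun {b b'} g =>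
    LinearMap.congr_fun (f := indLift Φ s M b' (φ b') (h b') ∘ₗ indAct Φ s M g)
      (g := N.act g ∘ₗ indLift Φ s M b (φ b) (h b)) (ind_hom_ext Φ s M b fun i f m => by
        rw [LinearMap.comp_apply, LinearMap.comp_apply, indAct_mk, indLift_mk, indLift_mk, h']))

theorem indAt_mkInd [DecidableEq I] {M : LMod k A} {N : LMod k B}
    (φ : ∀ b i, (Φ.obj (s i) ⟶ b) →ₗ[k] M.val (s i) →ₗ[k] N.val b)
    (h : ∀ b (i j : I) (t : s i ⟶ s j) (f : Φ.obj (s j) ⟶ b) (m : M.val (s i)),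
      φ b i (Φ.map t ≫ f) m = φ b j f (M.act t m))
    (h' : ∀ {b b'} (g : b ⟶ b') (i : I) (f : Φ.obj (s i) ⟶ b) (m : M.val (s i)),
      φ b' i (f ≫ g) m = N.act g (φ b i f m)) (b : B) (i : I) (f : Φ.obj (s i) ⟶ b)
    (m : M.val (s i)) :
    indAt Φ s (mkInd Φ s φ h h') b (indMk Φ s M b i f m) = φ b i f m :=
  indLift_mk Φ s M b (φ b) (h b) i f m

/-- The action maps of the morphism out of `ind M` that corresponds to `M ⟶ Φ^* N`. -/
def inBil {M : LMod k A} {N : LMod k B} (ψ : M ⟶ (restr Φ).obj N) (b : B) (i : I) :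
    (Φ.obj (s i) ⟶ b) →ₗ[k] M.val (s i) →ₗ[k] N.val b :=
  LinearMap.mk₂ k (fun f m => N.act f (inAt Φ ψ (s i) m))
    (fun f g m => act_add N f g _) (fun c f m => act_smul N c f _)
    (fun f m m' => by rw [map_add, map_add]) (fun c f m => by rw [map_smul, map_smul])

theorem inBil_apply {M : LMod k A} {N : LMod k B} (ψ : M ⟶ (restr Φ).obj N) (b : B) (i : I)
    (f : Φ.obj (s i) ⟶ b) (m : M.val (s i)) :
    inBil Φ s ψ b i f m = N.act f (inAt Φ ψ (s i) m) := rfl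

theorem inBil_rel {M : LMod k A} {N : LMod k B} (ψ : M ⟶ (restr Φ).obj N) (b : B) (i j : I)
    (t : s i ⟶ s j) (f : Φ.obj (s j) ⟶ b) (m : M.val (s i)) :
    inBil Φ s ψ b i (Φ.map t ≫ f) m = inBil Φ s ψ b j f (M.act t m) := by
  rw [inBil_apply, inBil_apply, act_comp, inAt_act]

/-- One direction of the adjunction bijection for induction. -/
def indTo [DecidableEq I] (i₀ : A → I) (u₀ : ∀ a, s (i₀ a) ≅ a) {M : LMod k A}
    {N : LMod k B} (θ : ind Φ s M ⟶ N) : M ⟶ (restr Φ).obj N :=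
  mkIn Φ
    (fun a => indAt Φ s θ (Φ.obj a) ∘ₗ indMk Φ s M (Φ.obj a) (i₀ a) (Φ.map (u₀ a).hom) ∘ₗ
      M.act (u₀ a).inv)
    (fun {a a'} t m => by
      change indAt Φ s θ (Φ.obj a') (indMk Φ s M (Φ.obj a') (i₀ a') (Φ.map (u₀ a').hom)
          (M.act (u₀ a').inv (M.act t m))) =
        N.act (Φ.map t) (indAt Φ s θ (Φ.obj a) (indMk Φ s M (Φ.obj a) (i₀ a) (Φ.map (u₀ a).hom)
          (M.act (u₀ a).inv m)))
      have h := indMk_rel Φ s M (Φ.obj a') ((u₀ a).hom ≫ t ≫ (u₀ a').inv)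
        (Φ.map (u₀ a').hom) (M.act (u₀ a).inv m)
      rw [← Φ.map_comp, Category.assoc, Category.assoc, Iso.inv_hom_id, Category.comp_id,
        Φ.map_comp, ← act_comp, Iso.inv_hom_id_assoc, act_comp] at h
      rw [indAt_act, h])

theorem inAt_indTo [DecidableEq I] (i₀ : A → I) (u₀ : ∀ a, s (i₀ a) ≅ a) {M : LMod k A}
    {N : LMod k B} (θ : ind Φ s M ⟶ N) (a : A) (m : M.val a) :
    inAt Φ (indTo Φ s i₀ u₀ θ) a m = indAt Φ s θ (Φ.obj a)
      (indMk Φ s M (Φ.obj a) (i₀ a) (Φ.map (u₀ a).hom) (M.act (u₀ a).inv m)) := rfl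

/-- The other direction of the adjunction bijection for induction. -/
def indFrom [DecidableEq I] {M : LMod k A} {N : LMod k B} (ψ : M ⟶ (restr Φ).obj N) :
    ind Φ s M ⟶ N :=
  mkInd Φ s (inBil Φ s ψ) (inBil_rel Φ s ψ) (fun g _ f _ => act_comp N f g _)

theorem indAt_indFrom [DecidableEq I] {M : LMod k A} {N : LMod k B} (ψ : M ⟶ (restr Φ).obj N)
    (b : B) (i : I) (f : Φ.obj (s i) ⟶ b) (m : M.val (s i)) :
    indAt Φ s (indFrom Φ s ψ) b (indMk Φ s M b i f m) = N.act f (inAt Φ ψ (s i) m) :=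
  indLift_mk Φ s M b (inBil Φ s ψ b) (inBil_rel Φ s ψ b) i f m

/-- The adjunction bijection for induction. -/
def indEquiv [DecidableEq I] (i₀ : A → I) (u₀ : ∀ a, s (i₀ a) ≅ a) (M : LMod k A)
    (N : LMod k B) : (ind Φ s M ⟶ N) ≃ (M ⟶ (restr Φ).obj N) where
  toFun := indTo Φ s i₀ u₀
  invFun := indFrom Φ s
  left_inv θ := ind_ext Φ s fun b i f m => by
    rw [indAt_indFrom, inAt_indTo, indAt_act, indMk_rel, ← act_comp, Iso.inv_hom_id, act_id]
  right_inv ψ := in_ext Φ fun a x => by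
    rw [inAt_indTo, indAt_indFrom, ← inAt_act, ← act_comp, Iso.inv_hom_id, act_id]

theorem restr_isRightAdjoint (hs : ∀ a : A, ∃ i, Nonempty (s i ≅ a)) :
    (restr (k := k) Φ).IsRightAdjoint := by
  classical
  choose i₀ u₀ using hs
  exact (Adjunction.adjunctionOfEquivLeft (indEquiv Φ s i₀ fun a => (u₀ a).some)
    (fun M N N' g h => in_ext Φ fun a x => rfl)).isRightAdjoint

end Adjoints

end LMod

/-! ### Categories of ordered diagrams -/

/-- Objects of the ordered upward directed Brauer category: finite sets. -/
structure DirOrd where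
  carrier : Type
  [finite : Finite carrier]

/-- A morphism `A → B` of the ordered upward directed Brauer category: an integer `deg` (the number
of ordered pairs) and a bijection `A ⊔ (Fin 2 × Fin deg) ≃ B`. The `j`-th directed pair is
`(e (0, j), e (1, j))`. -/
structure DirHom (A B : Type) where
  deg : ℕ
  e : A ⊕ (Fin 2 × Fin deg) ≃ B

namespace DirHom

variable {A B C D : Type}

theorem ext' {f g : DirHom A B} (h : f.deg = g.deg) (h₁ : ∀ a, f.e (Sum.inl a) = g.e (Sum.inl a))
    (h₂ : ∀ c j, f.e (Sum.inr (c, j)) = g.e (Sum.inr (c, Fin.cast h j))) : f = g := by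
  obtain ⟨n, f⟩ := f
  obtain ⟨m, g⟩ := g
  obtain rfl : n = m := h
  congr 1
  ext x
  rcases x with a | ⟨c, j⟩
  · exact h₁ a
  · exact h₂ c j

/-- The identity. -/
def id (A : Type) : DirHom A A := ⟨0, Equiv.sumEmpty A (Fin 2 × Fin 0)⟩

/-- The bijection underlying a composite; the pairs of `e` come before those of `e'`. -/
def glue {s t : ℕ} (e : A ⊕ (Fin 2 × Fin s) ≃ B) (e' : B ⊕ (Fin 2 × Fin t) ≃ C) :
    A ⊕ (Fin 2 × Fin (s + t)) ≃ C :=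
  ((Equiv.sumCongr (Equiv.refl A)
    ((Equiv.prodCongr (Equiv.refl (Fin 2)) finSumFinEquiv.symm).trans
      (Equiv.prodSumDistrib _ _ _))).trans
    ((Equiv.sumAssoc _ _ _).symm.trans (Equiv.sumCongr e (Equiv.refl _)))).trans e'

theorem glue_inl {s t : ℕ} (e : A ⊕ (Fin 2 × Fin s) ≃ B) (e' : B ⊕ (Fin 2 × Fin t) ≃ C) (a : A) :
    glue e e' (Sum.inl a) = e' (Sum.inl (e (Sum.inl a))) := rfl

theorem glue_castAdd {s t : ℕ} (e : A ⊕ (Fin 2 × Fin s) ≃ B) (e' : B ⊕ (Fin 2 × Fin t) ≃ C)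
    (c : Fin 2) (j : Fin s) :
    glue e e' (Sum.inr (c, Fin.castAdd t j)) = e' (Sum.inl (e (Sum.inr (c, j)))) := by
  have h := finSumFinEquiv_symm_apply_castAdd (n := t) j
  simp only [glue, Equiv.trans_apply, Equiv.sumCongr_apply, Sum.map_inr, Equiv.prodCongr_apply,
    Prod.map_apply, Equiv.coe_refl, id_eq, h]
  rfl

theorem glue_natAdd {s t : ℕ} (e : A ⊕ (Fin 2 × Fin s) ≃ B) (e' : B ⊕ (Fin 2 × Fin t) ≃ C)
    (c : Fin 2) (j : Fin t) :
    glue e e' (Sum.inr (c, Fin.natAdd s j)) = e' (Sum.inr (c, j)) := by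
  have h := finSumFinEquiv_symm_apply_natAdd (m := s) j
  simp only [glue, Equiv.trans_apply, Equiv.sumCongr_apply, Sum.map_inr, Equiv.prodCongr_apply,
    Prod.map_apply, Equiv.coe_refl, id_eq, h]
  rfl

/-- Composition; the pairs of `f` come before those of `g`. -/
def comp (f : DirHom A B) (g : DirHom B C) : DirHom A C := ⟨f.deg + g.deg, glue f.e g.e⟩

theorem glue_id {t : ℕ} (e' : A ⊕ (Fin 2 × Fin t) ≃ C) (c : Fin 2) (j : Fin (0 + t)) :
    glue (Equiv.sumEmpty A (Fin 2 × Fin 0)) e' (Sum.inr (c, j)) =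
      e' (Sum.inr (c, Fin.cast (Nat.zero_add t) j)) := by
  refine Fin.addCases (fun i => i.elim0) (fun j => ?_) j
  rw [glue_natAdd]
  congr 3
  ext
  simp

theorem glue_assoc {s t u : ℕ} (e : A ⊕ (Fin 2 × Fin s) ≃ B) (e' : B ⊕ (Fin 2 × Fin t) ≃ C)
    (e'' : C ⊕ (Fin 2 × Fin u) ≃ D) (c : Fin 2) (j : Fin (s + t + u)) :
    glue (glue e e') e'' (Sum.inr (c, j)) =
      glue e (glue e' e'') (Sum.inr (c, Fin.cast (Nat.add_assoc s t u) j)) := by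
  refine Fin.addCases (fun j => ?_) (fun j => ?_) j
  · refine Fin.addCases (fun j => ?_) (fun j => ?_) j
    · rw [glue_castAdd, glue_castAdd]
      exact (glue_castAdd e (glue e' e'') c j).symm
    · rw [glue_castAdd, glue_natAdd]
      refine Eq.trans (Eq.trans (glue_castAdd e' e'' c j).symm
        (glue_natAdd e (glue e' e'') c (Fin.castAdd u j)).symm) ?_
      congr 3
  · rw [glue_natAdd]
    refine Eq.trans (Eq.trans (glue_natAdd e' e'' c j).symm
      (glue_natAdd e (glue e' e'') c (Fin.natAdd t j)).symm) ?_
    congr 3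
    ext
    simp [Nat.add_assoc]

theorem id_comp (f : DirHom A B) : (id A).comp f = f :=
  ext' (Nat.zero_add _) (fun _ => rfl) (glue_id f.e)

theorem comp_id (f : DirHom A B) : f.comp (id B) = f :=
  ext' rfl (fun _ => rfl) (glue_castAdd f.e _)

theorem comp_assoc (f : DirHom A B) (g : DirHom B C) (h : DirHom C D) :
    (f.comp g).comp h = f.comp (g.comp h) :=
  ext' (Nat.add_assoc _ _ _) (fun _ => rfl) (glue_assoc f.e g.e h.e)

end DirHom

instance : Category DirOrd where
  Hom A B := DirHom A.carrier B.carrier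
  id A := DirHom.id A.carrier
  comp f g := DirHom.comp f g
  id_comp f := DirHom.id_comp f
  comp_id f := DirHom.comp_id f
  assoc f g h := DirHom.comp_assoc f g h

/-- Objects of the ordered upward walled Brauer category: pairs of finite sets. -/
structure WalOrd where
  fst : Type
  snd : Type
  [finite_fst : Finite fst]
  [finite_snd : Finite snd]

/-- A morphism `(X, Y) → (U, V)` of the ordered upward walled Brauer category: an integer `deg` and
bijections `X ⊔ Fin deg ≃ U` and `Y ⊔ Fin deg ≃ V`. The `j`-th walled pair is `(e₁ j, e₂ j)`. -/
structure WalHom (X Y U V : Type) where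
  deg : ℕ
  e₁ : X ⊕ Fin deg ≃ U
  e₂ : Y ⊕ Fin deg ≃ V

namespace WalHom

variable {X Y U V S T P Q : Type}

theorem ext' {f g : WalHom X Y U V} (h : f.deg = g.deg)
    (h₁ : ∀ x, f.e₁ (Sum.inl x) = g.e₁ (Sum.inl x))
    (h₁' : ∀ j, f.e₁ (Sum.inr j) = g.e₁ (Sum.inr (Fin.cast h j)))
    (h₂ : ∀ y, f.e₂ (Sum.inl y) = g.e₂ (Sum.inl y))
    (h₂' : ∀ j, f.e₂ (Sum.inr j) = g.e₂ (Sum.inr (Fin.cast h j))) : f = g := by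
  obtain ⟨n, f, f'⟩ := f
  obtain ⟨m, g, g'⟩ := g
  obtain rfl : n = m := h
  obtain rfl : f = g := by
    ext x
    rcases x with a | j
    · exact h₁ a
    · exact h₁' j
  obtain rfl : f' = g' := by
    ext x
    rcases x with a | j
    · exact h₂ a
    · exact h₂' j
  rfl

/-- Composition of one half of a walled diagram. -/
def half {s t : ℕ} (e : X ⊕ Fin s ≃ U) (e' : U ⊕ Fin t ≃ S) : X ⊕ Fin (s + t) ≃ S :=
  ((Equiv.sumCongr (Equiv.refl X) finSumFinEquiv.symm).trans
    ((Equiv.sumAssoc _ _ _).symm.trans (Equiv.sumCongr e (Equiv.refl _)))).trans e'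

theorem half_inl {s t : ℕ} (e : X ⊕ Fin s ≃ U) (e' : U ⊕ Fin t ≃ S) (x : X) :
    half e e' (Sum.inl x) = e' (Sum.inl (e (Sum.inl x))) := rfl
theorem half_castAdd {s t : ℕ} (e : X ⊕ Fin s ≃ U) (e' : U ⊕ Fin t ≃ S) (j : Fin s) :
    half e e' (Sum.inr (Fin.castAdd t j)) = e' (Sum.inl (e (Sum.inr j))) := by
  simp [half]
theorem half_natAdd {s t : ℕ} (e : X ⊕ Fin s ≃ U) (e' : U ⊕ Fin t ≃ S) (j : Fin t) :
    half e e' (Sum.inr (Fin.natAdd s j)) = e' (Sum.inr j) := by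
  simp [half]

/-- The identity. -/
def id (X Y : Type) : WalHom X Y X Y := ⟨0, Equiv.sumEmpty X (Fin 0), Equiv.sumEmpty Y (Fin 0)⟩

/-- Composition; the pairs of `f` come before those of `g`. -/
def comp (f : WalHom X Y U V) (g : WalHom U V S T) : WalHom X Y S T :=
  ⟨f.deg + g.deg, half f.e₁ g.e₁, half f.e₂ g.e₂⟩

theorem half_id {t : ℕ} (e' : X ⊕ Fin t ≃ S) (j : Fin (0 + t)) :
    half (Equiv.sumEmpty X (Fin 0)) e' (Sum.inr j) =
      e' (Sum.inr (Fin.cast (Nat.zero_add t) j)) := by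
  refine Fin.addCases (fun i => i.elim0) (fun j => ?_) j
  rw [half_natAdd]
  congr 2
  ext
  simp

theorem half_assoc {s t u : ℕ} (e : X ⊕ Fin s ≃ U) (e' : U ⊕ Fin t ≃ S) (e'' : S ⊕ Fin u ≃ P)
    (j : Fin (s + t + u)) : half (half e e') e'' (Sum.inr j) =
      half e (half e' e'') (Sum.inr (Fin.cast (Nat.add_assoc s t u) j)) := by
  refine Fin.addCases (fun j => ?_) (fun j => ?_) j
  · refine Fin.addCases (fun j => ?_) (fun j => ?_) j
    · rw [half_castAdd, half_castAdd]
      exact (half_castAdd e (half e' e'') j).symm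
    · rw [half_castAdd, half_natAdd]
      refine Eq.trans (Eq.trans (half_castAdd e' e'' j).symm
        (half_natAdd e (half e' e'') (Fin.castAdd u j)).symm) ?_
      congr 2
  · rw [half_natAdd]
    refine Eq.trans (Eq.trans (half_natAdd e' e'' j).symm
      (half_natAdd e (half e' e'') (Fin.natAdd t j)).symm) ?_
    congr 2
    ext
    simp [Nat.add_assoc]

theorem id_comp (f : WalHom X Y U V) : (id X Y).comp f = f :=
  ext' (Nat.zero_add _) (fun _ => rfl) (half_id f.e₁) (fun _ => rfl) (half_id f.e₂)

theorem comp_id (f : WalHom X Y U V) : f.comp (id U V) = f :=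
  ext' rfl (fun _ => rfl) (half_castAdd f.e₁ _) (fun _ => rfl) (half_castAdd f.e₂ _)

theorem comp_assoc (f : WalHom X Y U V) (g : WalHom U V S T) (h : WalHom S T P Q) :
    (f.comp g).comp h = f.comp (g.comp h) :=
  ext' (Nat.add_assoc _ _ _) (fun _ => rfl) (half_assoc _ _ _) (fun _ => rfl) (half_assoc _ _ _)

end WalHom

instance : Category WalOrd where
  Hom A B := WalHom A.fst A.snd B.fst B.snd
  id A := WalHom.id A.fst A.snd
  comp f g := WalHom.comp f g
  id_comp f := WalHom.id_comp f
  comp_id f := WalHom.comp_id f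
  assoc f g h := WalHom.comp_assoc f g h

/-- The unwalling of a diagram. A walled pair `(u, v)` becomes the directed pair with first entry
`u` and second entry `v`. -/
def unwHom {X Y U V : Type} (f : WalHom X Y U V) : DirHom (X ⊕ Y) (U ⊕ V) where
  deg := f.deg
  e := ((Equiv.sumCongr (Equiv.refl (X ⊕ Y))
    ((Equiv.prodCongr finTwoEquiv (Equiv.refl _)).trans (Equiv.boolProdEquivSum _))).trans
    (Equiv.sumSumSumComm X Y (Fin f.deg) (Fin f.deg))).trans (Equiv.sumCongr f.e₁ f.e₂)

theorem unwHom_inl_inl {X Y U V : Type} (f : WalHom X Y U V) (x : X) :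
    (unwHom f).e (Sum.inl (Sum.inl x)) = Sum.inl (f.e₁ (Sum.inl x)) := rfl
theorem unwHom_inl_inr {X Y U V : Type} (f : WalHom X Y U V) (y : Y) :
    (unwHom f).e (Sum.inl (Sum.inr y)) = Sum.inr (f.e₂ (Sum.inl y)) := rfl
theorem unwHom_zero {X Y U V : Type} (f : WalHom X Y U V) (j : Fin f.deg) :
    (unwHom f).e (Sum.inr (0, j)) = Sum.inl (f.e₁ (Sum.inr j)) := rfl
theorem unwHom_one {X Y U V : Type} (f : WalHom X Y U V) (j : Fin f.deg) :
    (unwHom f).e (Sum.inr (1, j)) = Sum.inr (f.e₂ (Sum.inr j)) := rfl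

theorem unwHom_id (X Y : Type) : unwHom (WalHom.id X Y) = DirHom.id (X ⊕ Y) := by
  refine DirHom.ext' rfl (fun a => ?_) (fun c j => j.elim0)
  rcases a with a | a <;> rfl

theorem unwHom_comp {X Y U V S T : Type} (f : WalHom X Y U V) (g : WalHom U V S T) :
    unwHom (f.comp g) = (unwHom f).comp (unwHom g) := by
  refine DirHom.ext' rfl (fun a => ?_) (fun c j => ?_)
  · rcases a with a | a <;> rfl
  · refine Fin.addCases (fun j => ?_) (fun j => ?_) j
    · refine Eq.trans ?_ (DirHom.glue_castAdd (unwHom f).e (unwHom g).e c j).symm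
      fin_cases c
      · exact congrArg Sum.inl (WalHom.half_castAdd f.e₁ g.e₁ j)
      · exact congrArg Sum.inr (WalHom.half_castAdd f.e₂ g.e₂ j)
    · refine Eq.trans ?_ (DirHom.glue_natAdd (unwHom f).e (unwHom g).e c j).symm
      fin_cases c
      · exact congrArg Sum.inl (WalHom.half_natAdd f.e₁ g.e₁ j)
      · exact congrArg Sum.inr (WalHom.half_natAdd f.e₂ g.e₂ j)

/-- The unwalling functor `(X, Y) ↦ X ⊔ Y`. -/
def unW : WalOrd ⥤ DirOrd where
  obj P := haveI := P.finite_fst; haveI := P.finite_snd; ⟨P.fst ⊕ P.snd⟩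
  map f := unwHom f
  map_id P := unwHom_id P.fst P.snd
  map_comp f g := unwHom_comp f g

/-! ### Twisted linearizations -/

/-- A relation on parallel morphisms with values in signs, compatible with composition.
`R.rel f g s` is used to impose the relation `[g] = s [f]`. -/
structure SignRel (C : Type w) [Category.{0} C] where
  rel : ∀ {X Y : C}, (X ⟶ Y) → (X ⟶ Y) → ℤˣ → Prop
  pre : ∀ {X Y Z : C} (h : X ⟶ Y) {f g : Y ⟶ Z} {s : ℤˣ}, rel f g s → rel (h ≫ f) (h ≫ g) s
  post : ∀ {X Y Z : C} {f g : X ⟶ Y} {s : ℤˣ} (h : Y ⟶ Z), rel f g s → rel (f ≫ h) (g ≫ h) s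

/-- A sign as a scalar. -/
def sgn (k : Type u) [Field k] (s : ℤˣ) : k := ((s : ℤ) : k)

theorem sgn_mul (k : Type u) [Field k] (s t : ℤˣ) : sgn k (s * t) = sgn k s * sgn k t := by
  simp [sgn]

theorem sgn_one (k : Type u) [Field k] : sgn k 1 = 1 := by simp [sgn]

theorem sgn_mul_self (k : Type u) [Field k] (s : ℤˣ) : sgn k s * sgn k s = 1 := by
  rw [← sgn_mul, Int.units_mul_self, sgn_one]

section Tw

variable (k : Type u) [Field k] {C : Type w} [Category.{0} C] (R : SignRel C)

/-- Objects of the `k`-linearization of `C` modulo the relations `[g] = s [f]`. -/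
structure Tw (k : Type u) {C : Type w} [Category.{0} C] (R : SignRel C) where
  as : C

variable {k R}

/-- The relations in the free vector space on the morphisms. -/
def twSub (k : Type u) [Field k] (R : SignRel C) (X Y : C) : Submodule k ((X ⟶ Y) →₀ k) :=
  Submodule.span k {x | ∃ (f g : X ⟶ Y) (s : ℤˣ), R.rel f g s ∧
    x = Finsupp.single g 1 - sgn k s • Finsupp.single f 1}

/-- Morphisms of the twisted linearization. -/
abbrev TwHom (k : Type u) [Field k] (R : SignRel C) (X Y : C) : Type u :=
  ((X ⟶ Y) →₀ k) ⧸ twSub k R X Y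

/-- The class of a morphism of `C`. -/
def cls (k : Type u) [Field k] (R : SignRel C) {X Y : C} (f : X ⟶ Y) : TwHom k R X Y :=
  (twSub k R X Y).mkQ (Finsupp.single f 1)

theorem cls_rel {X Y : C} {f g : X ⟶ Y} {s : ℤˣ} (h : R.rel f g s) :
    cls k R g = sgn k s • cls k R f := by
  rw [← sub_eq_zero, cls, cls, ← map_smul, ← map_sub, Submodule.mkQ_apply,
    Submodule.Quotient.mk_eq_zero]
  exact Submodule.subset_span ⟨f, g, s, h, rfl⟩

theorem tw_ext {X Y : C} {V : Type*} [AddCommGroup V] [Module k V] {φ ψ : TwHom k R X Y →ₗ[k] V}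
    (h : ∀ f, φ (cls k R f) = ψ (cls k R f)) : φ = ψ := by
  apply Submodule.linearMap_qext
  ext f
  exact h f

/-- A linear map out of the morphisms. -/
def twLift {X Y : C} {V : Type*} [AddCommGroup V] [Module k V] (φ : (X ⟶ Y) → V)
    (h : ∀ f g s, R.rel f g s → φ g = sgn k s • φ f) : TwHom k R X Y →ₗ[k] V :=
  (twSub k R X Y).liftQ (Finsupp.linearCombination k φ) (by
    unfold twSub
    rw [Submodule.span_le]
    rintro _ ⟨f, g, s, hr, rfl⟩
    rw [SetLike.mem_coe, LinearMap.mem_ker, map_sub, map_smul,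
      Finsupp.linearCombination_single, Finsupp.linearCombination_single, one_smul, one_smul,
      h f g s hr, sub_self])

theorem twLift_cls {X Y : C} {V : Type*} [AddCommGroup V] [Module k V] (φ : (X ⟶ Y) → V)
    (h : ∀ f g s, R.rel f g s → φ g = sgn k s • φ f) (f : X ⟶ Y) :
    twLift φ h (cls k R f) = φ f := by
  rw [twLift, cls, Submodule.mkQ_apply, Submodule.liftQ_apply, Finsupp.linearCombination_single,
    one_smul]

/-- Composition with a morphism of `C`. -/
def twPost {X Y Z : C} (g : Y ⟶ Z) : TwHom k R X Y →ₗ[k] TwHom k R X Z :=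
  twLift (fun f => cls k R (f ≫ g)) (fun _ _ _ h => cls_rel (R.post g h))

/-- Composition, as a bilinear map. -/
def twComp (X Y Z : C) : TwHom k R Y Z →ₗ[k] TwHom k R X Y →ₗ[k] TwHom k R X Z :=
  twLift (fun g => twPost g) (fun g g' s h => tw_ext fun f => by
    rw [LinearMap.smul_apply, twPost, twPost, twLift_cls, twLift_cls, cls_rel (R.pre f h)])

theorem twComp_cls {X Y Z : C} (f : X ⟶ Y) (g : Y ⟶ Z) :
    twComp X Y Z (cls k R g) (cls k R f) = cls k R (f ≫ g) := by
  rw [twComp, twLift_cls, twPost, twLift_cls]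

instance : CategoryStruct.{u} (Tw k R) where
  Hom X Y := TwHom k R X.as Y.as
  id X := cls k R (𝟙 X.as)
  comp {X Y Z} f g := twComp X.as Y.as Z.as g f

theorem tw_id_comp {X Y : C} (f : TwHom k R X Y) : twComp X X Y f (cls k R (𝟙 X)) = f := by
  have : (twComp X X Y).flip (cls k R (𝟙 X)) = LinearMap.id := tw_ext fun f => by
    rw [LinearMap.flip_apply, twComp_cls, Category.id_comp, LinearMap.id_apply]
  exact LinearMap.congr_fun this f

theorem tw_comp_id {X Y : C} (f : TwHom k R X Y) : twComp X Y Y (cls k R (𝟙 Y)) f = f := by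
  have : twComp X Y Y (cls k R (𝟙 Y)) = LinearMap.id := tw_ext fun f => by
    rw [twComp_cls, Category.comp_id, LinearMap.id_apply]
  exact LinearMap.congr_fun this f

theorem tw_induction {X Y : C} {p : TwHom k R X Y → Prop} (f : TwHom k R X Y) (zero : p 0)
    (add : ∀ f g, p f → p g → p (f + g)) (smul : ∀ (c : k) f, p (c • cls k R f)) : p f := by
  obtain ⟨f, rfl⟩ := Submodule.mkQ_surjective _ f
  induction f using Finsupp.induction_linear with
  | zero => rw [map_zero]; exact zero
  | add f g hf hg => rw [map_add]; exact add _ _ hf hg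
  | single f c =>
    have h := smul c f
    rwa [cls, ← map_smul, Finsupp.smul_single, smul_eq_mul, mul_one] at h

theorem tw_assoc {W X Y Z : C} (f : TwHom k R W X) (g : TwHom k R X Y) (h : TwHom k R Y Z) :
    twComp W Y Z h (twComp W X Y g f) = twComp W X Z (twComp X Y Z h g) f := by
  induction h using tw_induction with
  | zero => simp only [map_zero, LinearMap.zero_apply]
  | add h h' ih ih' => simp only [map_add, LinearMap.add_apply, ih, ih']
  | smul c h =>
    induction g using tw_induction with
    | zero => simp only [map_zero, LinearMap.zero_apply]
    | add g g' ih ih' => simp only [map_add, LinearMap.add_apply, ih, ih']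
    | smul c' g =>
      induction f using tw_induction with
      | zero => simp only [map_zero]
      | add f f' ih ih' => simp only [map_add, ih, ih']
      | smul c'' f =>
        simp only [map_smul, LinearMap.smul_apply, twComp_cls, Category.assoc]

theorem tw_add_comp {X Y Z : C} (f f' : TwHom k R X Y) (g : TwHom k R Y Z) :
    twComp X Y Z g (f + f') = twComp X Y Z g f + twComp X Y Z g f' := map_add _ _ _

theorem tw_comp_add {X Y Z : C} (f : TwHom k R X Y) (g g' : TwHom k R Y Z) :
    twComp X Y Z (g + g') f = twComp X Y Z g f + twComp X Y Z g' f := by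
  rw [map_add, LinearMap.add_apply]

theorem tw_smul_comp {X Y Z : C} (c : k) (f : TwHom k R X Y) (g : TwHom k R Y Z) :
    twComp X Y Z g (c • f) = c • twComp X Y Z g f := map_smul _ _ _

theorem tw_comp_smul {X Y Z : C} (f : TwHom k R X Y) (c : k) (g : TwHom k R Y Z) :
    twComp X Y Z (c • g) f = c • twComp X Y Z g f := by
  rw [map_smul, LinearMap.smul_apply]

instance : Category.{u} (Tw k R) where
  id_comp f := tw_id_comp f
  comp_id f := tw_comp_id f
  assoc f g h := tw_assoc f g h

instance : Preadditive (Tw k R) where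
  homGroup X Y := inferInstanceAs (AddCommGroup (TwHom k R X.as Y.as))
  add_comp _ _ _ f g h := tw_add_comp f g h
  comp_add _ _ _ f g h := tw_comp_add f g h

instance : Linear k (Tw k R) where
  homModule X Y := inferInstanceAs (Module k (TwHom k R X.as Y.as))
  smul_comp _ _ _ c f g := tw_smul_comp c f g
  comp_smul _ _ _ f c g := tw_comp_smul f c g

/-- The class of a morphism of `C`, as a morphism of the twisted linearization. -/
def gen (k : Type u) [Field k] (R : SignRel C) {X Y : C} (f : X ⟶ Y) :
    (⟨X⟩ : Tw k R) ⟶ ⟨Y⟩ := cls k R f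

theorem gen_id (X : C) : gen k R (𝟙 X) = 𝟙 (⟨X⟩ : Tw k R) := rfl

theorem gen_comp {X Y Z : C} (f : X ⟶ Y) (g : Y ⟶ Z) :
    gen k R (f ≫ g) = gen k R f ≫ gen k R g := (twComp_cls f g).symm

theorem gen_rel {X Y : C} {f g : X ⟶ Y} {s : ℤˣ} (h : R.rel f g s) :
    gen k R g = sgn k s • gen k R f := cls_rel h

theorem gen_ext {X Y : Tw k R} {V : Type*} [AddCommGroup V] [Module k V]
    {φ ψ : (X ⟶ Y) →ₗ[k] V} (h : ∀ f : X.as ⟶ Y.as, φ (gen k R f) = ψ (gen k R f)) : φ = ψ :=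
  tw_ext h

theorem gen_induction {X Y : Tw k R} {p : (X ⟶ Y) → Prop} (f : X ⟶ Y) (zero : p 0)
    (add : ∀ f g, p f → p g → p (f + g))
    (smul : ∀ (c : k) (f : X.as ⟶ Y.as), p (c • gen k R f)) : p f :=
  tw_induction f zero add smul

section Lift

/-- The data of a `k`-linear functor out of a twisted linearization. -/
structure TwData (k : Type u) [Field k] {C : Type w} [Category.{0} C] (R : SignRel C)
    (T : Type w) [Category.{u} T] [Preadditive T] [Linear k T] where
  o : C → T
  m : ∀ {X Y : C}, (X ⟶ Y) → (o X ⟶ o Y)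
  m_id : ∀ X, m (𝟙 X) = 𝟙 (o X)
  m_comp : ∀ {X Y Z : C} (f : X ⟶ Y) (g : Y ⟶ Z), m (f ≫ g) = m f ≫ m g
  m_rel : ∀ {X Y : C} {f g : X ⟶ Y} {s : ℤˣ}, R.rel f g s → m g = sgn k s • m f

variable {T : Type w} [Category.{u} T] [Preadditive T] [Linear k T] (d : TwData k R T)

/-- The action of `Tw.lift` on morphisms. -/
def liftHom (X Y : Tw k R) : (X ⟶ Y) →ₗ[k] (d.o X.as ⟶ d.o Y.as) :=
  twLift (fun f => d.m f) (fun _ _ _ h => d.m_rel h)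

theorem liftHom_gen {X Y : Tw k R} (f : X.as ⟶ Y.as) :
    liftHom d X Y (gen k R f) = d.m f := twLift_cls _ _ f

/-- The `k`-linear functor with given values on the morphisms of `C`. -/
def Tw.lift : Tw k R ⥤ T where
  obj X := d.o X.as
  map {X Y} f := liftHom d X Y f
  map_id X := (liftHom_gen d (𝟙 X.as)).trans (d.m_id X.as)
  map_comp {X Y Z} f g := by
    induction f using gen_induction with
    | zero => rw [Limits.zero_comp, map_zero, map_zero, Limits.zero_comp]
    | add f f' ih ih' => rw [Preadditive.add_comp, map_add, ih, ih', map_add, Preadditive.add_comp]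
    | smul c f =>
      rw [Linear.smul_comp, map_smul, map_smul, Linear.smul_comp]
      congr 1
      induction g using gen_induction with
      | zero => rw [Limits.comp_zero, map_zero, map_zero, Limits.comp_zero]
      | add f f' ih ih' =>
        rw [Preadditive.comp_add, map_add, ih, ih', map_add, Preadditive.comp_add]
      | smul c g =>
        rw [Linear.comp_smul, map_smul, map_smul, Linear.comp_smul]
        congr 1
        refine (congrArg _ (gen_comp f g).symm).trans ?_
        rw [liftHom_gen, liftHom_gen, d.m_comp]
        exact congrArg _ (liftHom_gen d g).symm

instance : (Tw.lift d).Additive where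
  map_add {X Y f g} := map_add (liftHom d X Y) f g

instance : (Tw.lift d).Linear k where
  map_smul {X Y} f c := map_smul (liftHom d X Y) c f

theorem Tw.lift_gen {X Y : C} (f : X ⟶ Y) : (Tw.lift d).map (gen k R f) = d.m f :=
  liftHom_gen (X := ⟨X⟩) (Y := ⟨Y⟩) d f

end Lift

/-- The data of the functor induced by a functor that respects the sign relations. -/
def mapData (k : Type u) [Field k] {D : Type w} [Category.{0} D] {S : SignRel D} (F : C ⥤ D)
    (h : ∀ {X Y : C} {f g : X ⟶ Y} {s : ℤˣ}, R.rel f g s → S.rel (F.map f) (F.map g) s) :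
    TwData k R (Tw k S) where
  o X := ⟨F.obj X⟩
  m f := gen k S (F.map f)
  m_id X := by rw [F.map_id, gen_id]
  m_comp f g := by rw [F.map_comp, gen_comp]
  m_rel hr := gen_rel (h hr)

end Tw

/-! ### Symmetries of diagrams and the twisted Brauer categories -/

/-- The trivial character for `ε = 1` and the sign character for `ε = -1`. -/
def signChar (ε s : ℤˣ) : ℤˣ := if ε = 1 then 1 else s

theorem signChar_mul (ε s t : ℤˣ) : signChar ε (s * t) = signChar ε s * signChar ε t := by
  unfold signChar
  split_ifs <;> simp

theorem signChar_one (ε : ℤˣ) : signChar ε 1 = 1 := by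
  unfold signChar
  split_ifs <;> rfl

/-- The permutation `σ₁ ⊔ σ₂` of `Fin (s + t)`. -/
def addPerm {s t : ℕ} (σ₁ : Equiv.Perm (Fin s)) (σ₂ : Equiv.Perm (Fin t)) :
    Equiv.Perm (Fin (s + t)) :=
  finSumFinEquiv.permCongr (Equiv.Perm.sumCongr σ₁ σ₂)

theorem addPerm_castAdd {s t : ℕ} (σ₁ : Equiv.Perm (Fin s)) (σ₂ : Equiv.Perm (Fin t)) (j : Fin s) :
    addPerm σ₁ σ₂ (Fin.castAdd t j) = Fin.castAdd t (σ₁ j) := by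
  simp [addPerm]

theorem addPerm_natAdd {s t : ℕ} (σ₁ : Equiv.Perm (Fin s)) (σ₂ : Equiv.Perm (Fin t)) (j : Fin t) :
    addPerm σ₁ σ₂ (Fin.natAdd s j) = Fin.natAdd s (σ₂ j) := by
  simp [addPerm]

theorem sign_addPerm {s t : ℕ} (σ₁ : Equiv.Perm (Fin s)) (σ₂ : Equiv.Perm (Fin t)) :
    Equiv.Perm.sign (addPerm σ₁ σ₂) = Equiv.Perm.sign σ₁ * Equiv.Perm.sign σ₂ := by
  rw [addPerm, Equiv.Perm.sign_permCongr, Equiv.Perm.sign_sumCongr]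

theorem signChar_one_addPerm (ε : ℤˣ) (s : ℕ) {t : ℕ} (σ : Equiv.Perm (Fin t)) :
    signChar ε (Equiv.Perm.sign σ) =
      signChar ε (Equiv.Perm.sign (addPerm (1 : Equiv.Perm (Fin s)) σ)) := by
  rw [sign_addPerm, map_one, one_mul]

theorem signChar_addPerm_one (ε : ℤˣ) (s : ℕ) {t : ℕ} (σ : Equiv.Perm (Fin t)) :
    signChar ε (Equiv.Perm.sign σ) =
      signChar ε (Equiv.Perm.sign (addPerm σ (1 : Equiv.Perm (Fin s)))) := by
  rw [sign_addPerm, map_one, mul_one]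

theorem addPerm_one (s t : ℕ) : addPerm (1 : Equiv.Perm (Fin s)) (1 : Equiv.Perm (Fin t)) = 1 := by
  ext j
  refine Fin.addCases (fun j => ?_) (fun j => ?_) j
  · rw [addPerm_castAdd]; rfl
  · rw [addPerm_natAdd]; rfl

/-- The bijection of `Fin 2 × Fin t` given by an element of the wreath product: `(c, j)` goes to
`(τ j c, σ j)`. -/
def wreath {t : ℕ} (τ : Fin t → Equiv.Perm (Fin 2)) (σ : Equiv.Perm (Fin t)) :
    Equiv.Perm (Fin 2 × Fin t) where
  toFun x := (τ x.2 x.1, σ x.2)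
  invFun x := ((τ (σ.symm x.2)).symm x.1, σ.symm x.2)
  left_inv x := by simp
  right_inv x := by simp

namespace DirHom

variable {A B C : Type}

/-- The right action of the wreath product on diagrams: `τ j` permutes the entries of a pair and
`σ` permutes the pairs. -/
def wr (f : DirHom A B) (τ : Fin f.deg → Equiv.Perm (Fin 2)) (σ : Equiv.Perm (Fin f.deg)) :
    DirHom A B :=
  ⟨f.deg, (Equiv.sumCongr (Equiv.refl A) (wreath τ σ)).trans f.e⟩

theorem wr_one (f : DirHom A B) : f.wr (fun _ => 1) 1 = f :=
  ext' rfl (fun _ => rfl) (fun _ _ => rfl)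

theorem wr_wr (f : DirHom A B) (τ τ' : Fin f.deg → Equiv.Perm (Fin 2))
    (σ σ' : Equiv.Perm (Fin f.deg)) :
    (f.wr τ σ).wr τ' σ' = f.wr (fun j => τ (σ' j) * τ' j) (σ * σ') :=
  ext' rfl (fun _ => rfl) (fun _ _ => rfl)

theorem wr_shuffle (f : DirHom A B) (τ₀ : Fin f.deg → Equiv.Perm (Fin 2))
    (σ₀ : Equiv.Perm (Fin f.deg)) (τ : Fin f.deg → Equiv.Perm (Fin 2)) :
    (f.wr τ₀ σ₀).wr τ 1 =
      (f.wr (fun j => τ₀ (σ₀.symm j) * τ (σ₀.symm j)) 1).wr (fun _ => 1) σ₀ := by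
  have h : ∀ (c : Fin 2) (j : Fin f.deg), f.e (Sum.inr (τ₀ j (τ j c), σ₀ j)) =
      f.e (Sum.inr (τ₀ (σ₀.symm (σ₀ j)) (τ (σ₀.symm (σ₀ j)) c), σ₀ j)) := fun c j => by
    rw [Equiv.symm_apply_apply]
  exact ext' rfl (fun _ => rfl) h

theorem glue_wreath {s t : ℕ} (e : A ⊕ (Fin 2 × Fin s) ≃ B) (e' : B ⊕ (Fin 2 × Fin t) ≃ C)
    (τ : Fin s → Equiv.Perm (Fin 2)) (σ : Equiv.Perm (Fin s)) (τ' : Fin t → Equiv.Perm (Fin 2))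
    (σ' : Equiv.Perm (Fin t)) (c : Fin 2) (j : Fin (s + t)) :
    glue ((Equiv.sumCongr (Equiv.refl A) (wreath τ σ)).trans e)
      ((Equiv.sumCongr (Equiv.refl B) (wreath τ' σ')).trans e') (Sum.inr (c, j)) =
      glue e e' (Sum.inr (Fin.append τ τ' j c, addPerm σ σ' j)) := by
  refine Fin.addCases (fun j => ?_) (fun j => ?_) j
  · rw [addPerm_castAdd, Fin.append_left, glue_castAdd, glue_castAdd]; rfl
  · rw [addPerm_natAdd, Fin.append_right, glue_natAdd, glue_natAdd]; rfl

theorem wr_comp (f : DirHom A B) (g : DirHom B C) (τ : Fin f.deg → Equiv.Perm (Fin 2))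
    (σ : Equiv.Perm (Fin f.deg)) (τ' : Fin g.deg → Equiv.Perm (Fin 2))
    (σ' : Equiv.Perm (Fin g.deg)) :
    (f.wr τ σ).comp (g.wr τ' σ') = (f.comp g).wr (Fin.append τ τ') (addPerm σ σ') := by
  exact ext' rfl (fun _ => rfl) (glue_wreath f.e g.e τ σ τ' σ')

end DirHom

/-- The permutation action on walled diagrams (diagonal on the pairs). -/
def WalHom.perm {X Y U V : Type} (f : WalHom X Y U V) (σ : Equiv.Perm (Fin f.deg)) :
    WalHom X Y U V :=
  ⟨f.deg, (Equiv.sumCongr (Equiv.refl X) σ).trans f.e₁,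
    (Equiv.sumCongr (Equiv.refl Y) σ).trans f.e₂⟩

theorem WalHom.perm_one {X Y U V : Type} (f : WalHom X Y U V) : f.perm 1 = f :=
  WalHom.ext' rfl (fun _ => rfl) (fun _ => rfl) (fun _ => rfl) (fun _ => rfl)

theorem WalHom.half_perm {X U S : Type} {s t : ℕ} (e : X ⊕ Fin s ≃ U) (e' : U ⊕ Fin t ≃ S)
    (σ : Equiv.Perm (Fin s)) (σ' : Equiv.Perm (Fin t)) (j : Fin (s + t)) :
    WalHom.half ((Equiv.sumCongr (Equiv.refl X) σ).trans e)
      ((Equiv.sumCongr (Equiv.refl U) σ').trans e') (Sum.inr j) =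
      WalHom.half e e' (Sum.inr (addPerm σ σ' j)) := by
  refine Fin.addCases (fun j => ?_) (fun j => ?_) j
  · rw [addPerm_castAdd, half_castAdd, half_castAdd]; rfl
  · rw [addPerm_natAdd, half_natAdd, half_natAdd]; rfl

theorem WalHom.perm_comp {X Y U V S T : Type} (f : WalHom X Y U V) (g : WalHom U V S T)
    (σ : Equiv.Perm (Fin f.deg)) (σ' : Equiv.Perm (Fin g.deg)) :
    (f.perm σ).comp (g.perm σ') = (f.comp g).perm (addPerm σ σ') :=
  WalHom.ext' rfl (fun _ => rfl) (WalHom.half_perm f.e₁ g.e₁ σ σ') (fun _ => rfl)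
    (WalHom.half_perm f.e₂ g.e₂ σ σ')

/-- The relations `[f · σ] = χ(σ) [f]` for the permutations of the pairs, where `χ` is the trivial
character if `ε = 1` and the sign character if `ε = -1`. -/
def dirRel (ε : ℤˣ) : SignRel DirOrd where
  rel f g s := ∃ σ : Equiv.Perm (Fin (DirHom.deg f)),
    g = DirHom.wr f (fun _ => 1) σ ∧ s = signChar ε (Equiv.Perm.sign σ)
  pre := by
    rintro X Y Z h f _ _ ⟨σ, rfl, rfl⟩
    refine ⟨addPerm 1 σ, ?_, signChar_one_addPerm ε _ σ⟩
    have := DirHom.wr_comp h f (fun _ => 1) 1 (fun _ => 1) σ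
    rw [DirHom.wr_one] at this
    refine this.trans (congrArg (fun τ => DirHom.wr (h ≫ f) τ (addPerm 1 σ)) ?_)
    funext j
    exact Fin.addCases (fun j => by rw [Fin.append_left]) (fun j => by rw [Fin.append_right]) j
  post := by
    rintro X Y Z f _ _ h ⟨σ, rfl, rfl⟩
    refine ⟨addPerm σ 1, ?_, signChar_addPerm_one ε _ σ⟩
    have := DirHom.wr_comp f h (fun _ => 1) σ (fun _ => 1) 1
    rw [DirHom.wr_one] at this
    refine this.trans (congrArg (fun τ => DirHom.wr (f ≫ h) τ (addPerm σ 1)) ?_)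
    funext j
    exact Fin.addCases (fun j => by rw [Fin.append_left]) (fun j => by rw [Fin.append_right]) j

/-- The character of the wreath product attached to the pair of signs `(δ, ε)`. -/
def wrChar (δ ε : ℤˣ) {t : ℕ} (τ : Fin t → Equiv.Perm (Fin 2)) (σ : Equiv.Perm (Fin t)) : ℤˣ :=
  signChar δ (∏ j, Equiv.Perm.sign (τ j)) * signChar ε (Equiv.Perm.sign σ)

theorem prod_sign_append {s t : ℕ} (τ : Fin s → Equiv.Perm (Fin 2))
    (τ' : Fin t → Equiv.Perm (Fin 2)) :
    ∏ j, Equiv.Perm.sign (Fin.append τ τ' j) =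
      (∏ j, Equiv.Perm.sign (τ j)) * ∏ j, Equiv.Perm.sign (τ' j) := by
  rw [Fin.prod_univ_add]
  simp only [Fin.append_left, Fin.append_right]

theorem wrChar_append (δ ε : ℤˣ) {s t : ℕ} (τ : Fin s → Equiv.Perm (Fin 2))
    (σ : Equiv.Perm (Fin s)) (τ' : Fin t → Equiv.Perm (Fin 2)) (σ' : Equiv.Perm (Fin t)) :
    wrChar δ ε (Fin.append τ τ') (addPerm σ σ') = wrChar δ ε τ σ * wrChar δ ε τ' σ' := by
  rw [wrChar, wrChar, wrChar, prod_sign_append, sign_addPerm, signChar_mul, signChar_mul,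
    mul_mul_mul_comm]

theorem wrChar_one (δ ε : ℤˣ) (t : ℕ) :
    wrChar δ ε (fun _ : Fin t => (1 : Equiv.Perm (Fin 2))) 1 = 1 := by
  simp [wrChar, signChar_one]

theorem wrChar_one_append (δ ε : ℤˣ) (s : ℕ) {t : ℕ} (τ : Fin t → Equiv.Perm (Fin 2))
    (σ : Equiv.Perm (Fin t)) : wrChar δ ε τ σ =
      wrChar δ ε (Fin.append (fun _ : Fin s => 1) τ) (addPerm 1 σ) := by
  rw [wrChar_append, wrChar_one, one_mul]

theorem wrChar_append_one (δ ε : ℤˣ) (s : ℕ) {t : ℕ} (τ : Fin t → Equiv.Perm (Fin 2))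
    (σ : Equiv.Perm (Fin t)) : wrChar δ ε τ σ =
      wrChar δ ε (Fin.append τ (fun _ : Fin s => 1)) (addPerm σ 1) := by
  rw [wrChar_append, wrChar_one, mul_one]

/-- The relations `[f · (τ, σ)] = χ(τ, σ) [f]` for the elements of the wreath product. -/
def undirRel (δ ε : ℤˣ) : SignRel DirOrd where
  rel f g s := ∃ (τ : Fin (DirHom.deg f) → Equiv.Perm (Fin 2))
    (σ : Equiv.Perm (Fin (DirHom.deg f))), g = DirHom.wr f τ σ ∧ s = wrChar δ ε τ σ
  pre := by
    rintro X Y Z h f _ _ ⟨τ, σ, rfl, rfl⟩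
    refine ⟨Fin.append (fun _ => 1) τ, addPerm 1 σ, ?_, wrChar_one_append δ ε _ τ σ⟩
    have := DirHom.wr_comp h f (fun _ => 1) 1 τ σ
    rwa [DirHom.wr_one] at this
  post := by
    rintro X Y Z f _ _ h ⟨τ, σ, rfl, rfl⟩
    refine ⟨Fin.append τ (fun _ => 1), addPerm σ 1, ?_, wrChar_append_one δ ε _ τ σ⟩
    have := DirHom.wr_comp f h τ σ (fun _ => 1) 1
    rwa [DirHom.wr_one] at this

/-- The relations `[f · σ] = χ(σ) [f]` for walled diagrams. -/
def walRel (ε : ℤˣ) : SignRel WalOrd where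
  rel f g s := ∃ σ : Equiv.Perm (Fin (WalHom.deg f)),
    g = WalHom.perm f σ ∧ s = signChar ε (Equiv.Perm.sign σ)
  pre := by
    rintro X Y Z h f _ _ ⟨σ, rfl, rfl⟩
    refine ⟨addPerm 1 σ, ?_, signChar_one_addPerm ε _ σ⟩
    have := WalHom.perm_comp h f 1 σ
    rwa [WalHom.perm_one] at this
  post := by
    rintro X Y Z f _ _ h ⟨σ, rfl, rfl⟩
    refine ⟨addPerm σ 1, ?_, signChar_addPerm_one ε _ σ⟩
    have := WalHom.perm_comp f h σ 1
    rwa [WalHom.perm_one] at this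

theorem wrChar_shuffle (δ ε : ℤˣ) {t : ℕ} (τ₀ : Fin t → Equiv.Perm (Fin 2))
    (σ₀ : Equiv.Perm (Fin t)) (τ : Fin t → Equiv.Perm (Fin 2)) :
    signChar δ (∏ j, Equiv.Perm.sign (τ j)) * signChar ε (Equiv.Perm.sign σ₀) =
      wrChar δ ε τ₀ σ₀ *
        signChar δ (∏ j, Equiv.Perm.sign (τ₀ (σ₀.symm j) * τ (σ₀.symm j))) := by
  have h : ∏ j, Equiv.Perm.sign (τ₀ (σ₀.symm j) * τ (σ₀.symm j)) =
      (∏ j, Equiv.Perm.sign (τ₀ j)) * ∏ j, Equiv.Perm.sign (τ j) := by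
    rw [← Finset.prod_mul_distrib,
      ← Equiv.prod_comp σ₀.symm fun j => Equiv.Perm.sign (τ₀ j) * Equiv.Perm.sign (τ j)]
    exact Finset.prod_congr rfl fun j _ => map_mul _ _ _
  rw [h, wrChar, signChar_mul, mul_mul_mul_comm, ← mul_assoc, Int.units_mul_self, one_mul,
    mul_comm]

section Categories

variable (k : Type u) [Field k] (δ ε : ℤˣ)

/-- The twisted upward directed Brauer category. -/
abbrev KDUB (k : Type u) (ε : ℤˣ) := Tw k (dirRel ε)

/-- The twisted upward (undirected) Brauer category. -/
abbrev KUB (k : Type u) (δ ε : ℤˣ) := Tw k (undirRel δ ε)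

/-- The twisted upward walled Brauer category. -/
abbrev KUWB (k : Type u) (ε : ℤˣ) := Tw k (walRel ε)

theorem unW_rel {X Y : WalOrd} {f g : X ⟶ Y} {s : ℤˣ} (h : (walRel ε).rel f g s) :
    (dirRel ε).rel (unW.map f) (unW.map g) s := by
  obtain ⟨σ, rfl, rfl⟩ := h
  refine ⟨σ, DirHom.ext' rfl (fun a => ?_) (fun c j => ?_), rfl⟩
  · rcases a with a | a <;> rfl
  · fin_cases c <;> rfl

theorem dir_undir {X Y : DirOrd} {f g : X ⟶ Y} {s : ℤˣ} (h : (dirRel ε).rel f g s) :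
    (undirRel δ ε).rel f g s := by
  obtain ⟨σ, rfl, rfl⟩ := h
  refine ⟨fun _ => 1, σ, rfl, ?_⟩
  simp [wrChar, signChar_one]

/-- The functor from walled to directed diagrams induced by the unwalling functor. -/
abbrev Ups : KUWB k ε ⥤ KDUB k ε := Tw.lift (mapData k unW (unW_rel ε))

/-- The projection from directed to undirected diagrams. -/
abbrev mp : KDUB k ε ⥤ KUB k δ ε := Tw.lift (mapData k (𝟭 DirOrd) (dir_undir δ ε))

/-- The composite functor from walled to undirected diagrams. -/
abbrev ups : KUWB k ε ⥤ KUB k δ ε := Ups k ε ⋙ mp k δ ε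

/-- The value of the transfer on a diagram: the signed sum over all choices of directions. -/
def trMap {X Y : DirOrd} (f : X ⟶ Y) : (⟨X⟩ : KDUB k ε) ⟶ ⟨Y⟩ :=
  ∑ τ : Fin (DirHom.deg f) → Equiv.Perm (Fin 2),
    sgn k (signChar δ (∏ j, Equiv.Perm.sign (τ j))) • gen k (dirRel ε) (DirHom.wr f τ 1)

theorem trMap_id (X : DirOrd) : trMap k δ ε (𝟙 X) = 𝟙 (⟨X⟩ : KDUB k ε) := by
  have key : ∀ φ : (Fin 0 → Equiv.Perm (Fin 2)) → ((⟨X⟩ : KDUB k ε) ⟶ ⟨X⟩),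
      ∑ τ, φ τ = φ (fun _ => 1) := fun φ => by
    rw [Fintype.sum_unique]
    exact congrArg φ (Subsingleton.elim _ _)
  refine (key _).trans ?_
  have h : ∏ j : Fin 0, Equiv.Perm.sign ((fun _ => 1 : Fin 0 → Equiv.Perm (Fin 2)) j) = 1 := rfl
  refine (congrArg (fun s => sgn k (signChar δ s) • _) h).trans ?_
  rw [signChar_one, sgn_one, one_smul]
  exact congrArg (gen k (dirRel ε)) (DirHom.wr_one (DirHom.id X.carrier))

theorem trMap_comp {X Y Z : DirOrd} (f : X ⟶ Y) (g : Y ⟶ Z) :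
    trMap k δ ε (f ≫ g) = trMap k δ ε f ≫ trMap k δ ε g := by
  rw [trMap, trMap, trMap, Preadditive.sum_comp]
  simp only [Preadditive.comp_sum]
  rw [← Fintype.sum_prod_type']
  refine (Fintype.sum_equiv (Fin.appendEquiv (DirHom.deg f) (DirHom.deg g)) _ _ ?_).symm
  rintro ⟨τ, τ'⟩
  change _ = sgn k (signChar δ (∏ j, Equiv.Perm.sign (Fin.append τ τ' j))) •
    gen k (dirRel ε) (DirHom.wr (f ≫ g) (Fin.append τ τ') 1)
  rw [Linear.smul_comp, Linear.comp_smul, smul_smul, ← gen_comp]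
  congr 1
  · rw [← sgn_mul, ← signChar_mul]
    exact congrArg (fun s => sgn k (signChar δ s)) (prod_sign_append τ τ').symm
  · refine congrArg _ ((DirHom.wr_comp f g τ 1 τ' 1).trans ?_)
    rw [addPerm_one]
    rfl

theorem trMap_rel {X Y : DirOrd} {f g : X ⟶ Y} {s : ℤˣ} (h : (undirRel δ ε).rel f g s) :
    trMap k δ ε g = sgn k s • trMap k δ ε f := by
  obtain ⟨τ₀, σ₀, rfl, rfl⟩ := h
  rw [trMap, trMap, Finset.smul_sum]
  refine Fintype.sum_equiv ((Equiv.mulLeft τ₀).trans (Equiv.arrowCongr σ₀ (Equiv.refl _))) _ _ ?_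
  intro τ
  have h₂ : (dirRel ε).rel (DirHom.wr f (fun j => τ₀ (σ₀.symm j) * τ (σ₀.symm j)) 1 : X ⟶ Y)
      (DirHom.wr (DirHom.wr f τ₀ σ₀) τ 1) (signChar ε (Equiv.Perm.sign σ₀)) :=
    ⟨σ₀, DirHom.wr_shuffle f τ₀ σ₀ τ, rfl⟩
  rw [gen_rel h₂, smul_smul, smul_smul, ← sgn_mul, ← sgn_mul]
  exact congrArg (fun s => sgn k s • _) (wrChar_shuffle δ ε τ₀ σ₀ τ)

/-- The data of the transfer functor. -/
def trData : TwData k (undirRel δ ε) (KDUB k ε) where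
  o X := ⟨X⟩
  m f := trMap k δ ε f
  m_id X := trMap_id k δ ε X
  m_comp f g := trMap_comp k δ ε f g
  m_rel h := trMap_rel k δ ε h

/-- The transfer functor from undirected to directed diagrams; it is the identity on objects and
bijections. -/
abbrev Tr : KUB k δ ε ⥤ KDUB k ε := Tw.lift (trData k δ ε)

end Categories

/-! ### Bijections as morphisms -/

/-- The morphism of degree zero given by a bijection. -/
def DirHom.ofEquiv {A B : Type} (e : A ≃ B) : DirHom A B :=
  ⟨0, (Equiv.sumEmpty A (Fin 2 × Fin 0)).trans e⟩

theorem DirHom.ofEquiv_comp {A B C : Type} (e : A ≃ B) (e' : B ≃ C) :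
    (DirHom.ofEquiv e).comp (DirHom.ofEquiv e') = DirHom.ofEquiv (e.trans e') :=
  DirHom.ext' rfl (fun _ => rfl) (fun _ j => j.elim0)

/-- The morphism of degree zero given by a pair of bijections. -/
def WalHom.ofEquiv {X Y U V : Type} (e : X ≃ U) (e' : Y ≃ V) : WalHom X Y U V :=
  ⟨0, (Equiv.sumEmpty X (Fin 0)).trans e, (Equiv.sumEmpty Y (Fin 0)).trans e'⟩

theorem WalHom.ofEquiv_comp {X Y U V S T : Type} (e : X ≃ U) (e' : Y ≃ V) (f : U ≃ S)
    (f' : V ≃ T) :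
    (WalHom.ofEquiv e e').comp (WalHom.ofEquiv f f') = WalHom.ofEquiv (e.trans f) (e'.trans f') :=
  WalHom.ext' rfl (fun _ => rfl) (fun j => j.elim0) (fun _ => rfl) (fun j => j.elim0)

/-- The finite set with `n` elements. -/
def dirObj (n : ℕ) : DirOrd := ⟨Fin n⟩

/-- The pair of finite sets with `m` and `n` elements. -/
def walObj (p : ℕ × ℕ) : WalOrd := ⟨Fin p.1, Fin p.2⟩

theorem wal_skeleton (P : WalOrd) : ∃ p : ℕ × ℕ, Nonempty (walObj p ≅ P) := by
  obtain ⟨X, Y⟩ := P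
  have := Fintype.ofFinite X
  have := Fintype.ofFinite Y
  let e := (Fintype.equivFin X).symm
  let e' := (Fintype.equivFin Y).symm
  refine ⟨(Fintype.card X, Fintype.card Y),
    ⟨⟨WalHom.ofEquiv e e', WalHom.ofEquiv e.symm e'.symm, ?_, ?_⟩⟩⟩
  · refine (WalHom.ofEquiv_comp e e' e.symm e'.symm).trans ?_
    rw [Equiv.self_trans_symm, Equiv.self_trans_symm]
    rfl
  · refine (WalHom.ofEquiv_comp e.symm e'.symm e e').trans ?_
    rw [Equiv.symm_trans_self, Equiv.symm_trans_self]
    rfl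

theorem kuwb_skeleton (k : Type u) [Field k] (ε : ℤˣ) (P : KUWB k ε) :
    ∃ p : ℕ × ℕ, Nonempty ((⟨walObj p⟩ : KUWB k ε) ≅ P) := by
  obtain ⟨P⟩ := P
  obtain ⟨p, ⟨i⟩⟩ := wal_skeleton P
  exact ⟨p, ⟨⟨gen k _ i.hom, gen k _ i.inv, by rw [← gen_comp, i.hom_inv_id, gen_id],
    by rw [← gen_comp, i.inv_hom_id, gen_id]⟩⟩⟩

section Functors

variable (k : Type u) [Field k] (δ ε : ℤˣ)

instance : (LMod.restr (k := k) (Ups k ε).op).IsLeftAdjoint :=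
  LMod.restr_isLeftAdjoint (Ups k ε).op (fun p : ℕ × ℕ => op (⟨walObj p⟩ : KUWB k ε)) fun a => by
    obtain ⟨p, ⟨i⟩⟩ := kuwb_skeleton k ε a.unop
    exact ⟨p, ⟨i.symm.op⟩⟩

instance : (LMod.restr (k := k) (ups k δ ε)).IsRightAdjoint :=
  LMod.restr_isRightAdjoint (ups k δ ε) (fun p : ℕ × ℕ => (⟨walObj p⟩ : KUWB k ε))
    (kuwb_skeleton k ε)

/-- The right adjoint of the restriction of modules over the downward categories along the
unwalling functor. -/
def dUpsLower : LMod k (KUWB k ε)ᵒᵖ ⥤ LMod k (KDUB k ε)ᵒᵖ :=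
  (LMod.restr (k := k) (Ups k ε).op).rightAdjoint

/-- The functor from modules over the downward walled category to modules over the downward
undirected category. -/
def dJ : LMod k (KUWB k ε)ᵒᵖ ⥤ LMod k (KUB k δ ε)ᵒᵖ :=
  dUpsLower k ε ⋙ LMod.restr (Tr k δ ε).op

/-- The left adjoint of restriction along the functor from walled to undirected diagrams. -/
def scrL : LMod k (KUWB k ε) ⥤ LMod k (KUB k δ ε) := (LMod.restr (k := k) (ups k δ ε)).leftAdjoint

instance : (scrL k δ ε).Additive :=
  (Adjunction.ofIsRightAdjoint (LMod.restr (k := k) (ups k δ ε))).left_adjoint_additive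

end Functors

/-! ### Koszul complexes -/

section Koszul

variable {k : Type u} [Field k] {C : Type w} [Category.{0} C] {R R' : SignRel C}

/-- The relations `gσ ⊗ m = g ⊗ σm` in `Hom(x, Y) ⊗ M(x)`, where the group `G` acts on `x` through
`ρ` and acts on `M(x)` on the left through inverses. -/
def balSub {x : C} {G : Type} [Group G] (ρ : G →* End x) (M : LMod k (Tw k R')ᵒᵖ) (Y : Tw k R) :
    Submodule k (((⟨x⟩ : Tw k R) ⟶ Y) ⊗[k] M.val (op ⟨x⟩)) :=
  Submodule.span k {z | ∃ (σ : G) (g : (⟨x⟩ : Tw k R) ⟶ Y) (m : M.val (op ⟨x⟩)),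
    z = (gen k R (ρ σ) ≫ g) ⊗ₜ[k] m - g ⊗ₜ[k] M.act (gen k R' (ρ σ⁻¹)).op m}

/-- The tensor product of `Hom(x, Y)` and `M(x)` over the group algebra of `G`. -/
abbrev Bal {x : C} {G : Type} [Group G] (ρ : G →* End x) (M : LMod k (Tw k R')ᵒᵖ) (Y : Tw k R) :
    Type u :=
  (((⟨x⟩ : Tw k R) ⟶ Y) ⊗[k] M.val (op ⟨x⟩)) ⧸ balSub ρ M Y

variable {x : C} {G : Type} [Group G] (ρ : G →* End x)

/-- The class of `g ⊗ m`. -/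
def bmk (M : LMod k (Tw k R')ᵒᵖ) (Y : Tw k R) (g : (⟨x⟩ : Tw k R) ⟶ Y) (m : M.val (op ⟨x⟩)) :
    Bal ρ M Y :=
  (balSub ρ M Y).mkQ (g ⊗ₜ[k] m)

section Bal

variable (M : LMod k (Tw k R')ᵒᵖ) (Y : Tw k R)

theorem bmk_rel (σ : G) (g : (⟨x⟩ : Tw k R) ⟶ Y) (m : M.val (op ⟨x⟩)) :
    bmk ρ M Y (gen k R (ρ σ) ≫ g) m = bmk ρ M Y g (M.act (gen k R' (ρ σ⁻¹)).op m) := by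
  rw [← sub_eq_zero, bmk, bmk, ← map_sub, Submodule.mkQ_apply, Submodule.Quotient.mk_eq_zero]
  exact Submodule.subset_span ⟨σ, g, m, rfl⟩

theorem bmk_add (g g' : (⟨x⟩ : Tw k R) ⟶ Y) (m : M.val (op ⟨x⟩)) :
    bmk ρ M Y (g + g') m = bmk ρ M Y g m + bmk ρ M Y g' m := by
  rw [bmk, bmk, bmk, TensorProduct.add_tmul, map_add]

theorem bmk_smul (c : k) (g : (⟨x⟩ : Tw k R) ⟶ Y) (m : M.val (op ⟨x⟩)) :
    bmk ρ M Y (c • g) m = c • bmk ρ M Y g m := by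
  rw [bmk, bmk, ← TensorProduct.smul_tmul', map_smul]

theorem bmk_add' (g : (⟨x⟩ : Tw k R) ⟶ Y) (m m' : M.val (op ⟨x⟩)) :
    bmk ρ M Y g (m + m') = bmk ρ M Y g m + bmk ρ M Y g m' := by
  rw [bmk, bmk, bmk, TensorProduct.tmul_add, map_add]

theorem bmk_smul' (c : k) (g : (⟨x⟩ : Tw k R) ⟶ Y) (m : M.val (op ⟨x⟩)) :
    bmk ρ M Y g (c • m) = c • bmk ρ M Y g m := by
  rw [bmk, bmk, TensorProduct.tmul_smul, map_smul]

variable {M Y}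

theorem bal_ext {V : Type*} [AddCommGroup V] [Module k V] {φ ψ : Bal ρ M Y →ₗ[k] V}
    (h : ∀ g m, φ (bmk ρ M Y g m) = ψ (bmk ρ M Y g m)) : φ = ψ := by
  apply Submodule.linearMap_qext
  apply TensorProduct.ext'
  exact h

/-- A linear map out of the balanced tensor product. -/
def balLift {V : Type*} [AddCommGroup V] [Module k V]
    (φ : ((⟨x⟩ : Tw k R) ⟶ Y) →ₗ[k] M.val (op ⟨x⟩) →ₗ[k] V)
    (h : ∀ (σ : G) (g : (⟨x⟩ : Tw k R) ⟶ Y) (m : M.val (op ⟨x⟩)),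
      φ (gen k R (ρ σ) ≫ g) m = φ g (M.act (gen k R' (ρ σ⁻¹)).op m)) : Bal ρ M Y →ₗ[k] V :=
  (balSub ρ M Y).liftQ (TensorProduct.lift φ) (by
    unfold balSub
    rw [Submodule.span_le]
    rintro _ ⟨σ, g, m, rfl⟩
    rw [SetLike.mem_coe, LinearMap.mem_ker, map_sub, TensorProduct.lift.tmul,
      TensorProduct.lift.tmul, h, sub_self])

theorem balLift_bmk {V : Type*} [AddCommGroup V] [Module k V]
    (φ : ((⟨x⟩ : Tw k R) ⟶ Y) →ₗ[k] M.val (op ⟨x⟩) →ₗ[k] V)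
    (h : ∀ (σ : G) (g : (⟨x⟩ : Tw k R) ⟶ Y) (m : M.val (op ⟨x⟩)),
      φ (gen k R (ρ σ) ≫ g) m = φ g (M.act (gen k R' (ρ σ⁻¹)).op m))
    (g : (⟨x⟩ : Tw k R) ⟶ Y) (m : M.val (op ⟨x⟩)) :
    balLift ρ φ h (bmk ρ M Y g m) = φ g m := by
  rw [balLift, bmk, Submodule.mkQ_apply, Submodule.liftQ_apply, TensorProduct.lift.tmul]

end Bal

section Term

variable (M : LMod k (Tw k R')ᵒᵖ)

/-- The action of a morphism on the balanced tensor product. -/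
def balAct {Y Z : Tw k R} (f : Y ⟶ Z) : Bal ρ M Y →ₗ[k] Bal ρ M Z :=
  balLift ρ (LinearMap.mk₂ k (fun g m => bmk ρ M Z (g ≫ f) m)
      (fun g g' m => by rw [Preadditive.add_comp, bmk_add])
      (fun c g m => by rw [Linear.smul_comp, bmk_smul])
      (fun g m m' => bmk_add' ρ M Z _ m m')
      (fun c g m => bmk_smul' ρ M Z c _ m))
    (fun σ g m => by
      rw [LinearMap.mk₂_apply, LinearMap.mk₂_apply, Category.assoc, bmk_rel])

theorem balAct_bmk {Y Z : Tw k R} (f : Y ⟶ Z) (g : (⟨x⟩ : Tw k R) ⟶ Y) (m : M.val (op ⟨x⟩)) :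
    balAct ρ M f (bmk ρ M Y g m) = bmk ρ M Z (g ≫ f) m := balLift_bmk ρ _ _ g m

/-- The module `Y ↦ Hom(x, Y) ⊗_{kG} M(x)`. -/
def kTerm : LMod k (Tw k R) :=
  LMod.of (fun Y => Bal ρ M Y) (fun f => balAct ρ M f)
    (fun Y => LinearMap.congr_fun (g := LinearMap.id) (bal_ext ρ fun g m => by
      rw [balAct_bmk, Category.comp_id, LinearMap.id_apply]))
    (fun f f' => LinearMap.congr_fun (g := balAct ρ M f' ∘ₗ balAct ρ M f) (bal_ext ρ fun g m => by
      rw [LinearMap.comp_apply, balAct_bmk, balAct_bmk, balAct_bmk, Category.assoc]))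
    (fun f f' => LinearMap.congr_fun (g := balAct ρ M f + balAct ρ M f') (bal_ext ρ fun g m => by
      rw [LinearMap.add_apply, balAct_bmk, balAct_bmk, balAct_bmk, Preadditive.comp_add, bmk_add]))
    (fun c f => LinearMap.congr_fun (g := c • balAct ρ M f) (bal_ext ρ fun g m => by
      rw [LinearMap.smul_apply, balAct_bmk, balAct_bmk, Linear.comp_smul, bmk_smul]))

variable {M} {N : LMod k (Tw k R')ᵒᵖ}

/-- Functoriality of the balanced tensor product in the module. -/
def balMap (φ : M ⟶ N) (Y : Tw k R) : Bal ρ M Y →ₗ[k] Bal ρ N Y :=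
  balLift ρ (LinearMap.mk₂ k (fun g m => bmk ρ N Y g (LMod.homAt φ _ m))
      (fun g g' m => bmk_add ρ N Y g g' _)
      (fun c g m => bmk_smul ρ N Y c g _)
      (fun g m m' => by rw [map_add, bmk_add'])
      (fun c g m => by rw [map_smul, bmk_smul']))
    (fun σ g m => by
      rw [LinearMap.mk₂_apply, LinearMap.mk₂_apply, LMod.homAt_act, bmk_rel])

theorem balMap_bmk (φ : M ⟶ N) (Y : Tw k R) (g : (⟨x⟩ : Tw k R) ⟶ Y) (m : M.val (op ⟨x⟩)) :
    balMap ρ φ Y (bmk ρ M Y g m) = bmk ρ N Y g (LMod.homAt φ _ m) := balLift_bmk ρ _ _ g m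

/-- A morphism out of `kTerm`, as a family of linear maps. -/
def termAt {P : LMod k (Tw k R)} (φ : kTerm ρ M ⟶ P) (Y : Tw k R) : Bal ρ M Y →ₗ[k] P.val Y :=
  LMod.homAt φ Y

theorem term_ext {P : LMod k (Tw k R)} {φ ψ : kTerm ρ M ⟶ P}
    (h : ∀ Y g m, termAt ρ φ Y (bmk ρ M Y g m) = termAt ρ ψ Y (bmk ρ M Y g m)) : φ = ψ :=
  LMod.hom_ext fun Y => LinearMap.congr_fun (f := termAt ρ φ Y) (g := termAt ρ ψ Y)
    (bal_ext ρ (h Y))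

/-- Functoriality of `kTerm`. -/
def termMap (φ : M ⟶ N) : kTerm (R := R) ρ M ⟶ kTerm ρ N :=
  LMod.mkHom (fun Y => balMap ρ φ Y) (fun {Y Z} f =>
    LinearMap.congr_fun (f := balMap ρ φ Z ∘ₗ balAct ρ M f) (g := balAct ρ N f ∘ₗ balMap ρ φ Y)
      (bal_ext ρ fun g m => by
        rw [LinearMap.comp_apply, LinearMap.comp_apply, balAct_bmk, balMap_bmk, balMap_bmk,
          balAct_bmk]))

theorem termMap_id : termMap (R := R) ρ (𝟙 M) = 𝟙 _ :=
  term_ext ρ fun Y g m => balMap_bmk ρ (𝟙 M) Y g m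

theorem termMap_comp {P : LMod k (Tw k R')ᵒᵖ} (φ : M ⟶ N) (ψ : N ⟶ P) :
    termMap (R := R) ρ (φ ≫ ψ) = termMap ρ φ ≫ termMap ρ ψ :=
  term_ext ρ fun Y g m => by
    refine (balMap_bmk ρ (φ ≫ ψ) Y g m).trans ?_
    refine Eq.symm ((congrArg (balMap ρ ψ Y) (balMap_bmk ρ φ Y g m)).trans ?_)
    rw [balMap_bmk]
    rfl

end Term

/-! The differential. -/

/-- A function on morphisms `y → x` that is invariant under the action of `G` on `y` and
equivariant for the sign relations of both categories. -/
structure IsInv (k : Type u) [Field k] (R R' : SignRel C) {y : C} {H : Type} [Group H]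
    (ρ' : H →* End y) {x : C} {V : Type u} [AddCommGroup V] [Module k V] (Φ : (y ⟶ x) → V) :
    Prop where
  inv : ∀ σ h, Φ (ρ' σ ≫ h) = Φ h
  sign : ∀ {h h' : y ⟶ x} {s s' : ℤˣ}, R.rel h h' s → R'.rel h h' s' → Φ h' = sgn k (s * s') • Φ h

/-- The sum over the family `gens` of morphisms `y → x` is invariant under the action on `x`. -/
def SumInv (k : Type u) [Field k] (R R' : SignRel C) {x y : C} {G H : Type} [Group G] [Group H]
    (ρ : G →* End x) (ρ' : H →* End y) {ι : Type} [Fintype ι] (gens : ι → (y ⟶ x)) : Prop :=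
  ∀ {V : Type u} [AddCommGroup V] [Module k V] (Φ : (y ⟶ x) → V), IsInv k R R' ρ' Φ →
    ∀ σ : G, ∑ i, Φ (gens i ≫ ρ σ) = ∑ i, Φ (gens i)

/-- The function `h ↦ g[h] ⊗ [h]m` on morphisms `y → x`. -/
def diffFun {y : C} {H : Type} [Group H] (ρ' : H →* End y) (M : LMod k (Tw k R')ᵒᵖ) (Y : Tw k R)
    (g : (⟨x⟩ : Tw k R) ⟶ Y) (m : M.val (op ⟨x⟩)) (h : y ⟶ x) : Bal ρ' M Y :=
  bmk ρ' M Y (gen k R h ≫ g) (M.act (gen k R' h).op m)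

theorem diffFun_inv {y : C} {H : Type} [Group H] (ρ' : H →* End y) (M : LMod k (Tw k R')ᵒᵖ)
    (Y : Tw k R) (g : (⟨x⟩ : Tw k R) ⟶ Y) (m : M.val (op ⟨x⟩)) :
    IsInv k R R' ρ' (diffFun ρ' M Y g m) where
  inv σ h := by
    rw [diffFun, diffFun, gen_comp, gen_comp, Category.assoc, bmk_rel, op_comp, LMod.act_comp,
      ← LMod.act_comp, ← op_comp, ← gen_comp]
    have : ρ' σ⁻¹ ≫ ρ' σ = 𝟙 y := by
      rw [← End.mul_def, ← map_mul, mul_inv_cancel, map_one]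
      rfl
    rw [this, gen_id, op_id, LMod.act_id]
  sign {h h' s s'} hs hs' := by
    rw [diffFun, diffFun, gen_rel hs, gen_rel hs', op_smul, LMod.act_smul, Linear.smul_comp,
      bmk_smul, bmk_smul', smul_smul, sgn_mul]

variable {y : C} {H : Type} [Group H] (ρ' : H →* End y) {ι : Type} [Fintype ι]
  {gens : ι → (y ⟶ x)} (hg : SumInv k R R' ρ ρ' gens)

/-- The map `g ⊗ m ↦ ∑ g[h] ⊗ [h]m`, where the sum is over the family `gens`. -/
def balDiff (M : LMod k (Tw k R')ᵒᵖ) (Y : Tw k R) : Bal ρ M Y →ₗ[k] Bal ρ' M Y :=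
  balLift ρ (LinearMap.mk₂ k (fun g m => ∑ i, bmk ρ' M Y (gen k R (gens i) ≫ g)
        (M.act (gen k R' (gens i)).op m))
      (fun g g' m => by
        rw [← Finset.sum_add_distrib]
        exact Finset.sum_congr rfl fun i _ => by rw [Preadditive.comp_add, bmk_add])
      (fun c g m => by
        rw [Finset.smul_sum]
        exact Finset.sum_congr rfl fun i _ => by rw [Linear.comp_smul, bmk_smul])
      (fun g m m' => by
        rw [← Finset.sum_add_distrib]
        exact Finset.sum_congr rfl fun i _ => by rw [map_add, bmk_add'])
      (fun c g m => by
        rw [Finset.smul_sum]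
        exact Finset.sum_congr rfl fun i _ => by rw [map_smul, bmk_smul']))
    (fun σ g m => by
      rw [LinearMap.mk₂_apply, LinearMap.mk₂_apply]
      refine Eq.trans ?_ (hg _ (diffFun_inv ρ' M Y g (M.act (gen k R' (ρ σ⁻¹)).op m)) σ)
      refine Finset.sum_congr rfl fun i _ => ?_
      rw [diffFun, gen_comp, gen_comp, op_comp, LMod.act_comp, ← LMod.act_comp _
        _ (gen k R' (ρ σ)).op, ← op_comp]
      have : ρ σ ≫ ρ σ⁻¹ = 𝟙 x := by
        rw [← End.mul_def, ← map_mul, inv_mul_cancel, map_one]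
        rfl
      have h : gen k R' (ρ σ) ≫ gen k R' (ρ σ⁻¹) = 𝟙 _ := by rw [← gen_comp, this, gen_id]
      rw [h, op_id, LMod.act_id, Category.assoc])

theorem balDiff_bmk (M : LMod k (Tw k R')ᵒᵖ) (Y : Tw k R) (g : (⟨x⟩ : Tw k R) ⟶ Y)
    (m : M.val (op ⟨x⟩)) : balDiff ρ ρ' hg M Y (bmk ρ M Y g m) =
      ∑ i, bmk ρ' M Y (gen k R (gens i) ≫ g) (M.act (gen k R' (gens i)).op m) :=
  balLift_bmk ρ _ _ g m

/-- The differential, as a morphism of modules. -/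
def kDiff (M : LMod k (Tw k R')ᵒᵖ) : kTerm (R := R) ρ M ⟶ kTerm ρ' M :=
  LMod.mkHom (fun Y => balDiff ρ ρ' hg M Y) (fun {Y Z} f =>
    LinearMap.congr_fun (f := balDiff ρ ρ' hg M Z ∘ₗ balAct ρ M f)
      (g := balAct ρ' M f ∘ₗ balDiff ρ ρ' hg M Y)
      (bal_ext ρ fun g m => by
        rw [LinearMap.comp_apply, LinearMap.comp_apply, balAct_bmk, balDiff_bmk, balDiff_bmk,
          map_sum]
        exact Finset.sum_congr rfl fun i _ => by rw [balAct_bmk, Category.assoc]))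

theorem kDiff_nat {M N : LMod k (Tw k R')ᵒᵖ} (φ : M ⟶ N) :
    kDiff (R := R) ρ ρ' hg M ≫ termMap ρ' φ = termMap ρ φ ≫ kDiff ρ ρ' hg N :=
  term_ext ρ fun Y g m => by
    refine (congrArg (balMap ρ' φ Y) (balDiff_bmk ρ ρ' hg M Y g m)).trans ?_
    refine Eq.symm ((congrArg (balDiff ρ ρ' hg N Y) (balMap_bmk ρ φ Y g m)).trans ?_)
    rw [balDiff_bmk, map_sum]
    exact Finset.sum_congr rfl fun i _ => by rw [balMap_bmk, LMod.homAt_act]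

/-- Consecutive families of morphisms `z → y → x` whose composites cancel. -/
def SumZero (k : Type u) [Field k] (R R' : SignRel C) {x y z : C} {L : Type} [Group L]
    (ρ'' : L →* End z) {ι κ : Type} [Fintype ι] [Fintype κ] (gens : ι → (y ⟶ x))
    (gens' : κ → (z ⟶ y)) : Prop :=
  ∀ {V : Type u} [AddCommGroup V] [Module k V] (Φ : (z ⟶ x) → V), IsInv k R R' ρ'' Φ →
    ∑ i, ∑ j, Φ (gens' j ≫ gens i) = 0

theorem kDiff_comp {z : C} {L : Type} [Group L] (ρ'' : L →* End z) {κ : Type} [Fintype κ]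
    {gens' : κ → (z ⟶ y)} (hg' : SumInv k R R' ρ' ρ'' gens')
    (h0 : SumZero k R R' ρ'' gens gens') (M : LMod k (Tw k R')ᵒᵖ) :
    kDiff (R := R) ρ ρ' hg M ≫ kDiff ρ' ρ'' hg' M = 0 :=
  term_ext ρ fun Y g m => by
    refine (congrArg (balDiff ρ' ρ'' hg' M Y) (balDiff_bmk ρ ρ' hg M Y g m)).trans ?_
    rw [map_sum]
    refine Eq.trans ?_ (h0 _ (diffFun_inv ρ'' M Y g m))
    refine Finset.sum_congr rfl fun i _ => ?_
    rw [balDiff_bmk]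
    refine Finset.sum_congr rfl fun j _ => ?_
    rw [diffFun, gen_comp, gen_comp, op_comp, LMod.act_comp, Category.assoc]

end Koszul

/-! Averaging over all diagrams of degree one. -/

section Averaging

variable {C : Type w} [Category.{0} C] {R R' : SignRel C}

/-- `gens` is, up to symmetries, a family of representatives of the finite family `eh` of
morphisms `y → x`, with multiplicity; the family `eh` is stable under the action on `x`. -/
structure IsFam (k : Type u) [Field k] (R R' : SignRel C) {x y : C} {G H : Type} [Group G]
    [Group H] (ρ : G →* End x) (ρ' : H →* End y) {ι E : Type} [Fintype ι] [Fintype E]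
    (gens : ι → (y ⟶ x)) (eh : E → (y ⟶ x)) : Prop where
  avg : ∃ c : ℕ, c ≠ 0 ∧ ∀ {V : Type u} [AddCommGroup V] [Module k V] (Φ : (y ⟶ x) → V),
    IsInv k R R' ρ' Φ → ∑ e, Φ (eh e) = (c : k) • ∑ i, Φ (gens i)
  act : ∀ σ : G, ∃ s : Equiv.Perm E, ∀ e, eh e ≫ ρ σ = eh (s e)

theorem sum_avg {E P V : Type*} [Fintype E] [Fintype P] [DecidableEq P] [AddCommMonoid V]
    (q : E → P) (α : P → E)
    (hc : ∀ p p', ∃ s : Equiv.Perm E, ∀ e, q e = p ↔ q (s e) = p') (p₀ : P) (Φ : E → V)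
    (hΦ : ∀ e, Φ e = Φ (α (q e))) :
    ∑ e, Φ e = (Finset.univ.filter fun e => q e = p₀).card • ∑ p, Φ (α p) := by
  rw [← Finset.sum_fiberwise Finset.univ q, Finset.smul_sum]
  refine Finset.sum_congr rfl fun p _ => ?_
  have h : ∀ e ∈ Finset.univ.filter fun e => q e = p, Φ e = Φ (α p) := fun e he => by
    rw [hΦ, (Finset.mem_filter.1 he).2]
  rw [Finset.sum_congr rfl h, Finset.sum_const]
  congr 1
  obtain ⟨s, hs⟩ := hc p p₀
  refine Finset.card_bij (fun e _ => s e) (fun e he => ?_) (fun e _ e' _ h => s.injective h)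
    (fun e he => ⟨s.symm e, ?_, s.apply_symm_apply e⟩)
  · simpa [← hs] using he
  · simpa [hs] using he

variable {k : Type u} [Field k] {x y : C} {G H : Type} [Group G]
    [Group H] {ρ : G →* End x} {ρ' : H →* End y} {ι E : Type} [Fintype ι] [Fintype E]
    {gens : ι → (y ⟶ x)} {eh : E → (y ⟶ x)}

theorem IsInv.post {V : Type u} [AddCommGroup V] [Module k V] {x' : C} {Φ : (y ⟶ x') → V}
    (hΦ : IsInv k R R' ρ' Φ) (f : x ⟶ x') : IsInv k R R' ρ' fun h : y ⟶ x => Φ (h ≫ f) where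
  inv σ h := by rw [Category.assoc, hΦ.inv]
  sign hs hs' := hΦ.sign (R.post f hs) (R'.post f hs')

theorem IsFam.mk' [DecidableEq ι] (q : E → ι) (α : ι → E) (hgens : ∀ i, gens i = eh (α i))
    (hα : ∀ p, q (α p) = p) (hc : ∀ p p', ∃ s : Equiv.Perm E, ∀ e, q e = p ↔ q (s e) = p')
    (p₀ : ι) (hΦ : ∀ {V : Type u} [AddCommGroup V] [Module k V] (Φ : (y ⟶ x) → V),
      IsInv k R R' ρ' Φ → ∀ e, Φ (eh e) = Φ (eh (α (q e))))
    (act : ∀ σ : G, ∃ s : Equiv.Perm E, ∀ e, eh e ≫ ρ σ = eh (s e)) :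
    IsFam k R R' ρ ρ' gens eh where
  avg := by
    refine ⟨(Finset.univ.filter fun e => q e = p₀).card, ?_, fun {V _ _} Φ hΦ' => ?_⟩
    · refine Finset.card_ne_zero_of_mem (a := α p₀) ?_
      simp [hα]
    · rw [Nat.cast_smul_eq_nsmul, sum_avg q α hc p₀ (fun e => Φ (eh e)) (hΦ Φ hΦ')]
      simp only [hgens]
  act := act

theorem IsFam.sumInv [CharZero k] (h : IsFam k R R' ρ ρ' gens eh) :
    SumInv k R R' ρ ρ' gens := by
  intro V _ _ Φ hΦ σ
  obtain ⟨c, hc, hav⟩ := h.avg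
  obtain ⟨s, hs⟩ := h.act σ
  refine smul_right_injective V (Nat.cast_ne_zero.2 hc : (c : k) ≠ 0) ?_
  change (c : k) • ∑ i, Φ (gens i ≫ ρ σ) = (c : k) • ∑ i, Φ (gens i)
  rw [← hav Φ hΦ, ← hav _ (hΦ.post (ρ σ)), ← Equiv.sum_comp s fun e => Φ (eh e)]
  exact Finset.sum_congr rfl fun e _ => congrArg Φ (hs e)

theorem IsFam.sumZero [CharZero k] (h : IsFam k R R' ρ ρ' gens eh) {z : C} {L : Type} [Group L]
    {ρ'' : L →* End z} {κ F : Type} [Fintype κ] [Fintype F] {gens' : κ → (z ⟶ y)}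
    {fh : F → (z ⟶ y)} (h' : IsFam k R R' ρ' ρ'' gens' fh)
    (hsw : ∀ f : F, ∃ t : Equiv.Perm E, ∀ e, ∃ s s', R.rel (fh f ≫ eh e) (fh f ≫ eh (t e)) s ∧
      R'.rel (fh f ≫ eh e) (fh f ≫ eh (t e)) s' ∧ s * s' = -1) :
    SumZero k R R' ρ'' gens gens' := by
  intro V _ _ Φ hΦ
  obtain ⟨c, hc, hav⟩ := h.avg
  obtain ⟨c', hc', hav'⟩ := h'.avg
  have h1 : (c' : k) • ∑ i, ∑ j, Φ (gens' j ≫ gens i) = ∑ i, ∑ f, Φ (fh f ≫ gens i) := by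
    rw [Finset.smul_sum]
    exact Finset.sum_congr rfl fun i _ => (hav' _ (hΦ.post (gens i))).symm
  have h2 : IsInv k R R' ρ' fun g : y ⟶ x => ∑ f, Φ (fh f ≫ g) :=
    { inv := fun σ g => by
        obtain ⟨s, hs⟩ := h'.act σ
        rw [← Equiv.sum_comp s fun f => Φ (fh f ≫ g)]
        refine Finset.sum_congr rfl fun f _ => ?_
        rw [← hs, Category.assoc]
      sign := fun hs hs' => by
        rw [Finset.smul_sum]
        exact Finset.sum_congr rfl fun f _ => hΦ.sign (R.pre (fh f) hs) (R'.pre (fh f) hs') }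
  have h3 : ∑ e, ∑ f, Φ (fh f ≫ eh e) = 0 := by
    rw [Finset.sum_comm]
    refine Finset.sum_eq_zero fun f _ => ?_
    obtain ⟨t, ht⟩ := hsw f
    have h4 : ∑ e, Φ (fh f ≫ eh e) = -∑ e, Φ (fh f ≫ eh e) := by
      conv_lhs => rw [← Equiv.sum_comp t]
      rw [← Finset.sum_neg_distrib]
      refine Finset.sum_congr rfl fun e _ => ?_
      obtain ⟨s, s', hs, hs', hm⟩ := ht e
      rw [hΦ.sign hs hs', hm]
      simp [sgn]
    have h5 : (2 : k) • ∑ e, Φ (fh f ≫ eh e) = 0 := by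
      rw [two_smul]
      nth_rewrite 2 [h4]
      exact add_neg_cancel _
    exact (smul_eq_zero.1 h5).resolve_left two_ne_zero
  have h6 : (c : k) • (c' : k) • ∑ i, ∑ j, Φ (gens' j ≫ gens i) = 0 := by
    rw [h1, ← hav _ h2, h3]
  exact ((smul_eq_zero.1 ((smul_eq_zero.1 h6).resolve_left (Nat.cast_ne_zero.2 hc))).resolve_left
    (Nat.cast_ne_zero.2 hc'))

end Averaging

/-! Bijections with prescribed values on the second summand. -/

theorem exists_perm_of_agree {A K B : Type} [Finite A] {e e' : A ⊕ K ≃ B}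
    (h : ∀ c, e (Sum.inr c) = e' (Sum.inr c)) :
    ∃ π : Equiv.Perm A, e = (Equiv.sumCongr π (Equiv.refl K)).trans e' := by
  have h1 : ∀ a, ∃ b, e'.symm (e (Sum.inl a)) = Sum.inl b := fun a => by
    rcases hx : e'.symm (e (Sum.inl a)) with b | c
    · exact ⟨b, rfl⟩
    · rw [Equiv.symm_apply_eq, ← h] at hx
      exact absurd (e.injective hx) Sum.inl_ne_inr
  choose p hp using h1
  have hinj : Function.Injective p := fun a b hab => by
    have := (hp a).trans ((congrArg Sum.inl hab).trans (hp b).symm)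
    exact Sum.inl_injective (e.injective (e'.symm.injective this))
  refine ⟨Equiv.ofBijective p (Finite.injective_iff_bijective.1 hinj), ?_⟩
  ext x
  rcases x with a | c
  · change e (Sum.inl a) = e' (Sum.inl (p a))
    rw [← hp, Equiv.apply_symm_apply]
  · exact h c

/-- The exchange of the two copies of `K` in `(A ⊔ K) ⊔ K`. -/
def exch (A K : Type) : (A ⊕ K) ⊕ K ≃ (A ⊕ K) ⊕ K :=
  (Equiv.sumAssoc A K K).trans
    ((Equiv.sumCongr (Equiv.refl A) (Equiv.sumComm K K)).trans (Equiv.sumAssoc A K K).symm)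

/-- The exchange of the images of the two copies of `K`. -/
def exchPerm {A K B : Type} (e' : A ⊕ K ≃ B) : Equiv.Perm (B ⊕ K) :=
  (Equiv.sumCongr e'.symm (Equiv.refl K)).trans
    ((exch A K).trans (Equiv.sumCongr e' (Equiv.refl K)))

theorem exchPerm_inl {A K B : Type} (e' : A ⊕ K ≃ B) (a : A) :
    exchPerm e' (Sum.inl (e' (Sum.inl a))) = Sum.inl (e' (Sum.inl a)) := by
  simp [exchPerm, exch]

theorem exchPerm_inl_inr {A K B : Type} (e' : A ⊕ K ≃ B) (c : K) :
    exchPerm e' (Sum.inl (e' (Sum.inr c))) = Sum.inr c := by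
  simp [exchPerm, exch]

theorem exchPerm_inr {A K B : Type} (e' : A ⊕ K ≃ B) (c : K) :
    exchPerm e' (Sum.inr c) = Sum.inl (e' (Sum.inr c)) := by
  simp [exchPerm, exch]

/-- Precomposition with a permutation. -/
def preEquiv {A B : Type} (w : Equiv.Perm A) : Equiv.Perm (A ≃ B) where
  toFun e := w.trans e
  invFun e := w.symm.trans e
  left_inv e := by ext; simp
  right_inv e := by ext; simp

/-- Postcomposition with a permutation. -/
def postEquiv {A B : Type} (w : Equiv.Perm B) : Equiv.Perm (A ≃ B) where
  toFun e := e.trans w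
  invFun e := e.trans w.symm
  left_inv e := by ext; simp
  right_inv e := by ext; simp

theorem signChar_swap (ε : ℤˣ) : signChar (-ε) (-1) * signChar ε (-1) = -1 := by
  rcases Int.units_eq_one_or ε with rfl | rfl <;> decide

/-! The directed/undirected case. -/

theorem sum_elim_bijective {A K B : Type} [Fintype A] [Fintype K] [Fintype B] {u : A → B}
    {v : K → B} (hu : Function.Injective u) (hv : Function.Injective v) (h : ∀ a c, u a ≠ v c)
    (hc : Fintype.card A + Fintype.card K = Fintype.card B) :
    Function.Bijective (Sum.elim u v) := by
  rw [Fintype.bijective_iff_injective_and_card, Fintype.card_sum]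
  exact ⟨hu.sumElim hv h, hc⟩

/-- The set of the two-element subsets `{i < j}` of `Fin (n + 2)`. -/
abbrev Pairs (n : ℕ) : Type := {p : Fin (n + 2) × Fin (n + 2) // p.1 < p.2}

theorem card_compl_pair {n : ℕ} (p : Pairs n) :
    (({p.1.1, p.1.2} : Finset (Fin (n + 2)))ᶜ).card = n := by
  rw [Finset.card_compl, Finset.card_pair p.2.ne, Fintype.card_fin, Nat.add_sub_cancel]

/-- The bijection `Fin n ⊔ (Fin 2 × Fin 1) ≃ Fin (n + 2)` that is order preserving from `Fin n` to
the complement of `{i, j}` and sends the pair to `(i, j)`. -/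
def alphaEquiv {n : ℕ} (p : Pairs n) : Fin n ⊕ (Fin 2 × Fin 1) ≃ Fin (n + 2) :=
  Equiv.ofBijective
    (Sum.elim (fun a => ({p.1.1, p.1.2} : Finset (Fin (n + 2)))ᶜ.orderEmbOfFin (card_compl_pair p) a)
      (fun c => if c.1 = 0 then p.1.1 else p.1.2))
    (sum_elim_bijective (RelEmbedding.injective _)
      (by
        have hp := p.2.ne
        rintro ⟨c, j⟩ ⟨c', j'⟩ h
        fin_cases c <;> fin_cases c' <;> simp_all [Subsingleton.elim j j'])
      (fun a c h => by
        have hm := Finset.orderEmbOfFin_mem _ (card_compl_pair p) a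
        rw [h, Finset.mem_compl, Finset.mem_insert, Finset.mem_singleton] at hm
        split_ifs at hm <;> simp at hm)
      (by simp))

theorem alphaEquiv_zero {n : ℕ} (p : Pairs n) : alphaEquiv p (Sum.inr (0, 0)) = p.1.1 := rfl
theorem alphaEquiv_one {n : ℕ} (p : Pairs n) : alphaEquiv p (Sum.inr (1, 0)) = p.1.2 := rfl

/-- The diagram of degree one given by a bijection. -/
def dirOne {A B : Type} (e : A ⊕ (Fin 2 × Fin 1) ≃ B) : DirHom A B := ⟨1, e⟩

/-- The diagram of degree one with the pair `(i, j)`. -/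
def alpha {n : ℕ} (p : Pairs n) : dirObj n ⟶ dirObj (n + 2) := dirOne (alphaEquiv p)

/-- The action of the symmetric group on the standard finite set. -/
def dirSym (n : ℕ) : Equiv.Perm (Fin n) →* End (dirObj n) where
  toFun σ := DirHom.ofEquiv σ
  map_one' := rfl
  map_mul' σ τ := (DirHom.ofEquiv_comp τ σ).symm

theorem ofEquiv_dirOne {A A' B : Type} (π : A ≃ A') (e : A' ⊕ (Fin 2 × Fin 1) ≃ B) :
    (DirHom.ofEquiv π).comp (dirOne e) =
      dirOne ((Equiv.sumCongr π (Equiv.refl (Fin 2 × Fin 1))).trans e) := by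
  have h : ∀ (c : Fin 2) (j : Fin (0 + 1)),
      DirHom.glue (DirHom.ofEquiv π).e e (Sum.inr (c, j)) = e (Sum.inr (c, 0)) := fun c j => by
    obtain rfl : j = Fin.natAdd 0 (0 : Fin 1) := Subsingleton.elim (α := Fin 1) _ _
    exact DirHom.glue_natAdd (DirHom.ofEquiv π).e e c (0 : Fin 1)
  refine DirHom.ext' rfl (fun _ => rfl) (fun c j => (h c j).trans ?_)
  exact congrArg (fun i : Fin 1 => e (Sum.inr (c, i))) (Subsingleton.elim _ _)

theorem dirOne_ofEquiv {A B B' : Type} (e : A ⊕ (Fin 2 × Fin 1) ≃ B) (π : B ≃ B') :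
    (dirOne e).comp (DirHom.ofEquiv π) = dirOne (e.trans π) :=
  DirHom.ext' rfl (fun _ => rfl) (fun c j => DirHom.glue_castAdd e (DirHom.ofEquiv π).e c j)

/-- The exchange of the two entries of the pair. -/
def flipEquiv (A : Type) : Equiv.Perm (A ⊕ (Fin 2 × Fin 1)) :=
  Equiv.sumCongr (Equiv.refl A) (Equiv.prodCongr (Equiv.swap 0 1) (Equiv.refl _))

theorem dirOne_flip {A B : Type} (e : A ⊕ (Fin 2 × Fin 1) ≃ B) :
    dirOne ((flipEquiv A).trans e) = (dirOne e).wr (fun _ => Equiv.swap 0 1) 1 :=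
  DirHom.ext' rfl (fun _ => rfl) (fun _ _ => rfl)

/-- All diagrams of degree one. -/
abbrev DirAll (n : ℕ) : Type := Fin n ⊕ (Fin 2 × Fin 1) ≃ Fin (n + 2)

theorem dirAll_ne {n : ℕ} (e : DirAll n) : e (Sum.inr (0, 0)) ≠ e (Sum.inr (1, 0)) := by
  intro h
  simpa using e.injective h

/-- The unordered pair of a diagram of degree one. -/
def dirPair {n : ℕ} (e : DirAll n) : Pairs n :=
  if h : e (Sum.inr (0, 0)) < e (Sum.inr (1, 0)) then ⟨(e (Sum.inr (0, 0)), e (Sum.inr (1, 0))), h⟩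
  else ⟨(e (Sum.inr (1, 0)), e (Sum.inr (0, 0))), lt_of_le_of_ne (not_lt.1 h) (dirAll_ne e).symm⟩

theorem dirPair_eq {n : ℕ} (e : DirAll n) (p : Pairs n) : dirPair e = p ↔
    (e (Sum.inr (0, 0)) = p.1.1 ∧ e (Sum.inr (1, 0)) = p.1.2) ∨
    (e (Sum.inr (0, 0)) = p.1.2 ∧ e (Sum.inr (1, 0)) = p.1.1) := by
  obtain ⟨⟨i, j⟩, hp⟩ := p
  have := dirAll_ne e
  unfold dirPair
  split_ifs with h
  · rw [Subtype.mk.injEq, Prod.mk.injEq]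
    constructor
    · exact Or.inl
    · rintro (h' | h')
      · exact h'
      · rw [h'.1, h'.2] at h
        exact absurd h hp.asymm
  · rw [Subtype.mk.injEq, Prod.mk.injEq]
    constructor
    · exact fun h' => Or.inr h'.symm
    · rintro (h' | h')
      · rw [h'.1, h'.2] at h
        exact absurd hp h
      · exact h'.symm

theorem inr_ext {A B : Type} {e e' : A ⊕ (Fin 2 × Fin 1) ≃ B}
    (h0 : e (Sum.inr (0, 0)) = e' (Sum.inr (0, 0))) (h1 : e (Sum.inr (1, 0)) = e' (Sum.inr (1, 0)))
    (c : Fin 2 × Fin 1) : e (Sum.inr c) = e' (Sum.inr c) := by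
  obtain ⟨c, j⟩ := c
  obtain rfl : j = 0 := Subsingleton.elim _ _
  fin_cases c
  · exact h0
  · exact h1

theorem dir_isFam (k : Type u) [Field k] (δ ε : ℤˣ) (n : ℕ) :
    IsFam k (undirRel δ (-ε)) (undirRel δ ε) (dirSym (n + 2)) (dirSym n) alpha
      (fun e : DirAll n => (dirOne e : dirObj n ⟶ dirObj (n + 2))) := by
  refine IsFam.mk' dirPair alphaEquiv (fun _ => rfl) (fun p => ?_) (fun p p' => ?_)
    ⟨(0, 1), by simp⟩ (fun Φ hΦ e => ?_) (fun σ => ?_)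
  · rw [dirPair_eq]
    exact Or.inl ⟨rfl, rfl⟩
  · let t : Equiv.Perm (Fin (n + 2)) := (alphaEquiv p).symm.trans (alphaEquiv p')
    have ht1 : t p.1.1 = p'.1.1 := by
      change alphaEquiv p' ((alphaEquiv p).symm p.1.1) = _
      rw [← alphaEquiv_zero p, Equiv.symm_apply_apply, alphaEquiv_zero]
    have ht2 : t p.1.2 = p'.1.2 := by
      change alphaEquiv p' ((alphaEquiv p).symm p.1.2) = _
      rw [← alphaEquiv_one p, Equiv.symm_apply_apply, alphaEquiv_one]
    refine ⟨postEquiv t, fun e => ?_⟩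
    rw [dirPair_eq, dirPair_eq, ← ht1, ← ht2]
    change _ ↔ (t _ = t _ ∧ t _ = t _) ∨ (t _ = t _ ∧ t _ = t _)
    simp only [t.injective.eq_iff]
  · have key : ∀ e e' : DirAll n, (∀ c, e (Sum.inr c) = e' (Sum.inr c)) →
        Φ (dirOne e) = Φ (dirOne e') := fun e e' h => by
      obtain ⟨π, rfl⟩ := exists_perm_of_agree h
      exact (congrArg Φ (ofEquiv_dirOne π e').symm).trans (hΦ.inv π (dirOne e'))
    rcases (dirPair_eq e (dirPair e)).1 rfl with h | h
    · exact key _ _ (inr_ext h.1 h.2)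
    · have h1 : Φ (dirOne ((flipEquiv (Fin n)).trans e)) = Φ (dirOne (alphaEquiv (dirPair e))) :=
        key _ _ (inr_ext h.2 h.1)
      have h2 : ∀ ε', (undirRel δ ε').rel (dirOne e : dirObj n ⟶ dirObj (n + 2))
          (dirOne ((flipEquiv (Fin n)).trans e))
          (wrChar δ ε' (fun _ : Fin 1 => Equiv.swap 0 1) 1) := fun ε' =>
        ⟨fun _ => Equiv.swap 0 1, 1, dirOne_flip e, rfl⟩
      have h3 := hΦ.sign (h2 (-ε)) (h2 ε)
      have h4 : wrChar δ (-ε) (fun _ : Fin 1 => (Equiv.swap 0 1 : Equiv.Perm (Fin 2))) 1 *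
          wrChar δ ε (fun _ : Fin 1 => (Equiv.swap 0 1 : Equiv.Perm (Fin 2))) 1 = 1 := by
        simp [wrChar, signChar_one]
      rw [h4, sgn_one, one_smul] at h3
      exact h3.symm.trans h1
  · exact ⟨postEquiv σ, fun e => dirOne_ofEquiv e σ⟩

theorem dirOne_comp_exch {A B C : Type} (f : A ⊕ (Fin 2 × Fin 1) ≃ B)
    (e : B ⊕ (Fin 2 × Fin 1) ≃ C) :
    (dirOne f).comp (dirOne ((exchPerm f).trans e)) =
      ((dirOne f).comp (dirOne e)).wr (fun _ => 1) (Equiv.swap 0 1 : Equiv.Perm (Fin 2)) := by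
  refine DirHom.ext' rfl (fun a => ?_) ?_
  · exact congrArg e (exchPerm_inl f a)
  · have h : ∀ (c : Fin 2) (j : Fin (1 + 1)),
        DirHom.glue f ((exchPerm f).trans e) (Sum.inr (c, j)) =
          DirHom.glue f e (Sum.inr (c, Equiv.swap (0 : Fin 2) 1 j)) := fun c j => by
      refine Fin.addCases (fun i => ?_) (fun i => ?_) j
      · obtain rfl : i = 0 := Subsingleton.elim _ _
        refine (DirHom.glue_castAdd f ((exchPerm f).trans e) c 0).trans ?_
        refine Eq.trans ?_ (DirHom.glue_natAdd f e c 0).symm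
        exact congrArg e (exchPerm_inl_inr f (c, 0))
      · obtain rfl : i = 0 := Subsingleton.elim _ _
        refine (DirHom.glue_natAdd f ((exchPerm f).trans e) c 0).trans ?_
        refine Eq.trans ?_ (DirHom.glue_castAdd f e c 0).symm
        exact congrArg e (exchPerm_inr f (c, 0))
    exact h

theorem dir_exch (δ ε : ℤˣ) {n : ℕ} (f : DirAll n) (e : DirAll (n + 2)) :
    (undirRel δ ε).rel ((dirOne f : dirObj n ⟶ dirObj (n + 2)) ≫
        (dirOne e : dirObj (n + 2) ⟶ dirObj (n + 4)))
      ((dirOne f : dirObj n ⟶ dirObj (n + 2)) ≫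
        (dirOne ((exchPerm f).trans e) : dirObj (n + 2) ⟶ dirObj (n + 4))) (signChar ε (-1)) := by
  refine ⟨fun _ => 1, (Equiv.swap 0 1 : Equiv.Perm (Fin 2)), dirOne_comp_exch f e, ?_⟩
  have h : wrChar δ ε (fun _ : Fin 2 => (1 : Equiv.Perm (Fin 2))) (Equiv.swap (0 : Fin 2) 1) =
      signChar ε (-1) := by
    simp [wrChar, signChar_one]
  exact h.symm

theorem dir_sumInv (k : Type u) [Field k] [CharZero k] (δ ε : ℤˣ) (n : ℕ) :
    SumInv k (undirRel δ (-ε)) (undirRel δ ε) (dirSym (n + 2)) (dirSym n) alpha :=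
  (dir_isFam k δ ε n).sumInv

theorem dir_sumZero (k : Type u) [Field k] [CharZero k] (δ ε : ℤˣ) (n : ℕ) :
    SumZero k (undirRel δ (-ε)) (undirRel δ ε) (dirSym n) (alpha (n := n + 2)) (alpha (n := n)) :=
  (dir_isFam k δ ε (n + 2)).sumZero (dir_isFam k δ ε n) fun f => ⟨preEquiv (exchPerm f), fun e =>
    ⟨_, _, dir_exch δ (-ε) f e, dir_exch δ ε f e, signChar_swap ε⟩⟩

/-! The walled case. -/

/-- The bijection `Fin m ⊔ Fin 1 ≃ Fin (m + 1)` that is order preserving from `Fin m` to the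
complement of `i` and sends the point to `i`. -/
def betaEquiv {m : ℕ} (i : Fin (m + 1)) : Fin m ⊕ Fin 1 ≃ Fin (m + 1) :=
  Equiv.ofBijective (Sum.elim i.succAbove (fun _ => i))
    (sum_elim_bijective Fin.succAbove_right_injective (fun _ _ _ => Subsingleton.elim _ _)
      (fun a _ => Fin.succAbove_ne i a) (by simp))

/-- The walled diagram of degree one given by a pair of bijections. -/
def walOne {X Y U V : Type} (e : (X ⊕ Fin 1 ≃ U) × (Y ⊕ Fin 1 ≃ V)) : WalHom X Y U V :=
  ⟨1, e.1, e.2⟩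

/-- The walled diagram of degree one with the pair `(i, j)`. -/
def beta {p : ℕ × ℕ} (ij : Fin (p.1 + 1) × Fin (p.2 + 1)) :
    walObj p ⟶ walObj (p.1 + 1, p.2 + 1) :=
  walOne (betaEquiv ij.1, betaEquiv ij.2)

/-- The action of the product of symmetric groups on the standard pair of finite sets. -/
def walSym (p : ℕ × ℕ) : Equiv.Perm (Fin p.1) × Equiv.Perm (Fin p.2) →* End (walObj p) where
  toFun σ := WalHom.ofEquiv σ.1 σ.2
  map_one' := rfl
  map_mul' σ τ := (WalHom.ofEquiv_comp τ.1 τ.2 σ.1 σ.2).symm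

theorem half_ofEquiv {X X' U : Type} (π : X ≃ X') (e : X' ⊕ Fin 1 ≃ U) (j : Fin (0 + 1)) :
    WalHom.half ((Equiv.sumEmpty X (Fin 0)).trans π) e (Sum.inr j) =
      e (Sum.inr (Fin.cast (Nat.zero_add 1) j)) := by
  obtain rfl : j = Fin.natAdd 0 (0 : Fin 1) := Subsingleton.elim (α := Fin 1) _ _
  exact WalHom.half_natAdd ((Equiv.sumEmpty X (Fin 0)).trans π) e (0 : Fin 1)

theorem ofEquiv_walOne {X Y X' Y' U V : Type} (π : X ≃ X') (π' : Y ≃ Y')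
    (e : (X' ⊕ Fin 1 ≃ U) × (Y' ⊕ Fin 1 ≃ V)) :
    (WalHom.ofEquiv π π').comp (walOne e) =
      walOne ((Equiv.sumCongr π (Equiv.refl (Fin 1))).trans e.1,
        (Equiv.sumCongr π' (Equiv.refl (Fin 1))).trans e.2) :=
  WalHom.ext' rfl (fun _ => rfl) (half_ofEquiv π e.1) (fun _ => rfl) (half_ofEquiv π' e.2)

theorem walOne_ofEquiv {X Y U V U' V' : Type} (e : (X ⊕ Fin 1 ≃ U) × (Y ⊕ Fin 1 ≃ V))
    (π : U ≃ U') (π' : V ≃ V') :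
    (walOne e).comp (WalHom.ofEquiv π π') = walOne (e.1.trans π, e.2.trans π') :=
  WalHom.ext' rfl (fun _ => rfl) (fun j => WalHom.half_castAdd e.1 (WalHom.ofEquiv π π').e₁ j)
    (fun _ => rfl) (fun j => WalHom.half_castAdd e.2 (WalHom.ofEquiv π π').e₂ j)

/-- All walled diagrams of degree one. -/
abbrev WalAll (p : ℕ × ℕ) : Type :=
  (Fin p.1 ⊕ Fin 1 ≃ Fin (p.1 + 1)) × (Fin p.2 ⊕ Fin 1 ≃ Fin (p.2 + 1))

theorem wal_isFam (k : Type u) [Field k] (ε : ℤˣ) (p : ℕ × ℕ) :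
    IsFam k (walRel (-ε)) (walRel ε) (walSym (p.1 + 1, p.2 + 1)) (walSym p) beta
      (fun e : WalAll p => (walOne e : walObj p ⟶ walObj (p.1 + 1, p.2 + 1))) := by
  refine IsFam.mk' (fun e => (e.1 (Sum.inr 0), e.2 (Sum.inr 0)))
    (fun ij => (betaEquiv ij.1, betaEquiv ij.2)) (fun _ => rfl) (fun _ => rfl) (fun q q' => ?_)
    (0, 0) (fun Φ hΦ e => ?_) (fun σ => ?_)
  · refine ⟨Equiv.prodCongr (postEquiv (Equiv.swap q.1 q'.1)) (postEquiv (Equiv.swap q.2 q'.2)),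
      fun e => ?_⟩
    change _ ↔ (Equiv.swap q.1 q'.1 (e.1 (Sum.inr 0)), Equiv.swap q.2 q'.2 (e.2 (Sum.inr 0))) = q'
    rw [Prod.ext_iff, Prod.ext_iff]
    change _ ∧ _ ↔ Equiv.swap q.1 q'.1 (e.1 (Sum.inr 0)) = q'.1 ∧
      Equiv.swap q.2 q'.2 (e.2 (Sum.inr 0)) = q'.2
    rw [Equiv.swap_apply_eq_iff, Equiv.swap_apply_eq_iff, Equiv.swap_apply_right,
      Equiv.swap_apply_right]
  · have key : ∀ e e' : WalAll p, e.1 (Sum.inr 0) = e'.1 (Sum.inr 0) →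
        e.2 (Sum.inr 0) = e'.2 (Sum.inr 0) → Φ (walOne e) = Φ (walOne e') := fun e e' h h' => by
      obtain ⟨e₁, e₂⟩ := e
      obtain ⟨π, hπ⟩ := exists_perm_of_agree (e := e₁) (e' := e'.1) fun c => by
        rw [Subsingleton.elim c 0]; exact h
      obtain ⟨π', hπ'⟩ := exists_perm_of_agree (e := e₂) (e' := e'.2) fun c => by
        rw [Subsingleton.elim c 0]; exact h'
      rw [hπ, hπ']
      exact (congrArg Φ (ofEquiv_walOne π π' e').symm).trans (hΦ.inv (π, π') (walOne e'))
    exact key _ _ rfl rfl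
  · exact ⟨Equiv.prodCongr (postEquiv σ.1) (postEquiv σ.2), fun e => walOne_ofEquiv e σ.1 σ.2⟩

theorem half_exch {X U S : Type} (f : X ⊕ Fin 1 ≃ U) (e : U ⊕ Fin 1 ≃ S) (j : Fin (1 + 1)) :
    WalHom.half f ((exchPerm f).trans e) (Sum.inr j) =
      WalHom.half f e (Sum.inr (Equiv.swap (0 : Fin 2) 1 j)) := by
  refine Fin.addCases (fun i => ?_) (fun i => ?_) j
  · obtain rfl : i = 0 := Subsingleton.elim _ _
    refine (WalHom.half_castAdd f ((exchPerm f).trans e) 0).trans ?_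
    refine Eq.trans ?_ (WalHom.half_natAdd f e 0).symm
    exact congrArg e (exchPerm_inl_inr f 0)
  · obtain rfl : i = 0 := Subsingleton.elim _ _
    refine (WalHom.half_natAdd f ((exchPerm f).trans e) 0).trans ?_
    refine Eq.trans ?_ (WalHom.half_castAdd f e 0).symm
    exact congrArg e (exchPerm_inr f 0)

theorem walOne_comp_exch {X Y U V S T : Type} (f : (X ⊕ Fin 1 ≃ U) × (Y ⊕ Fin 1 ≃ V))
    (e : (U ⊕ Fin 1 ≃ S) × (V ⊕ Fin 1 ≃ T)) :
    (walOne f).comp (walOne ((exchPerm f.1).trans e.1, (exchPerm f.2).trans e.2)) =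
      ((walOne f).comp (walOne e)).perm (Equiv.swap 0 1 : Equiv.Perm (Fin 2)) :=
  WalHom.ext' rfl (fun a => congrArg e.1 (exchPerm_inl f.1 a)) (half_exch f.1 e.1)
    (fun a => congrArg e.2 (exchPerm_inl f.2 a)) (half_exch f.2 e.2)

theorem wal_exch (ε : ℤˣ) {p : ℕ × ℕ} (f : WalAll p) (e : WalAll (p.1 + 1, p.2 + 1)) :
    (walRel ε).rel ((walOne f : walObj p ⟶ walObj (p.1 + 1, p.2 + 1)) ≫
        (walOne e : walObj (p.1 + 1, p.2 + 1) ⟶ walObj (p.1 + 2, p.2 + 2)))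
      ((walOne f : walObj p ⟶ walObj (p.1 + 1, p.2 + 1)) ≫
        (walOne ((exchPerm f.1).trans e.1, (exchPerm f.2).trans e.2) :
          walObj (p.1 + 1, p.2 + 1) ⟶ walObj (p.1 + 2, p.2 + 2))) (signChar ε (-1)) := by
  refine ⟨(Equiv.swap 0 1 : Equiv.Perm (Fin 2)), walOne_comp_exch f e, ?_⟩
  have h : Equiv.Perm.sign (Equiv.swap (0 : Fin 2) 1) = -1 := Equiv.Perm.sign_swap (by decide)
  exact congrArg (signChar ε) h.symm

theorem wal_sumInv (k : Type u) [Field k] [CharZero k] (ε : ℤˣ) (p : ℕ × ℕ) :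
    SumInv k (walRel (-ε)) (walRel ε) (walSym (p.1 + 1, p.2 + 1)) (walSym p) beta :=
  (wal_isFam k ε p).sumInv

theorem wal_sumZero (k : Type u) [Field k] [CharZero k] (ε : ℤˣ) (p : ℕ × ℕ) :
    SumZero k (walRel (-ε)) (walRel ε) (walSym p) (beta (p := (p.1 + 1, p.2 + 1)))
      (beta (p := p)) :=
  (wal_isFam k ε (p.1 + 1, p.2 + 1)).sumZero (wal_isFam k ε p) fun f =>
    ⟨Equiv.prodCongr (preEquiv (exchPerm f.1)) (preEquiv (exchPerm f.2)), fun e =>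
      ⟨_, _, wal_exch (-ε) f e, wal_exch ε f e, signChar_swap ε⟩⟩

/-! The complexes. Both are graded by the total number of points, so that the differentials have
degree `-2`. -/

section Complexes

variable (k : Type u) [Field k] [CharZero k] (δ ε : ℤˣ)

/-- The term `Hom(n, -) ⊗_{kS_n} M(n)` of the first Koszul complex. -/
abbrev dirTerm (M : LMod k (KUB k δ ε)ᵒᵖ) (n : ℕ) : LMod k (KUB k δ (-ε)) := kTerm (dirSym n) M

/-- The differential of the first Koszul complex: `g ⊗ m ↦ ∑ g[α] ⊗ [α]m`, where the sum is over
`i < j`, and `α` is the diagram with the only pair `(i, j)`. -/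
def dirDiff (M : LMod k (KUB k δ ε)ᵒᵖ) (n : ℕ) : dirTerm k δ ε M (n + 2) ⟶ dirTerm k δ ε M n :=
  kDiff (dirSym (n + 2)) (dirSym n) (dir_sumInv k δ ε n) M

theorem dirDiff_comp (M : LMod k (KUB k δ ε)ᵒᵖ) (n : ℕ) :
    dirDiff k δ ε M (n + 2) ≫ dirDiff k δ ε M n = 0 :=
  kDiff_comp _ _ _ _ _ (dir_sumZero k δ ε n) M

/-- The first Koszul complex. -/
def firstKoszulObj (M : LMod k (KUB k δ ε)ᵒᵖ) :
    HomologicalComplex (LMod k (KUB k δ (-ε))) (ComplexShape.down' 2) where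
  X n := dirTerm k δ ε M n
  d i j := if h : j + 2 = i then
    eqToHom (congrArg (dirTerm k δ ε M) h.symm) ≫ dirDiff k δ ε M j else 0
  shape i j h := dif_neg h
  d_comp_d' i j l h h' := by
    obtain rfl : j + 2 = i := h
    obtain rfl : l + 2 = j := h'
    rw [dif_pos rfl, dif_pos rfl, eqToHom_refl, Category.id_comp, eqToHom_refl, Category.id_comp,
      dirDiff_comp]

/-- The first Koszul complex, as a functor. -/
def firstKoszul : LMod k (KUB k δ ε)ᵒᵖ ⥤
    HomologicalComplex (LMod k (KUB k δ (-ε))) (ComplexShape.down' 2) where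
  obj M := firstKoszulObj k δ ε M
  map φ :=
    { f := fun n => termMap (dirSym n) φ
      comm' := fun i j h => by
        obtain rfl : j + 2 = i := h
        dsimp only [firstKoszulObj]
        rw [dif_pos rfl, dif_pos rfl, eqToHom_refl, Category.id_comp, eqToHom_refl,
          Category.id_comp]
        exact (kDiff_nat _ _ _ φ).symm }
  map_id M := by
    ext n : 1
    exact termMap_id _
  map_comp φ ψ := by
    ext n : 1
    exact termMap_comp _ φ ψ

/-- The term `Hom((m, n), -) ⊗_{k(S_m × S_n)} M(m, n)` of the walled first Koszul complex. -/
abbrev walTerm (M : LMod k (KUWB k ε)ᵒᵖ) (p : ℕ × ℕ) : LMod k (KUWB k (-ε)) := kTerm (walSym p) M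

/-- The differential of the walled first Koszul complex: `g ⊗ m ↦ ∑ g[β] ⊗ [β]m`, where the sum is
over `i` and `j`, and `β` is the walled diagram with the only pair `(i, j)`. -/
def walDiff (M : LMod k (KUWB k ε)ᵒᵖ) (p : ℕ × ℕ) :
    walTerm k ε M (p.1 + 1, p.2 + 1) ⟶ walTerm k ε M p :=
  kDiff (walSym (p.1 + 1, p.2 + 1)) (walSym p) (wal_sumInv k ε p) M

theorem walDiff_comp (M : LMod k (KUWB k ε)ᵒᵖ) (p : ℕ × ℕ) :
    walDiff k ε M (p.1 + 1, p.2 + 1) ≫ walDiff k ε M p = 0 :=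
  kDiff_comp _ _ _ _ _ (wal_sumZero k ε p) M

/-- The pairs of cardinalities with a given total. -/
abbrev Bideg (N : ℕ) : Type := {p : ℕ × ℕ // p.1 + p.2 = N}

/-- The component of the differential on the summand of bidegree `p`; it vanishes unless both
entries are positive. -/
def walComp (M : LMod k (KUWB k ε)ᵒᵖ) (j : ℕ) : ∀ p : ℕ × ℕ,
    walTerm k ε M p ⟶ LMod.dsum fun q : Bideg j => walTerm k ε M q.1
  | (m + 1, n + 1) => if h : m + n = j then
      walDiff k ε M (m, n) ≫ LMod.dsumIncl (fun q : Bideg j => walTerm k ε M q.1) ⟨(m, n), h⟩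
    else 0
  | _ => 0

/-- The walled first Koszul complex. -/
def walledFirstKoszulObj (M : LMod k (KUWB k ε)ᵒᵖ) :
    HomologicalComplex (LMod k (KUWB k (-ε))) (ComplexShape.down' 2) where
  X N := LMod.dsum fun p : Bideg N => walTerm k ε M p.1
  d i j := LMod.dsumDesc fun p : Bideg i => walComp k ε M j p.1
  shape i j h := by
    refine LMod.dsum_hom_ext fun p => ?_
    rw [LMod.dsumIncl_desc, Limits.comp_zero]
    obtain ⟨⟨_ | m, _ | n⟩, hp⟩ := p
    · rfl
    · rfl
    · rfl
    · refine dif_neg fun h' => h ?_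
      change j + 2 = i
      omega
  d_comp_d' i j l h h' := by
    obtain rfl : j + 2 = i := h
    obtain rfl : l + 2 = j := h'
    refine LMod.dsum_hom_ext fun p => ?_
    rw [← Category.assoc, LMod.dsumIncl_desc, Limits.comp_zero]
    obtain ⟨⟨_ | m, _ | n⟩, hp⟩ := p
    · exact Limits.zero_comp
    · exact Limits.zero_comp
    · exact Limits.zero_comp
    · have h1 : m + n = l + 2 := by omega
      rw [walComp, dif_pos h1, Category.assoc, LMod.dsumIncl_desc]
      rcases m with _ | m
      · exact Limits.comp_zero
      rcases n with _ | n
      · exact Limits.comp_zero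
      have h2 : m + n = l := by omega
      have h3 : walComp k ε M l (m + 1, n + 1) = walDiff k ε M (m, n) ≫
          LMod.dsumIncl (fun q : Bideg l => walTerm k ε M q.1) ⟨(m, n), h2⟩ := dif_pos h2
      refine (congrArg (fun t => walDiff k ε M (m + 1, n + 1) ≫ t) h3).trans ?_
      refine (Category.assoc _ _ _).symm.trans ?_
      exact (congrArg (fun t => t ≫ LMod.dsumIncl (fun q : Bideg l => walTerm k ε M q.1)
        ⟨(m, n), h2⟩) (walDiff_comp k ε M (m, n))).trans Limits.zero_comp

/-- The morphism of direct sums induced by a morphism of modules. -/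
def walMap {M N : LMod k (KUWB k ε)ᵒᵖ} (φ : M ⟶ N) (j : ℕ) :
    (LMod.dsum fun p : Bideg j => walTerm k ε M p.1) ⟶
      LMod.dsum fun p : Bideg j => walTerm k ε N p.1 :=
  LMod.dsumDesc fun p : Bideg j =>
    termMap (walSym p.1) φ ≫ LMod.dsumIncl (fun q : Bideg j => walTerm k ε N q.1) p

theorem walComp_nat {M N : LMod k (KUWB k ε)ᵒᵖ} (φ : M ⟶ N) (j : ℕ) (p : ℕ × ℕ) :
    walComp k ε M j p ≫ walMap k ε φ j = termMap (walSym p) φ ≫ walComp k ε N j p := by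
  obtain ⟨_ | m, _ | n⟩ := p
  · exact Limits.zero_comp.trans Limits.comp_zero.symm
  · exact Limits.zero_comp.trans Limits.comp_zero.symm
  · exact Limits.zero_comp.trans Limits.comp_zero.symm
  · by_cases h : m + n = j
    · rw [walComp, walComp, dif_pos h, dif_pos h, Category.assoc, walMap, LMod.dsumIncl_desc,
        ← Category.assoc, ← Category.assoc]
      exact congrArg (fun t => t ≫ LMod.dsumIncl (fun q : Bideg j => walTerm k ε N q.1)
        ⟨(m, n), h⟩) (kDiff_nat _ _ _ φ)
    · rw [walComp, walComp, dif_neg h, dif_neg h, Limits.zero_comp]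
      exact Limits.comp_zero.symm

/-- The walled first Koszul complex, as a functor. -/
def walledFirstKoszul : LMod k (KUWB k ε)ᵒᵖ ⥤
    HomologicalComplex (LMod k (KUWB k (-ε))) (ComplexShape.down' 2) where
  obj M := walledFirstKoszulObj k ε M
  map φ :=
    { f := fun N => walMap k ε φ N
      comm' := fun i j _ => LMod.dsum_hom_ext fun p => by
        dsimp only [walledFirstKoszulObj]
        rw [← Category.assoc, ← Category.assoc, LMod.dsumIncl_desc, walMap, LMod.dsumIncl_desc,
          Category.assoc, LMod.dsumIncl_desc, walComp_nat] }
  map_id M := by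
    ext N : 1
    refine LMod.dsum_hom_ext fun p => ?_
    refine (LMod.dsumIncl_desc _ p).trans ?_
    rw [termMap_id, Category.id_comp]
    exact (Category.comp_id _).symm
  map_comp φ ψ := by
    ext N : 1
    refine LMod.dsum_hom_ext fun p => ?_
    refine (LMod.dsumIncl_desc _ p).trans ?_
    refine Eq.symm ((Category.assoc _ _ _).symm.trans ?_)
    refine (congrArg (fun t => t ≫ walMap k ε ψ N) (LMod.dsumIncl_desc _ p)).trans ?_
    refine (Category.assoc _ _ _).trans ?_
    refine (congrArg (fun t => termMap (walSym p.1) φ ≫ t) (LMod.dsumIncl_desc _ p)).trans ?_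
    rw [termMap_comp, Category.assoc]

end Complexes

end WalledBrauer

end

/-! Since `scrL` is left adjoint to restriction along `ups`, applying it to the term of degree `N`
of the walled complex gives the unique module that receives a universal arrow from that term. It
therefore suffices to construct, for every `N`, an arrow `theta` from the walled term to the
restriction of the term of the first Koszul complex of `dJ F`, to show that it is universal, and to
show that it commutes with the differentials and with morphisms in `F`
(`nonempty_iso_of_universal`).

The functor `dJ` is first replaced by a concrete model `dJCoind`: an element over `A` is a natural
family of maps from directed diagrams `X ⊔ Y → A` to `F(X, Y)`, and an undirected diagram acts
through composition with its transfer. The second ingredient is a linear retraction `retr` of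
directed onto walled diagrams. Label the points of `X ⊔ Y` by their side; a directed diagram is the
image of a (unique) walled one exactly when it preserves the labels and all its pairs go from left
to right, and `retr` kills all other diagrams. It commutes with composition by walled diagrams,
hence defines a map `iota` from `F(X, Y)` to `dJ F (X ⊔ Y)`. Two facts about the transfer govern
`iota`. For a walled diagram exactly one choice of directions in the transfer survives `retr`, so
`iota` intertwines walled diagrams (`iota_act`). For a diagram with a pair inside one side no choice
survives, so such a diagram annihilates the image of `iota` (`act_iota_eq_zero`).

A splitting is a bijection of `Fin m ⊔ Fin n` with `Fin N`. The arrow `theta` sends `g ⊗ x` to the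
class of `s g ⊗ s (iota x)`, where `s` is the inverse of a splitting; the choice of splitting does
not matter because the tensor product is balanced over `S_N`. Universality rests on the identity
`sum_act_splitInv_iota`: every element of `dJ F (N)` is the average over all splittings of its
components, transported by `iota`. Evaluated at a diagram `f`, only the splittings with the
labelling of `Fin N` determined by `f` contribute; there are `m! n!` of them and each contributes
the value at `f`. Characteristic zero allows the division by `m! n!`. The identity shows that the
image of `theta` generates the target, hence uniqueness of extensions; the analogous average of
prescribed values on components gives existence (`avgVal_iota`).

For the differential, the sum over pairs `i < j` of `Fin N` is cut along the standard splitting.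
Pairs inside one block contribute zero by the annihilation property. In a mixed pair the smaller
element lies in the left block, so the pair is already directed as a walled pair, and the remaining
sum is the walled differential without any sign. -/

noncomputable section

namespace WalledBrauer

/-! ### Detecting the left adjoint of a complex by universal arrows -/

section UniversalArrows

variable {𝓕 : Type*} [Category 𝓕] {𝓐 : Type*} [Category 𝓐] [Preadditive 𝓐]
  {𝓑 : Type*} [Category 𝓑] [Preadditive 𝓑] {L : 𝓐 ⥤ 𝓑} {R : 𝓑 ⥤ 𝓐}

/-- The isomorphism between the value of a left adjoint and the target of a universal arrow. -/
def isoOfUniversal (adj : L ⊣ R) {X : 𝓐} {Y : 𝓑} (θ : X ⟶ R.obj Y)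
    (hθ : ∀ Z : 𝓑, Function.Bijective fun φ : Y ⟶ Z => θ ≫ R.map φ) : L.obj X ≅ Y where
  hom := (adj.homEquiv X Y).symm θ
  -- The surjectivity half of universality, at `L.obj X`, factors the unit through `θ`; this factor
  -- is the inverse. The injectivity half, at `Y`, gives the second identity.
  inv := ((hθ (L.obj X)).2 (adj.unit.app X)).choose
  hom_inv_id := by
    apply (adj.homEquiv X _).injective
    rw [adj.homEquiv_naturality_right, Equiv.apply_symm_apply, adj.homEquiv_id]
    exact ((hθ (L.obj X)).2 (adj.unit.app X)).choose_spec
  inv_hom_id := by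
    apply (hθ Y).1
    have h := ((hθ (L.obj X)).2 (adj.unit.app X)).choose_spec
    change θ ≫ R.map (_ ≫ _) = θ ≫ R.map (𝟙 Y)
    change θ ≫ R.map _ = adj.unit.app X at h
    rw [R.map_comp, ← Category.assoc, h, R.map_id, Category.comp_id, ← adj.homEquiv_unit,
      Equiv.apply_symm_apply]

/-- The adjunction bijection is natural in both arguments, so commuting squares may be transposed.
One statement serves both the differentials and the naturality in the parameter. -/
theorem homEquiv_symm_square (adj : L ⊣ R) {X X' : 𝓐} {Y Y' : 𝓑} {θ : X ⟶ R.obj Y}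
    {θ' : X' ⟶ R.obj Y'} {f : X ⟶ X'} {g : Y ⟶ Y'} (h : θ ≫ R.map g = f ≫ θ') :
    (adj.homEquiv X Y).symm θ ≫ g = L.map f ≫ (adj.homEquiv X' Y').symm θ' := by
  rw [← adj.homEquiv_naturality_right_symm, h, adj.homEquiv_naturality_left_symm]

/-- A natural family of universal arrows that commutes with the differentials identifies the
complexes of values of a left adjoint. -/
theorem nonempty_iso_of_universal (adj : L ⊣ R) [L.Additive] {ι : Type*} (c : ComplexShape ι)
    (K : 𝓕 ⥤ HomologicalComplex 𝓐 c) (K' : 𝓕 ⥤ HomologicalComplex 𝓑 c)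
    (θ : ∀ (F : 𝓕) (i : ι), (K.obj F).X i ⟶ R.obj ((K'.obj F).X i))
    (hθ : ∀ (F : 𝓕) (i : ι) (Z : 𝓑), Function.Bijective fun φ : (K'.obj F).X i ⟶ Z =>
      θ F i ≫ R.map φ)
    (hd : ∀ (F : 𝓕) (i j : ι), c.Rel i j →
      θ F i ≫ R.map ((K'.obj F).d i j) = (K.obj F).d i j ≫ θ F j)
    (hn : ∀ {F F' : 𝓕} (φ : F ⟶ F') (i : ι),
      θ F i ≫ R.map ((K'.map φ).f i) = (K.map φ).f i ≫ θ F' i) :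
    Nonempty (K' ≅ K ⋙ L.mapHomologicalComplex c) := by
  -- The isomorphism is built from the left adjoint to `K'`, because in this direction its
  -- components are the transposes of `θ`; hence the final `Iso.symm`.
  refine ⟨Iso.symm (NatIso.ofComponents (fun F => HomologicalComplex.Hom.isoOfComponents
    (fun i => isoOfUniversal adj (θ F i) (hθ F i)) (fun i j hij => ?_)) (fun {F F'} φ => ?_))⟩
  · exact homEquiv_symm_square adj (hd F i j hij)
  · ext i
    exact (homEquiv_symm_square adj (hn φ i)).symm

end UniversalArrows

/-! ### The coinduction functor -/

namespace LMod

section Coind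

variable {k : Type u} [Field k] {A : Type w} [Category.{u} A] [Preadditive A] [Linear k A]
  {B : Type w} [Category.{u} B] [Preadditive B] [Linear k B] (Φ : A ⥤ B) [Φ.Additive] [Φ.Linear k]
  {I : Type} (s : I → A)

/-- Functoriality of the coinduced module. -/
def coindMap {M M' : LMod k A} (φ : M ⟶ M') : coind Φ s M ⟶ coind Φ s M' :=
  mkHom (fun b =>
    { toFun := fun ξ : coindSub Φ s M b => (⟨fun i => homAt φ (s i) ∘ₗ ξ.1 i, fun i j t f => by
        change M'.act t (homAt φ (s i) (ξ.1 i f)) = homAt φ (s j) (ξ.1 j (f ≫ Φ.map t))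
        rw [← ξ.2 i j t f, homAt_act]⟩ : coindSub Φ s M' b)
      map_add' := fun ξ ξ' => Subtype.ext (funext fun i => LinearMap.comp_add _ _ _)
      map_smul' := fun c ξ => Subtype.ext (funext fun i => LinearMap.comp_smul _ _ _) })
    (fun _ _ => rfl)

/-- The coinduction functor. -/
def coindFunctor : LMod k A ⥤ LMod k B where
  obj M := coind Φ s M
  map φ := coindMap Φ s φ
  map_id _ := hom_ext fun _ _ => rfl
  map_comp _ _ := hom_ext fun _ _ => rfl

/-- Coinduction is right adjoint to restriction. -/
def coindAdj (i₀ : A → I) (u₀ : ∀ a, s (i₀ a) ≅ a) :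
    restr (k := k) Φ ⊣ coindFunctor Φ s :=
  Adjunction.mkOfHomEquiv
    { homEquiv := fun N M => coindEquiv Φ s i₀ u₀ N M
      homEquiv_naturality_left_symm := fun {N' N M} f g => by
        -- After the bijection is applied to both sides, evaluation at a point reduces the claim to
        -- the compatibility of `f` with the action of `h`.
        refine (Equiv.symm_apply_eq (coindEquiv Φ s i₀ u₀ N' M)).2 ?_
        refine coind_hom_ext Φ s fun b x i h => ?_
        have e := (coindEquiv Φ s i₀ u₀ N M).apply_symm_apply g
        have e' : coindAt Φ s (f ≫ g) b x i h = coindAt Φ s g b (homAt f b x) i h := rfl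
        refine e'.trans ((congrArg (fun g' => coindAt Φ s g' b (homAt f b x) i h) e.symm).trans ?_)
        exact congrArg (outAt Φ ((coindEquiv Φ s i₀ u₀ N M).symm g) (s i)) (homAt_act f h x).symm
      homEquiv_naturality_right := fun f g => coind_hom_ext Φ s fun b x i h => rfl }

end Coind

end LMod

/-! ### Bijections compatible with the decomposition of a sum -/

/-- The inverse of a side-preserving bijection also preserves sides, so the restrictions to the
summands are mutually inverse. This is the tool for recognizing walled diagrams among directed ones
and for comparing two splittings with the same labelling. -/
theorem exists_eq_sumCongr {A B U V : Type} (g : A ⊕ B ≃ U ⊕ V)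
    (h : ∀ x, (g x).isLeft = x.isLeft) :
    ∃ (e₁ : A ≃ U) (e₂ : B ≃ V), g = Equiv.sumCongr e₁ e₂ := by
  have h' : ∀ y, (g.symm y).isLeft = y.isLeft := fun y => by
    rw [← h, Equiv.apply_symm_apply]
  have h1 : ∀ a, ∃ u, g (Sum.inl a) = Sum.inl u := fun a => Sum.isLeft_iff.1 (h (Sum.inl a))
  have h2 : ∀ b, ∃ v, g (Sum.inr b) = Sum.inr v := fun b =>
    Sum.isRight_iff.1 (by rw [← Sum.not_isLeft, h]; simp)
  have h3 : ∀ u, ∃ a, g.symm (Sum.inl u) = Sum.inl a := fun u =>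
    Sum.isLeft_iff.1 (h' (Sum.inl u))
  have h4 : ∀ v, ∃ b, g.symm (Sum.inr v) = Sum.inr b := fun v =>
    Sum.isRight_iff.1 (by rw [← Sum.not_isLeft, h']; simp)
  choose p hp using h1
  choose q hq using h2
  choose p' hp' using h3
  choose q' hq' using h4
  refine ⟨⟨p, p', fun a => ?_, fun u => ?_⟩, ⟨q, q', fun b => ?_, fun v => ?_⟩, ?_⟩
  · apply Sum.inl_injective (β := B); rw [← hp', ← hp, Equiv.symm_apply_apply]
  · apply Sum.inl_injective (β := V); rw [← hp, ← hp', Equiv.apply_symm_apply]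
  · apply Sum.inr_injective (α := A); rw [← hq', ← hq, Equiv.symm_apply_apply]
  · apply Sum.inr_injective (α := U); rw [← hq, ← hq', Equiv.apply_symm_apply]
  · ext x
    rcases x with a | b
    · exact hp a
    · exact hq b

/-! ### Splittings of a standard set and the labellings they induce -/

instance (N : ℕ) : Fintype (Bideg N) :=
  Fintype.subtype (Finset.HasAntidiagonal.antidiagonal N) fun _ => Finset.HasAntidiagonal.mem_antidiagonal

/-- The identifications of `Fin N` with a disjoint union of two standard finite sets. -/
abbrev Splitting (N : ℕ) : Type := Σ p : Bideg N, Fin p.1.1 ⊕ Fin p.1.2 ≃ Fin N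

/-- The splittings with the same labelling as `e₀` form a torsor under `S_m × S_n`: each of them is
`e₀` preceded by a unique pair of permutations. The decidability instance is arbitrary so that the
count applies to any such filter. -/
theorem card_labelled {p : ℕ × ℕ} {S : Type} [Fintype S] [DecidableEq S]
    (e₀ : Fin p.1 ⊕ Fin p.2 ≃ S)
    [DecidablePred fun e : Fin p.1 ⊕ Fin p.2 ≃ S =>
      ∀ n, (e.symm n).isLeft = (e₀.symm n).isLeft] :
    (Finset.univ.filter fun e : Fin p.1 ⊕ Fin p.2 ≃ S =>
      ∀ n, (e.symm n).isLeft = (e₀.symm n).isLeft).card = p.1.factorial * p.2.factorial := by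
  have h : (Finset.univ.filter fun e : Fin p.1 ⊕ Fin p.2 ≃ S =>
      ∀ n, (e.symm n).isLeft = (e₀.symm n).isLeft) =
      Finset.univ.image fun σ : Equiv.Perm (Fin p.1) × Equiv.Perm (Fin p.2) =>
        (Equiv.sumCongr σ.1 σ.2).trans e₀ := by
    ext e
    simp only [Finset.mem_filter, Finset.mem_univ, true_and, Finset.mem_image, Prod.exists]
    constructor
    · intro he
      obtain ⟨σ, τ, hστ⟩ := exists_eq_sumCongr (e.trans e₀.symm) fun x => by
        have := he (e x)
        rw [Equiv.symm_apply_apply] at this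
        exact this.symm
      refine ⟨σ, τ, ?_⟩
      rw [← hστ]
      ext x
      simp
    · rintro ⟨σ, τ, rfl⟩ n
      rw [Equiv.symm_trans_apply]
      rcases e₀.symm n with x | x <;> rfl
  rw [h, Finset.card_image_of_injective, Finset.card_univ, Fintype.card_prod, Fintype.card_perm,
    Fintype.card_perm, Fintype.card_fin, Fintype.card_fin]
  rintro ⟨σ, τ⟩ ⟨σ', τ'⟩ hh
  have h1 : ∀ x, Sum.map σ τ x = Sum.map σ' τ' x := fun x =>
    e₀.injective (Equiv.congr_fun hh x)
  refine Prod.ext (Equiv.ext fun a => ?_) (Equiv.ext fun b => ?_)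
  · exact Sum.inl_injective (h1 (Sum.inl a))
  · exact Sum.inr_injective (h1 (Sum.inr b))

/-- Enumerating the two fibres of the labelling gives a splitting; it serves as the reference point
for the count. -/
theorem exists_labelled {N : ℕ} (l : Fin N → Bool) :
    ∃ s : Splitting N, ∀ n, (s.2.symm n).isLeft = l n := by
  obtain ⟨a, ⟨e₁⟩⟩ := Finite.exists_equiv_fin {n // l n = true}
  obtain ⟨b, ⟨e₂⟩⟩ := Finite.exists_equiv_fin {n // ¬ l n = true}
  let e : Fin a ⊕ Fin b ≃ Fin N :=
    (Equiv.sumCongr e₁.symm e₂.symm).trans (Equiv.sumCompl fun n => l n = true)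
  have h : a + b = N := by
    have := Fintype.card_congr e
    rwa [Fintype.card_sum, Fintype.card_fin, Fintype.card_fin, Fintype.card_fin] at this
  refine ⟨⟨⟨(a, b), h⟩, e⟩, fun n => ?_⟩
  obtain ⟨x, rfl⟩ := e.surjective n
  refine (congrArg Sum.isLeft (e.symm_apply_apply x)).trans ?_
  rcases x with x | x
  · exact (e₁.symm x).2.symm
  · exact (Bool.eq_false_iff.2 (e₂.symm x).2).symm

/-- The bidegree is the pair of sizes of the two fibres of the labelling. Consequently a fixed
labelling selects a single bidegree in sums over all splittings. -/
theorem bideg_eq_of_label {N : ℕ} {s s' : Splitting N}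
    (h : ∀ n, (s.2.symm n).isLeft = (s'.2.symm n).isLeft) : s.1 = s'.1 := by
  obtain ⟨e, e', -⟩ := exists_eq_sumCongr (s.2.trans s'.2.symm) fun x => by
    have := h (s.2 x)
    rw [Equiv.symm_apply_apply] at this
    exact this.symm
  have h1 := Fintype.card_congr e
  have h2 := Fintype.card_congr e'
  rw [Fintype.card_fin, Fintype.card_fin] at h1 h2
  exact Subtype.ext (Prod.ext h1 h2)

/-- The weight of a splitting. -/
def splitWt (k : Type u) [Field k] (p : ℕ × ℕ) : k := ((p.1.factorial * p.2.factorial : ℕ) : k)⁻¹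

/-- The splittings inducing a given labelling have total weight one. -/
theorem sum_splitting (k : Type u) [Field k] [CharZero k] {N : ℕ} (l : Fin N → Bool)
    {V : Type*} [AddCommGroup V] [Module k V] (v : V) (f : Splitting N → V)
    (h : ∀ s : Splitting N, (∀ n, (s.2.symm n).isLeft = l n) → f s = v)
    (h' : ∀ s : Splitting N, (¬ ∀ n, (s.2.symm n).isLeft = l n) → f s = 0) :
    ∑ p : Bideg N, splitWt k p.1 • ∑ e : Fin p.1.1 ⊕ Fin p.1.2 ≃ Fin N, f ⟨p, e⟩ = v := by
  obtain ⟨s₀, hs₀⟩ := exists_labelled l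
  -- Only the bidegree of the labelling survives; there the factorial count cancels the weight,
  -- which is where characteristic zero enters.
  rw [Finset.sum_eq_single s₀.1]
  · have h1 : ∀ e : Fin s₀.1.1.1 ⊕ Fin s₀.1.1.2 ≃ Fin N, f ⟨s₀.1, e⟩ =
        if (∀ n, (e.symm n).isLeft = (s₀.2.symm n).isLeft) then v else 0 := fun e => by
      simp only [hs₀]
      split_ifs with he
      · exact h ⟨s₀.1, e⟩ he
      · exact h' ⟨s₀.1, e⟩ he
    simp only [h1]
    rw [← Finset.sum_filter, Finset.sum_const, card_labelled, ← Nat.cast_smul_eq_nsmul k,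
      smul_smul, splitWt, inv_mul_cancel₀, one_smul]
    exact Nat.cast_ne_zero.2 (mul_ne_zero (Nat.factorial_ne_zero _) (Nat.factorial_ne_zero _))
  · intro p _ hp
    rw [Finset.sum_eq_zero, smul_zero]
    intro e _
    refine h' ⟨p, e⟩ fun he => hp ?_
    exact bideg_eq_of_label (s := ⟨p, e⟩) (s' := s₀) fun n => (he n).trans (hs₀ n).symm
  · intro hp
    exact absurd (Finset.mem_univ _) hp

/-! ### Directed diagrams compatible with labellings -/

/-- The extension of a labelling of `A` that gives the two entries of each pair the labels `true`
and `false`. -/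
def pairLabel {A : Type} (l : A → Bool) (t : ℕ) : A ⊕ (Fin 2 × Fin t) → Bool :=
  Sum.elim l fun x => decide (x.1 = 0)

/-- A diagram is compatible with labellings of its source and target if it preserves the labels of
the points of the source, and all its pairs go from `true` to `false`. -/
def Compat {A B : Type} (l : A → Bool) (l' : B → Bool) (f : DirHom A B) : Prop :=
  ∀ z, l' (f.e z) = pairLabel l f.deg z

/-- Every point of the middle set is the image under `f` of a source point or of an entry of a pair,
so its label is dictated by `f`. The conditions on `g` are thus among those on the composite. In
particular a diagram that is not walled cannot become walled after precomposition with a walled one.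
-/
theorem compat_comp_iff_right {A B C : Type} {l : A → Bool} {l' : B → Bool} {l'' : C → Bool}
    {f : DirHom A B} (hf : Compat l l' f) (g : DirHom B C) :
    Compat l l'' (f.comp g) ↔ Compat l' l'' g := by
  constructor
  · rintro h (b | ⟨c, j⟩)
    · obtain ⟨z, rfl⟩ := f.e.surjective b
      refine Eq.trans ?_ (hf z).symm
      rcases z with a | ⟨c, j⟩
      · exact h (Sum.inl a)
      · exact (congrArg l'' (DirHom.glue_castAdd f.e g.e c j).symm).trans
          (h (Sum.inr (c, Fin.castAdd g.deg j)))
    · exact (congrArg l'' (DirHom.glue_natAdd f.e g.e c j).symm).trans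
        (h (Sum.inr (c, Fin.natAdd f.deg j)))
  · rintro h (a | ⟨c, j⟩)
    · exact (h (Sum.inl (f.e (Sum.inl a)))).trans (hf (Sum.inl a))
    · refine Fin.addCases (fun j => ?_) (fun j => ?_) j
      · exact (congrArg l'' (DirHom.glue_castAdd f.e g.e c j)).trans
          ((h (Sum.inl (f.e (Sum.inr (c, j))))).trans (hf (Sum.inr (c, j))))
      · exact (congrArg l'' (DirHom.glue_natAdd f.e g.e c j)).trans (h (Sum.inr (c, j)))

/-- The points and pairs of `f` reappear in the composite with their positions transported by `g`,
and `g` preserves labels. -/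
theorem compat_comp_iff_left {A B C : Type} {l : A → Bool} {l' : B → Bool} {l'' : C → Bool}
    (f : DirHom A B) {g : DirHom B C} (hg : Compat l' l'' g) :
    Compat l l'' (f.comp g) ↔ Compat l l' f := by
  constructor
  · rintro h (a | ⟨c, j⟩)
    · exact (hg (Sum.inl (f.e (Sum.inl a)))).symm.trans (h (Sum.inl a))
    · exact (hg (Sum.inl (f.e (Sum.inr (c, j))))).symm.trans
        ((congrArg l'' (DirHom.glue_castAdd f.e g.e c j).symm).trans
          (h (Sum.inr (c, Fin.castAdd g.deg j))))
  · exact fun h => (compat_comp_iff_right h g).2 hg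

/-- The last pair of a composite comes from the second diagram. -/
theorem Compat.comp_pair {A B C : Type} {l : A → Bool} {l'' : C → Bool} {f : DirHom A B}
    {g : DirHom B C} (h : Compat l l'' (f.comp g)) (c : Fin 2) (j : Fin g.deg) :
    l'' (g.e (Sum.inr (c, j))) = decide (c = 0) :=
  (congrArg l'' (DirHom.glue_natAdd f.e g.e c j).symm).trans
    (h (Sum.inr (c, Fin.natAdd f.deg j)))

theorem compat_ofEquiv {A B : Type} {l : A → Bool} {l' : B → Bool} {e : A ≃ B} :
    Compat l l' (DirHom.ofEquiv e) ↔ ∀ a, l' (e a) = l a :=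
  ⟨fun h a => h (Sum.inl a), fun h z => by
    rcases z with a | ⟨_, j⟩
    · exact h a
    · exact j.elim0⟩

theorem compat_wr {A B : Type} {l : A → Bool} {l' : B → Bool} {f : DirHom A B}
    (σ : Equiv.Perm (Fin f.deg)) :
    Compat l l' (f.wr (fun _ => 1) σ) ↔ Compat l l' f := by
  refine ⟨fun h => ?_, fun h => ?_⟩
  · rintro (a | ⟨c, j⟩)
    · exact h (Sum.inl a)
    · obtain ⟨j, rfl⟩ := σ.surjective j
      exact h (Sum.inr (c, j))
  · rintro (a | ⟨c, j⟩)
    · exact h (Sum.inl a)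
    · exact h (Sum.inr (c, σ j))

theorem compat_unwHom {X Y U V : Type} (w : WalHom X Y U V) :
    Compat Sum.isLeft Sum.isLeft (unwHom w) := by
  rintro ((x | y) | ⟨c, j⟩)
  · rfl
  · rfl
  · fin_cases c <;> rfl

/-- Compatibility says exactly that, once the source is regrouped by label, the underlying bijection
preserves sides; it then splits into the two bijections of a walled diagram. -/
theorem exists_unwHom {X Y U V : Type} {f : DirHom (X ⊕ Y) (U ⊕ V)}
    (h : Compat Sum.isLeft Sum.isLeft f) : ∃ w : WalHom X Y U V, unwHom w = f := by
  obtain ⟨d, e⟩ := f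
  -- This is the regrouping used in the definition of `unwHom`, so the recovered diagram agrees with
  -- `f` by unfolding.
  let E : (X ⊕ Y) ⊕ (Fin 2 × Fin d) ≃ (X ⊕ Fin d) ⊕ (Y ⊕ Fin d) :=
    (Equiv.sumCongr (Equiv.refl (X ⊕ Y))
      ((Equiv.prodCongr finTwoEquiv (Equiv.refl _)).trans (Equiv.boolProdEquivSum _))).trans
      (Equiv.sumSumSumComm X Y (Fin d) (Fin d))
  have hE : ∀ z, (E z).isLeft = pairLabel Sum.isLeft d z := by
    rintro ((x | y) | ⟨c, j⟩)
    · rfl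
    · rfl
    · fin_cases c <;> rfl
  obtain ⟨e₁, e₂, he⟩ := exists_eq_sumCongr (E.symm.trans e) fun z => by
    have h1 := h (E.symm z)
    have h2 := hE (E.symm z)
    rw [Equiv.apply_symm_apply] at h2
    exact h1.trans h2.symm
  refine ⟨⟨d, e₁, e₂⟩, ?_⟩
  have h3 : E.trans (Equiv.sumCongr e₁ e₂) = e := by
    rw [← he, ← Equiv.trans_assoc, Equiv.self_trans_symm, Equiv.refl_trans]
  exact congrArg (DirHom.mk d) h3

/-- Both halves of a walled diagram can be read off from its unwalling. Hence the choice made in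
`walPart` is harmless. -/
theorem unwHom_injective {X Y U V : Type} {w w' : WalHom X Y U V} (h : unwHom w = unwHom w') :
    w = w' := by
  obtain ⟨d, e₁, e₂⟩ := w
  obtain ⟨d', e₁', e₂'⟩ := w'
  obtain rfl : d = d' := congrArg DirHom.deg h
  have h' : ∀ z, (unwHom ⟨d, e₁, e₂⟩).e z = (unwHom ⟨d, e₁', e₂'⟩).e z := fun z => by
    injection h with _ h
    exact Equiv.congr_fun h z
  exact WalHom.ext' rfl (fun x => Sum.inl_injective (h' (Sum.inl (Sum.inl x))))
    (fun j => Sum.inl_injective (h' (Sum.inr (0, j))))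
    (fun y => Sum.inr_injective (h' (Sum.inl (Sum.inr y))))
    (fun j => Sum.inr_injective (h' (Sum.inr (1, j))))

theorem unwHom_perm {X Y U V : Type} (w : WalHom X Y U V) (σ : Equiv.Perm (Fin w.deg)) :
    unwHom (w.perm σ) = (unwHom w).wr (fun _ => 1) σ := by
  refine DirHom.ext' rfl (fun a => ?_) (fun c j => ?_)
  · rcases a with a | a <;> rfl
  · fin_cases c <;> rfl

/-! ### The retraction of directed diagrams onto walled diagrams -/

section Retraction

variable (k : Type u) [Field k] (ε : ℤˣ)

open Classical in
/-- The walled diagram underlying a directed diagram, or zero if there is none. -/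
def walPart {P Q : WalOrd} (f : unW.obj P ⟶ unW.obj Q) : TwHom k (walRel ε) P Q :=
  if h : ∃ w : P ⟶ Q, unW.map w = f then cls k (walRel ε) h.choose else 0

theorem walPart_unW {P Q : WalOrd} (w : P ⟶ Q) :
    walPart k ε (unW.map w) = cls k (walRel ε) w := by
  have h : ∃ w' : P ⟶ Q, unW.map w' = unW.map w := ⟨w, rfl⟩
  rw [walPart, dif_pos h]
  exact congrArg (cls k (walRel ε)) (unwHom_injective h.choose_spec)

theorem walPart_of_not {P Q : WalOrd} (f : unW.obj P ⟶ unW.obj Q)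
    (h : ¬ Compat Sum.isLeft Sum.isLeft (f : DirHom (P.fst ⊕ P.snd) (Q.fst ⊕ Q.snd))) :
    walPart k ε f = 0 :=
  dif_neg (by rintro ⟨w, rfl⟩; exact h (compat_unwHom w))

/-- Permuting the pairs without reversing them does not affect compatibility, and it carries the
same sign in the walled and the directed category. This lets the retraction descend to the twisted
linearizations. -/
theorem walPart_rel {P Q : WalOrd} (f g : unW.obj P ⟶ unW.obj Q) (s : ℤˣ)
    (h : (dirRel ε).rel f g s) : walPart k ε g = sgn k s • walPart k ε f := by
  obtain ⟨σ, rfl, rfl⟩ := h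
  by_cases hf : Compat Sum.isLeft Sum.isLeft (f : DirHom (P.fst ⊕ P.snd) (Q.fst ⊕ Q.snd))
  · obtain ⟨w, rfl⟩ := exists_unwHom hf
    refine (congrArg (walPart k ε) (unwHom_perm w σ).symm).trans ?_
    refine (walPart_unW k ε (w.perm σ : P ⟶ Q)).trans ?_
    refine Eq.trans ?_ (congrArg (_ • ·) (walPart_unW k ε (w : P ⟶ Q)).symm)
    exact cls_rel ⟨σ, rfl, rfl⟩
  · rw [walPart_of_not k ε f hf, smul_zero]
    exact walPart_of_not k ε _ fun h => hf ((compat_wr σ).1 h)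

/-- The linear retraction of the functor `Ups` on morphisms. -/
def retr (P Q : WalOrd) : ((⟨unW.obj P⟩ : KDUB k ε) ⟶ ⟨unW.obj Q⟩) →ₗ[k]
    ((⟨P⟩ : KUWB k ε) ⟶ ⟨Q⟩) :=
  twLift (k := k) (R := dirRel ε) (X := unW.obj P) (Y := unW.obj Q) (walPart k ε)
    (walPart_rel k ε)

theorem retr_gen {P Q : WalOrd} (f : unW.obj P ⟶ unW.obj Q) :
    retr k ε P Q (gen k (dirRel ε) f) = walPart k ε f :=
  twLift_cls _ _ f

/-- The functor `Ups` on morphisms, as a linear map. -/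
def upsHom (P Q : WalOrd) : ((⟨P⟩ : KUWB k ε) ⟶ ⟨Q⟩) →ₗ[k]
    ((⟨unW.obj P⟩ : KDUB k ε) ⟶ ⟨unW.obj Q⟩) :=
  liftHom (mapData k unW (unW_rel ε)) ⟨P⟩ ⟨Q⟩

theorem upsHom_gen {P Q : WalOrd} (w : P ⟶ Q) :
    upsHom k ε P Q (gen k (walRel ε) w) = gen k (dirRel ε) (unW.map w) :=
  Tw.lift_gen _ w

/-- By `compat_comp_iff_right` a composite with a walled diagram is walled only if the other factor
is, so killing the other diagrams is compatible with composition. -/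
theorem walPart_comp_left {P P' Q : WalOrd} (w : P ⟶ P') (f : unW.obj P' ⟶ unW.obj Q) :
    walPart k ε (unW.map w ≫ f) =
      twComp P P' Q (walPart k ε f) (cls k (walRel ε) w) := by
  have key := compat_comp_iff_right (l'' := Sum.isLeft) (compat_unwHom w)
    (f : DirHom (P'.fst ⊕ P'.snd) (Q.fst ⊕ Q.snd))
  by_cases hf : Compat Sum.isLeft Sum.isLeft (f : DirHom (P'.fst ⊕ P'.snd) (Q.fst ⊕ Q.snd))
  · obtain ⟨v, rfl⟩ := exists_unwHom hf
    refine (congrArg (walPart k ε) (unW.map_comp w (v : P' ⟶ Q)).symm).trans ?_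
    refine (walPart_unW k ε (w ≫ (v : P' ⟶ Q))).trans ?_
    refine Eq.trans ?_ (congrArg (fun t => twComp P P' Q t _) (walPart_unW k ε (v : P' ⟶ Q)).symm)
    exact (twComp_cls w (v : P' ⟶ Q)).symm
  · rw [walPart_of_not k ε f hf, map_zero, LinearMap.zero_apply]
    exact walPart_of_not k ε _ fun h => hf (key.1 h)

theorem walPart_comp_right {P Q Q' : WalOrd} (f : unW.obj P ⟶ unW.obj Q) (w : Q ⟶ Q') :
    walPart k ε (f ≫ unW.map w) =
      twComp P Q Q' (cls k (walRel ε) w) (walPart k ε f) := by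
  have key := compat_comp_iff_left (l := Sum.isLeft)
    (f : DirHom (P.fst ⊕ P.snd) (Q.fst ⊕ Q.snd)) (compat_unwHom w)
  by_cases hf : Compat Sum.isLeft Sum.isLeft (f : DirHom (P.fst ⊕ P.snd) (Q.fst ⊕ Q.snd))
  · obtain ⟨v, rfl⟩ := exists_unwHom hf
    refine (congrArg (walPart k ε) (unW.map_comp (v : P ⟶ Q) w).symm).trans ?_
    refine (walPart_unW k ε ((v : P ⟶ Q) ≫ w)).trans ?_
    refine Eq.trans ?_ (congrArg (twComp P Q Q' (cls k (walRel ε) w)) (walPart_unW k ε (v : P ⟶ Q)).symm)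
    exact (twComp_cls (k := k) (R := walRel ε) (v : P ⟶ Q) w).symm
  · rw [walPart_of_not k ε f hf, map_zero]
    exact walPart_of_not k ε _ fun h => hf (key.1 h)

theorem retr_gen_comp_left {P P' Q : WalOrd} (w : P ⟶ P') (f : unW.obj P' ⟶ unW.obj Q) :
    retr k ε P Q (gen k (dirRel ε) (unW.map w) ≫ gen k (dirRel ε) f) =
      gen k (walRel ε) w ≫ retr k ε P' Q (gen k (dirRel ε) f) := by
  rw [← gen_comp, retr_gen, retr_gen]
  exact walPart_comp_left k ε w f

theorem retr_gen_comp_right {P Q Q' : WalOrd} (f : unW.obj P ⟶ unW.obj Q) (w : Q ⟶ Q') :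
    retr k ε P Q' (gen k (dirRel ε) f ≫ gen k (dirRel ε) (unW.map w)) =
      retr k ε P Q (gen k (dirRel ε) f) ≫ gen k (walRel ε) w := by
  rw [← gen_comp, retr_gen, retr_gen]
  exact walPart_comp_right k ε f w

/-- Bilinear extension of the case of diagrams. This form is needed for arbitrary morphisms because
it is the naturality condition that makes `iota` land in the coinduced module. -/
theorem retr_comp_left {P P' Q : WalOrd} (t : (⟨P⟩ : KUWB k ε) ⟶ ⟨P'⟩)
    (f : (⟨unW.obj P'⟩ : KDUB k ε) ⟶ ⟨unW.obj Q⟩) :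
    retr k ε P Q (upsHom k ε P P' t ≫ f) = t ≫ retr k ε P' Q f := by
  induction t using gen_induction with
  | zero => rw [map_zero, Limits.zero_comp, Limits.zero_comp, map_zero]
  | add t t' h h' => rw [map_add, Preadditive.add_comp, Preadditive.add_comp, map_add, h, h']
  | smul c t =>
    rw [map_smul, Linear.smul_comp, Linear.smul_comp, map_smul]
    congr 1
    induction f using gen_induction with
    | zero => rw [map_zero, Limits.comp_zero, Limits.comp_zero, map_zero]
    | add f f' h h' => rw [map_add, Preadditive.comp_add, Preadditive.comp_add, map_add, h, h']
    | smul c f =>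
      rw [map_smul, Linear.comp_smul, Linear.comp_smul, map_smul, upsHom_gen]
      congr 1
      exact retr_gen_comp_left k ε t f

end Retraction

/-! ### The transfer and the retraction -/

section Transfer

variable (k : Type u) [Field k] (δ ε : ℤˣ)

/-- With no pairs there is nothing to direct. Splittings and permutations have degree zero, so the
transfer leaves them unchanged. -/
theorem trMap_of_deg_zero {X Y : DirOrd} (f : X ⟶ Y) (hf : DirHom.deg f = 0) :
    trMap k δ ε f = gen k (dirRel ε) f := by
  obtain ⟨d, e⟩ := f
  obtain rfl : d = 0 := hf
  have key : ∀ φ : (Fin 0 → Equiv.Perm (Fin 2)) → ((⟨X⟩ : KDUB k ε) ⟶ ⟨Y⟩),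
      ∑ τ, φ τ = φ (fun _ => 1) := fun φ => by
    rw [Fintype.sum_unique]
    exact congrArg φ (Subsingleton.elim _ _)
  refine (key _).trans ?_
  have h : ∏ j : Fin 0, Equiv.Perm.sign ((fun _ => 1 : Fin 0 → Equiv.Perm (Fin 2)) j) = 1 := rfl
  refine (congrArg (fun s => sgn k (signChar δ s) • _) h).trans ?_
  rw [signChar_one, sgn_one, one_smul]
  exact congrArg (gen k (dirRel ε)) (DirHom.wr_one (DirHom.mk 0 e))

/-- Pairs of the second diagram remain pairs of the composite, so a single wrongly placed entry
makes the composite incompatible. -/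
theorem retr_comp_wr_of_not {P Q : WalOrd} {A : DirOrd} (f : unW.obj P ⟶ A) (h : A ⟶ unW.obj Q)
    (τ : Fin (DirHom.deg h) → Equiv.Perm (Fin 2)) (c : Fin 2) (j : Fin (DirHom.deg h))
    (hc : Sum.isLeft (h.e (Sum.inr (τ j c, j))) ≠ decide (c = 0)) :
    retr k ε P Q (gen k (dirRel ε) f ≫ gen k (dirRel ε) (DirHom.wr h τ 1)) = 0 := by
  refine (congrArg (retr k ε P Q) (gen_comp f _).symm).trans ?_
  refine (retr_gen k ε _).trans (walPart_of_not k ε _ fun hf => hc ?_)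
  exact Compat.comp_pair hf c j

/-- When both ends of a pair lie on the same side, neither direction of that pair goes from left to
right. The vanishing is termwise in the transfer sum. -/
theorem retr_comp_trMap_eq_zero {P Q : WalOrd} {A : DirOrd} (f : unW.obj P ⟶ A)
    (h : A ⟶ unW.obj Q) (j : Fin (DirHom.deg h))
    (hj : Sum.isLeft (h.e (Sum.inr (0, j))) = Sum.isLeft (h.e (Sum.inr (1, j)))) :
    retr k ε P Q (gen k (dirRel ε) f ≫ trMap k δ ε h) = 0 := by
  have hj' : ∀ c c' : Fin 2,
      Sum.isLeft (h.e (Sum.inr (c, j))) = Sum.isLeft (h.e (Sum.inr (c', j))) := fun c c' => by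
    fin_cases c <;> fin_cases c'
    exacts [rfl, hj, hj.symm, rfl]
  rw [trMap, Preadditive.comp_sum, map_sum]
  refine Finset.sum_eq_zero fun τ _ => ?_
  rw [Linear.comp_smul, map_smul]
  -- If the first entry carries the right label, the second carries the same label and is therefore
  -- wrong; otherwise the first entry is already wrong.
  by_cases h0 : Sum.isLeft (h.e (Sum.inr (τ j 0, j))) = decide ((0 : Fin 2) = 0)
  · rw [retr_comp_wr_of_not k ε f h τ 1 j, smul_zero]
    rw [hj' _ (τ j 0), h0]
    decide
  · rw [retr_comp_wr_of_not k ε f h τ 0 j h0, smul_zero]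

/-- Each pair of an unwalled diagram has one end on each side, so reversing any of them destroys
compatibility. Only the summand with no reversal survives, with coefficient one whatever `δ` is. -/
theorem retr_comp_trMap_unW {P P' Q : WalOrd} (f : unW.obj P ⟶ unW.obj P') (w : P' ⟶ Q) :
    retr k ε P Q (gen k (dirRel ε) f ≫ trMap k δ ε (unW.map w)) =
      retr k ε P P' (gen k (dirRel ε) f) ≫ gen k (walRel ε) w := by
  rw [trMap, Preadditive.comp_sum, map_sum]
  refine (Finset.sum_eq_single (fun _ => 1) (fun τ _ hτ => ?_)
    (fun h => absurd (Finset.mem_univ _) h)).trans ?_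
  · rw [Linear.comp_smul, map_smul]
    obtain ⟨j, hj⟩ : ∃ j, τ j ≠ 1 := by
      by_contra hcon
      push Not at hcon
      exact hτ (funext hcon)
    -- A nontrivial permutation of two elements exchanges them, so the first entry of the reversed
    -- pair lies on the right side.
    have h0 : τ j 0 = 1 := by
      by_contra h0
      refine hj ?_
      have h0' : τ j 0 = 0 := by omega
      have h1 : τ j 1 ≠ τ j 0 := fun h => absurd ((τ j).injective h) (by decide)
      ext c
      fin_cases c
      · exact congrArg Fin.val h0'
      · change (τ j 1).val = 1
        omega
    rw [retr_comp_wr_of_not k ε f (unW.map w) τ 0 j, smul_zero]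
    rw [h0]
    exact Bool.false_ne_true
  · have h1 : ∏ j : Fin (DirHom.deg (unW.map w)),
        Equiv.Perm.sign ((fun _ => 1 : _ → Equiv.Perm (Fin 2)) j) = 1 := by simp
    have h2 : DirHom.wr (unW.map w) (fun _ => 1) 1 = unW.map w := DirHom.wr_one _
    rw [h1, signChar_one, sgn_one, one_smul, h2]
    exact retr_gen_comp_right k ε f w

end Transfer

/-! ### An explicit description of the functor `dJ` -/

section Explicit

variable (k : Type u) [Field k] (δ ε : ℤˣ)

/-- Coinduction along `Ups`. -/
abbrev upsCoind : LMod k (KUWB k ε)ᵒᵖ ⥤ LMod k (KDUB k ε)ᵒᵖ :=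
  LMod.coindFunctor (Ups k ε).op fun p : ℕ × ℕ => op (⟨walObj p⟩ : KUWB k ε)

/-- The functor `dJ`, described through natural families. -/
def dJCoind : LMod k (KUWB k ε)ᵒᵖ ⥤ LMod k (KUB k δ ε)ᵒᵖ :=
  upsCoind k ε ⋙ LMod.restr (Tr k δ ε).op

/-- Right adjoints are unique up to isomorphism, so the abstract adjoint in `dJ` may be exchanged
for coinduction, where elements can be evaluated on diagrams. -/
theorem nonempty_dJ_iso : Nonempty (dJ k δ ε ≅ dJCoind k δ ε) := by
  have hs : ∀ a : (KUWB k ε)ᵒᵖ, ∃ p : ℕ × ℕ, Nonempty (op (⟨walObj p⟩ : KUWB k ε) ≅ a) :=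
    fun a => by
      obtain ⟨p, ⟨i⟩⟩ := kuwb_skeleton k ε a.unop
      exact ⟨p, ⟨i.symm.op⟩⟩
  choose i₀ u₀ using hs
  exact ⟨Functor.isoWhiskerRight ((Adjunction.ofIsLeftAdjoint (LMod.restr (k := k)
    (Ups k ε).op)).rightAdjointUniq (LMod.coindAdj (Ups k ε).op _ i₀ fun a => (u₀ a).some)) _⟩

variable {k δ ε} (F : LMod k (KUWB k ε)ᵒᵖ)

/-- The components of an element of `dJCoind F`. -/
def ev (A : DirOrd) (p : ℕ × ℕ) : ((dJCoind k δ ε).obj F).val (op ⟨A⟩) →ₗ[k]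
    ((⟨unW.obj (walObj p)⟩ : KDUB k ε) ⟶ ⟨A⟩) →ₗ[k] F.val (op ⟨walObj p⟩) :=
  LinearMap.mk₂ k (fun m f => (show LMod.coindSub (Ups k ε).op
      (fun p : ℕ × ℕ => op (⟨walObj p⟩ : KUWB k ε)) F (op ⟨A⟩) from m).1 p f.op)
    (fun _ _ _ => rfl) (fun _ _ _ => rfl) 
    (fun m f g => map_add ((show LMod.coindSub (Ups k ε).op
      (fun p : ℕ × ℕ => op (⟨walObj p⟩ : KUWB k ε)) F (op ⟨A⟩) from m).1 p) f.op g.op)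
    (fun c m f => map_smul ((show LMod.coindSub (Ups k ε).op
      (fun p : ℕ × ℕ => op (⟨walObj p⟩ : KUWB k ε)) F (op ⟨A⟩) from m).1 p) c f.op)

variable {F}

theorem ev_ext {A : DirOrd} {m m' : ((dJCoind k δ ε).obj F).val (op ⟨A⟩)}
    (h : ∀ (p : ℕ × ℕ) (f : unW.obj (walObj p) ⟶ A),
      ev F A p m (gen k (dirRel ε) f) = ev F A p m' (gen k (dirRel ε) f)) : m = m' := by
  refine Subtype.ext (funext fun p => LinearMap.ext fun f => ?_)
  have h' : ev F A p m = ev F A p m' := gen_ext (h p)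
  exact LinearMap.congr_fun h' f.unop

/-- The downward undirected category acts on natural families through the transfer; this is the only
place where the transfer enters the explicit model. -/
theorem ev_act {A B : DirOrd} (h : A ⟶ B) (m : ((dJCoind k δ ε).obj F).val (op ⟨B⟩)) (p : ℕ × ℕ)
    (f : (⟨unW.obj (walObj p)⟩ : KDUB k ε) ⟶ ⟨A⟩) :
    ev F A p (((dJCoind k δ ε).obj F).act (gen k (undirRel δ ε) h).op m) f =
      ev F B p m (f ≫ trMap k δ ε h) := by
  rw [← show (Tr k δ ε).map (gen k (undirRel δ ε) h) = trMap k δ ε h from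
    Tw.lift_gen (trData k δ ε) h]
  rfl

theorem ev_nat {A : DirOrd} (m : ((dJCoind k δ ε).obj F).val (op ⟨A⟩)) {p q : ℕ × ℕ}
    (w : walObj p ⟶ walObj q) (f : (⟨unW.obj (walObj q)⟩ : KDUB k ε) ⟶ ⟨A⟩) :
    ev F A p m (gen k (dirRel ε) (unW.map w) ≫ f) =
      F.act (gen k (walRel ε) w).op (ev F A q m f) := by
  have h := (show LMod.coindSub (Ups k ε).op
    (fun p : ℕ × ℕ => op (⟨walObj p⟩ : KUWB k ε)) F (op ⟨A⟩) from m).2 q p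
      (gen k (walRel ε) w).op f.op
  rw [← upsHom_gen]
  exact h.symm

theorem ev_map {F' : LMod k (KUWB k ε)ᵒᵖ} (φ : F ⟶ F') {A : DirOrd}
    (m : ((dJCoind k δ ε).obj F).val (op ⟨A⟩)) (p : ℕ × ℕ)
    (f : (⟨unW.obj (walObj p)⟩ : KDUB k ε) ⟶ ⟨A⟩) :
    ev F' A p (LMod.homAt ((dJCoind k δ ε).map φ) (op ⟨A⟩) m) f =
      LMod.homAt φ _ (ev F A p m f) := rfl

variable (F)

/-- The section of the counit of the coinduction adjunction provided by the retraction `retr`. -/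
def iota (P : WalOrd) : F.val (op ⟨P⟩) →ₗ[k] ((dJCoind k δ ε).obj F).val (op ⟨unW.obj P⟩) where
  toFun x := show LMod.coindSub (Ups k ε).op
      (fun p : ℕ × ℕ => op (⟨walObj p⟩ : KUWB k ε)) F (op ⟨unW.obj P⟩) from
    ⟨fun q =>
      { toFun := fun f => F.act (retr k ε (walObj q) P f.unop).op x
        map_add' := fun f g => 
          (congrArg (fun t => F.act t.op x) (map_add (retr k ε (walObj q) P) f.unop g.unop)).trans
            (LMod.act_add F _ _ x)
        map_smul' := fun c f => 
          (congrArg (fun t => F.act t.op x) (map_smul (retr k ε (walObj q) P) c f.unop)).trans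
            (LMod.act_smul F c _ x) },
      fun i j t f => by
        refine (LMod.act_comp F _ _ x).symm.trans (congrArg (fun t => F.act t x) ?_)
        exact congrArg Quiver.Hom.op
          (retr_comp_left k ε (P := walObj j) (P' := walObj i) t.unop f.unop).symm⟩
  map_add' x y := Subtype.ext (funext fun q => LinearMap.ext fun f =>
    map_add (F.act (retr k ε (walObj q) P f.unop).op) x y)
  map_smul' c x := Subtype.ext (funext fun q => LinearMap.ext fun f =>
    map_smul (F.act (retr k ε (walObj q) P f.unop).op) c x)

variable {F}

theorem ev_iota {P : WalOrd} (x : F.val (op ⟨P⟩)) (q : ℕ × ℕ)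
    (f : (⟨unW.obj (walObj q)⟩ : KDUB k ε) ⟶ ⟨unW.obj P⟩) :
    ev F (unW.obj P) q (iota (δ := δ) F P x) f =
      F.act (retr k ε (walObj q) P f).op x := rfl

/-- Evaluated on a directed diagram, this is `retr_comp_trMap_unW`: the transfer of a walled diagram
acts after `retr` as the diagram itself. -/
theorem iota_act {P Q : WalOrd} (w : P ⟶ Q) (x : F.val (op ⟨Q⟩)) :
    ((dJCoind k δ ε).obj F).act (gen k (undirRel δ ε) (unW.map w)).op (iota F Q x) =
      iota F P (F.act (gen k (walRel ε) w).op x) := by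
  refine ev_ext fun q f => ?_
  rw [ev_act, ev_iota, ev_iota, retr_comp_trMap_unW, op_comp, LMod.act_comp]

/-- The retraction kills the whole transfer of a diagram with a pair inside one side. This removes
the unmixed pairs from the Koszul differential. -/
theorem act_iota_eq_zero {A : DirOrd} {Q : WalOrd} (h : A ⟶ unW.obj Q) (x : F.val (op ⟨Q⟩))
    (j : Fin (DirHom.deg h))
    (hj : Sum.isLeft (h.e (Sum.inr (0, j))) = Sum.isLeft (h.e (Sum.inr (1, j)))) :
    ((dJCoind k δ ε).obj F).act (gen k (undirRel δ ε) h).op (iota F Q x) = 0 := by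
  refine ev_ext fun q f => ?_
  rw [ev_act, ev_iota, retr_comp_trMap_eq_zero k δ ε f h j hj, map_zero, LinearMap.zero_apply]
  exact LinearMap.congr_fun (ModuleCat.hom_ext_iff.1 (F.obj.map_zero _ _)) x

theorem iota_nat {F' : LMod k (KUWB k ε)ᵒᵖ} (φ : F ⟶ F') {P : WalOrd} (x : F.val (op ⟨P⟩)) :
    LMod.homAt ((dJCoind k δ ε).map φ) (op ⟨unW.obj P⟩) (iota F P x) =
      iota F' P (LMod.homAt φ _ x) := by
  refine ev_ext fun q f => ?_
  rw [ev_map, ev_iota, ev_iota, LMod.homAt_act]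

end Explicit

/-! ### Splittings as diagrams -/

/-- The isomorphism of diagrams given by a splitting. -/
def splitHom {p : ℕ × ℕ} {N : ℕ} (e : Fin p.1 ⊕ Fin p.2 ≃ Fin N) :
    unW.obj (walObj p) ⟶ dirObj N := DirHom.ofEquiv e

/-- The inverse of `splitHom`. -/
def splitInv {p : ℕ × ℕ} {N : ℕ} (e : Fin p.1 ⊕ Fin p.2 ≃ Fin N) :
    dirObj N ⟶ unW.obj (walObj p) := DirHom.ofEquiv e.symm

theorem splitInv_splitHom {p : ℕ × ℕ} {N : ℕ} (e : Fin p.1 ⊕ Fin p.2 ≃ Fin N) :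
    splitInv e ≫ splitHom e = 𝟙 (dirObj N) := by
  refine (DirHom.ofEquiv_comp e.symm e).trans ?_
  rw [Equiv.symm_trans_self]
  rfl

theorem splitHom_splitInv {p : ℕ × ℕ} {N : ℕ} (e : Fin p.1 ⊕ Fin p.2 ≃ Fin N) :
    splitHom e ≫ splitInv e = 𝟙 (unW.obj (walObj p)) := by
  refine (DirHom.ofEquiv_comp e e.symm).trans ?_
  rw [Equiv.self_trans_symm]
  rfl

theorem splitHom_dirSym {p : ℕ × ℕ} {N : ℕ} (e : Fin p.1 ⊕ Fin p.2 ≃ Fin N)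
    (σ : Equiv.Perm (Fin N)) : splitHom e ≫ dirSym N σ = splitHom (e.trans σ) :=
  DirHom.ofEquiv_comp e σ

/-- Two splittings of the same bidegree differ by a permutation of `Fin N`, which the balanced
tensor product absorbs. -/
theorem dirSym_splitInv {p : ℕ × ℕ} {N : ℕ} (e e' : Fin p.1 ⊕ Fin p.2 ≃ Fin N) :
    dirSym N (e'.symm.trans e) ≫ splitInv e = splitInv e' := by
  refine (DirHom.ofEquiv_comp (e'.symm.trans e) e.symm).trans ?_
  rw [Equiv.trans_assoc, Equiv.self_trans_symm, Equiv.trans_refl]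
  rfl

theorem unW_walSym (p : ℕ × ℕ) (σ : Equiv.Perm (Fin p.1) × Equiv.Perm (Fin p.2)) :
    unW.map (walSym p σ) = DirHom.ofEquiv (Equiv.sumCongr σ.1 σ.2) := by
  refine DirHom.ext' rfl (fun a => ?_) (fun _ j => j.elim0)
  rcases a with a | a <;> rfl

theorem unW_walSym_splitHom {p : ℕ × ℕ} {N : ℕ} (e : Fin p.1 ⊕ Fin p.2 ≃ Fin N)
    (σ : Equiv.Perm (Fin p.1) × Equiv.Perm (Fin p.2)) :
    unW.map (walSym p σ) ≫ splitHom e = splitHom ((Equiv.sumCongr σ.1 σ.2).trans e) :=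
  (congrArg (· ≫ splitHom e) (unW_walSym p σ)).trans
    (DirHom.ofEquiv_comp (Equiv.sumCongr σ.1 σ.2) e)

theorem splitInv_unW_walSym {p : ℕ × ℕ} {N : ℕ} (e : Fin p.1 ⊕ Fin p.2 ≃ Fin N)
    (σ : Equiv.Perm (Fin p.1) × Equiv.Perm (Fin p.2)) :
    splitInv e ≫ unW.map (walSym p σ) = splitInv ((Equiv.sumCongr σ.1 σ.2).symm.trans e) :=
  (congrArg (splitInv e ≫ ·) (unW_walSym p σ)).trans
    (DirHom.ofEquiv_comp e.symm (Equiv.sumCongr σ.1 σ.2))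

/-- As `f` is a bijection onto `Fin N`, it transports the labels of its source and of its pairs to
one labelling of `Fin N`. The composite is walled precisely for the splittings that induce this
labelling, so `sum_splitting` applies. -/
theorem compat_comp_splitInv {A : Type} {l : A → Bool} {p : ℕ × ℕ} {N : ℕ}
    (f : DirHom A (Fin N)) (e : Fin p.1 ⊕ Fin p.2 ≃ Fin N) :
    Compat l Sum.isLeft (f.comp (DirHom.ofEquiv e.symm)) ↔
      ∀ n, (e.symm n).isLeft = pairLabel l f.deg (f.e.symm n) := by
  rw [compat_comp_iff_left (l' := fun n => (e.symm n).isLeft) f (compat_ofEquiv.2 fun _ => rfl)]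
  refine ⟨fun h n => ?_, fun h z => ?_⟩
  · have := h (f.e.symm n)
    rwa [Equiv.apply_symm_apply] at this
  · have := h (f.e z)
    rwa [Equiv.symm_apply_apply] at this

/-! ### Decomposition into components and construction of the comparison map -/

section Theta

variable {k : Type u} [Field k] {δ ε : ℤˣ} {F : LMod k (KUWB k ε)ᵒᵖ}

theorem trMap_splitInv {p : ℕ × ℕ} {N : ℕ} (e : Fin p.1 ⊕ Fin p.2 ≃ Fin N) :
    trMap k δ ε (splitInv e) = gen k (dirRel ε) (splitInv e) := trMap_of_deg_zero k δ ε _ rfl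

/-- The decomposition of an element of `dJCoind F` into its components. -/
theorem sum_act_splitInv_iota [CharZero k] {N : ℕ}
    (m : ((dJCoind k δ ε).obj F).val (op ⟨dirObj N⟩)) :
    ∑ p : Bideg N, splitWt k p.1 • ∑ e : Fin p.1.1 ⊕ Fin p.1.2 ≃ Fin N,
      ((dJCoind k δ ε).obj F).act (gen k (undirRel δ ε) (splitInv e)).op
        (iota F (walObj p.1) (ev F (dirObj N) p.1 m (gen k (dirRel ε) (splitHom e)))) = m := by
  refine ev_ext fun q f => ?_
  have hs : ∀ (p : Bideg N) (e : Fin p.1.1 ⊕ Fin p.1.2 ≃ Fin N),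
      ev F (dirObj N) q (((dJCoind k δ ε).obj F).act (gen k (undirRel δ ε) (splitInv e)).op
        (iota F (walObj p.1) (ev F (dirObj N) p.1 m (gen k (dirRel ε) (splitHom e)))))
        (gen k (dirRel ε) f) =
      F.act (Quiver.Hom.op (X := (⟨walObj q⟩ : KUWB k ε)) (Y := ⟨walObj p.1⟩)
        (walPart k ε (f ≫ splitInv e)))
        (ev F (dirObj N) p.1 m (gen k (dirRel ε) (splitHom e))) := fun p e => by
    rw [ev_act, ev_iota, trMap_splitInv, ← gen_comp, retr_gen]
  simp only [map_sum, map_smul, LinearMap.sum_apply, LinearMap.smul_apply, hs]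
  -- At `f`, the summand of a splitting is the walled part of `f ≫ splitInv e` acting on a component
  -- of `m`; it has to be the value of `m` at `f` when the labellings match and zero otherwise.
  refine sum_splitting k
    (fun n => pairLabel Sum.isLeft (DirHom.deg f) ((DirHom.e f).symm n)) _
    (fun s : Splitting N => F.act (Quiver.Hom.op (X := (⟨walObj q⟩ : KUWB k ε)) (Y := ⟨walObj s.1.1⟩)
        (walPart k ε (f ≫ splitInv s.2)))
        (ev F (dirObj N) s.1.1 m (gen k (dirRel ε) (splitHom s.2))))
    (fun s h => ?_) (fun s h => ?_)
  · obtain ⟨w, hw⟩ := exists_unwHom ((compat_comp_splitInv f s.2).2 h)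
    have hw' : unW.map (w : walObj q ⟶ walObj s.1.1) = f ≫ splitInv s.2 := hw
    rw [← hw']
    refine (congrArg (fun t : (⟨walObj q⟩ : KUWB k ε) ⟶ ⟨walObj s.1.1⟩ => F.act t.op _)
      (walPart_unW k ε (w : walObj q ⟶ walObj s.1.1))).trans ?_
    -- Here `f` is the walled diagram `w` followed by the splitting, so naturality of the family `m`
    -- turns the summand into its value at `f`.
    refine (ev_nat m (w : walObj q ⟶ walObj s.1.1) _).symm.trans ?_
    rw [hw', ← gen_comp, Category.assoc, splitInv_splitHom, Category.comp_id]
  · have h0 := walPart_of_not k ε (Q := walObj s.1.1) (f ≫ splitInv s.2)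
      fun h' => h ((compat_comp_splitInv f s.2).1 h')
    refine (congrArg (fun t : (⟨walObj q⟩ : KUWB k ε) ⟶ ⟨walObj s.1.1⟩ => F.act t.op _) h0).trans ?_
    exact LinearMap.congr_fun (ModuleCat.hom_ext_iff.1 (F.obj.map_zero _ _)) _

/-- The functor `ups` on morphisms, as a linear map. -/
def undHom (k : Type u) [Field k] (δ η : ℤˣ) (P Q : WalOrd) : ((⟨P⟩ : KUWB k η) ⟶ ⟨Q⟩) →ₗ[k]
    ((⟨unW.obj P⟩ : KUB k δ η) ⟶ ⟨unW.obj Q⟩) where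
  toFun g := (ups k δ η).map g
  map_add' _ _ := (ups k δ η).map_add
  map_smul' c g := (ups k δ η).map_smul c g

theorem undHom_gen (η : ℤˣ) {P Q : WalOrd} (w : P ⟶ Q) :
    undHom k δ η P Q (gen k (walRel η) w) = gen k (undirRel δ η) (unW.map w) :=
  (congrArg (mp k δ η).map (upsHom_gen k η w)).trans (Tw.lift_gen _ (unW.map w))

theorem undHom_comp (η : ℤˣ) {P Q S : WalOrd} (f : (⟨P⟩ : KUWB k η) ⟶ ⟨Q⟩)
    (g : (⟨Q⟩ : KUWB k η) ⟶ ⟨S⟩) :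
    undHom k δ η P S (f ≫ g) = undHom k δ η P Q f ≫ undHom k δ η Q S g :=
  (ups k δ η).map_comp f g

theorem undHom_id (η : ℤˣ) (P : WalOrd) : undHom k δ η P P (𝟙 _) = 𝟙 _ :=
  (ups k δ η).map_id _

variable (F) in
/-- The function on diagrams from a standard set to the unwalling of `P` from which the comparison
of the Koszul complexes is built. -/
def thetaFun (δ : ℤˣ) {N : ℕ} {P Y : WalOrd} (g : (⟨P⟩ : KUWB k (-ε)) ⟶ ⟨Y⟩) (x : F.val (op ⟨P⟩))
    (h : dirObj N ⟶ unW.obj P) :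
    Bal (dirSym N) ((dJCoind k δ ε).obj F) (⟨unW.obj Y⟩ : KUB k δ (-ε)) :=
  diffFun (dirSym N) ((dJCoind k δ ε).obj F) ⟨unW.obj Y⟩ (undHom k δ (-ε) P Y g)
    (iota (δ := δ) F P x) h

theorem thetaFun_eq {N : ℕ} {P Y : WalOrd} (g : (⟨P⟩ : KUWB k (-ε)) ⟶ ⟨Y⟩) (x : F.val (op ⟨P⟩))
    (h : dirObj N ⟶ unW.obj P) : thetaFun F δ g x h =
      bmk (dirSym N) ((dJCoind k δ ε).obj F) (⟨unW.obj Y⟩ : KUB k δ (-ε))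
        (gen k _ h ≫ undHom k δ (-ε) P Y g)
        (((dJCoind k δ ε).obj F).act (gen k (undirRel δ ε) h).op (iota F P x)) := rfl

/-- A final walled factor acts in both tensor slots at once, in the first by functoriality of `ups`
and in the second by `iota_act`. The balancing over `S_m × S_n` and the comparison with the walled
differential are both instances of this. -/
theorem thetaFun_comp {N : ℕ} {P Q Y : WalOrd} (g : (⟨Q⟩ : KUWB k (-ε)) ⟶ ⟨Y⟩)
    (x : F.val (op ⟨Q⟩)) (h : dirObj N ⟶ unW.obj P) (w : P ⟶ Q) :
    thetaFun F δ g x (h ≫ unW.map w) =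
      thetaFun F δ (gen k (walRel (-ε)) w ≫ g) (F.act (gen k (walRel ε) w).op x) h := by
  rw [thetaFun_eq, thetaFun_eq, gen_comp, gen_comp, op_comp, LMod.act_comp, iota_act, undHom_comp,
    undHom_gen, Category.assoc]

theorem thetaFun_dirSym {N : ℕ} {P Y : WalOrd} (g : (⟨P⟩ : KUWB k (-ε)) ⟶ ⟨Y⟩)
    (x : F.val (op ⟨P⟩)) (σ : Equiv.Perm (Fin N)) (h : dirObj N ⟶ unW.obj P) :
    thetaFun F δ g x (dirSym N σ ≫ h) = thetaFun F δ g x h :=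
  (diffFun_inv _ _ _ _ _).inv σ h

/-- The two inverse splittings differ by an element of `S_N`, over which the target is balanced.
Hence the comparison does not depend on the chosen splitting. -/
theorem thetaFun_splitInv {p : ℕ × ℕ} {N : ℕ} {Y : WalOrd}
    (g : (⟨walObj p⟩ : KUWB k (-ε)) ⟶ ⟨Y⟩) (x : F.val (op ⟨walObj p⟩))
    (e e' : Fin p.1 ⊕ Fin p.2 ≃ Fin N) :
    thetaFun F δ g x (splitInv e) = thetaFun F δ g x (splitInv e') := by
  rw [← dirSym_splitInv e' e, thetaFun_dirSym]

theorem thetaFun_walSym {p : ℕ × ℕ} {N : ℕ} {Y : WalOrd}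
    (g : (⟨walObj p⟩ : KUWB k (-ε)) ⟶ ⟨Y⟩) (x : F.val (op ⟨walObj p⟩))
    (e : Fin p.1 ⊕ Fin p.2 ≃ Fin N) (σ : Equiv.Perm (Fin p.1) × Equiv.Perm (Fin p.2)) :
    thetaFun F δ (gen k (walRel (-ε)) (walSym p σ) ≫ g) x (splitInv e) =
      thetaFun F δ g (F.act (gen k (walRel ε) (walSym p σ⁻¹)).op x) (splitInv e) := by
  have h : walSym p σ ≫ walSym p σ⁻¹ = 𝟙 (walObj p) := by
    rw [← End.mul_def, ← map_mul, inv_mul_cancel, map_one]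
    rfl
  have hx : F.act (gen k (walRel ε) (walSym p σ)).op
      (F.act (gen k (walRel ε) (walSym p σ⁻¹)).op x) = x := by
    rw [← LMod.act_comp, ← op_comp, ← gen_comp, h, gen_id, op_id, LMod.act_id]
  -- Writing `x` as `σ` applied to `σ⁻¹ x` brings the left side into the shape of `thetaFun_comp`;
  -- the splitting modified by `σ` can then be replaced by the original one.
  conv_lhs => rw [← hx]
  rw [← thetaFun_comp, splitInv_unW_walSym]
  exact thetaFun_splitInv _ _ _ _

/-- The linear map `g ⊗ x ↦ thetaFun g x`. -/
def thetaLin (F : LMod k (KUWB k ε)ᵒᵖ) (δ : ℤˣ) {p : ℕ × ℕ} {N : ℕ}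
    (e : Fin p.1 ⊕ Fin p.2 ≃ Fin N) (Y : WalOrd) :
    Bal (walSym p) F (⟨Y⟩ : KUWB k (-ε)) →ₗ[k]
      Bal (dirSym N) ((dJCoind k δ ε).obj F) (⟨unW.obj Y⟩ : KUB k δ (-ε)) :=
  balLift (walSym p) (LinearMap.mk₂ k (fun g x => thetaFun F δ g x (splitInv e))
      (fun g g' x => by simp only [thetaFun_eq, map_add, Preadditive.comp_add, bmk_add])
      (fun c g x => by simp only [thetaFun_eq, map_smul, Linear.comp_smul, bmk_smul])
      (fun g x x' => by simp only [thetaFun_eq, map_add, bmk_add'])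
      (fun c g x => by simp only [thetaFun_eq, map_smul, bmk_smul']))
    (fun σ g x => thetaFun_walSym g x e σ)

theorem thetaLin_bmk {p : ℕ × ℕ} {N : ℕ} (e : Fin p.1 ⊕ Fin p.2 ≃ Fin N) (Y : WalOrd)
    (g : (⟨walObj p⟩ : KUWB k (-ε)) ⟶ ⟨Y⟩) (x : F.val (op ⟨walObj p⟩)) :
    thetaLin F δ e Y (bmk (walSym p) F ⟨Y⟩ g x) = thetaFun F δ g x (splitInv e) :=
  balLift_bmk _ _ _ _ _

theorem balAct_thetaFun {N : ℕ} {P Y Y' : WalOrd} (g : (⟨P⟩ : KUWB k (-ε)) ⟶ ⟨Y⟩)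
    (x : F.val (op ⟨P⟩)) (h : dirObj N ⟶ unW.obj P) (t : (⟨Y⟩ : KUWB k (-ε)) ⟶ ⟨Y'⟩) :
    balAct (dirSym N) ((dJCoind k δ ε).obj F) (undHom k δ (-ε) Y Y' t) (thetaFun F δ g x h) =
      thetaFun F δ (g ≫ t) x h := by
  rw [thetaFun_eq, thetaFun_eq, balAct_bmk, undHom_comp, Category.assoc]

variable [CharZero k]

variable (F δ) in
/-- The components of the comparison of the Koszul complexes. -/
def thetaComp {p : ℕ × ℕ} {N : ℕ} (e : Fin p.1 ⊕ Fin p.2 ≃ Fin N) :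
    walTerm k ε F p ⟶
      (LMod.restr (ups k δ (-ε))).obj (dirTerm k δ ε ((dJCoind k δ ε).obj F) N) :=
  LMod.mkIn (ups k δ (-ε)) (fun Y => thetaLin F δ e Y.as) (fun {Y Y'} t =>
    LinearMap.congr_fun (f := thetaLin F δ e Y'.as ∘ₗ balAct (walSym p) F t)
      (g := balAct (dirSym N) ((dJCoind k δ ε).obj F) (undHom k δ (-ε) Y.as Y'.as t) ∘ₗ
        thetaLin F δ e Y.as) (bal_ext _ fun g x => by
      rw [LinearMap.comp_apply, LinearMap.comp_apply, balAct_bmk]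
      refine (thetaLin_bmk e Y'.as (g ≫ t) x).trans ?_
      refine Eq.trans ?_ (congrArg _ (thetaLin_bmk e Y.as g x).symm)
      exact (balAct_thetaFun g x (splitInv e) t).symm))

/-- The standard splitting. -/
def stdSplit {N : ℕ} (p : Bideg N) : Fin p.1.1 ⊕ Fin p.1.2 ≃ Fin N :=
  finSumFinEquiv.trans (finCongr p.2)

variable (F δ) in
/-- The comparison of the Koszul complexes. -/
def theta (N : ℕ) : (LMod.dsum fun p : Bideg N => walTerm k ε F p.1) ⟶
    (LMod.restr (ups k δ (-ε))).obj (dirTerm k δ ε ((dJCoind k δ ε).obj F) N) :=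
  LMod.dsumDesc fun p => thetaComp δ F (stdSplit p)

end Theta

/-! ### Universality of the comparison -/

section Universal

variable {k : Type u} [Field k] [CharZero k] {δ ε : ℤˣ} {F : LMod k (KUWB k ε)ᵒᵖ}
  {Z : LMod k (KUB k δ (-ε))}

theorem termAt_thetaComp_map {p : ℕ × ℕ} {N : ℕ} (e : Fin p.1 ⊕ Fin p.2 ≃ Fin N)
    (φ : dirTerm k δ ε ((dJCoind k δ ε).obj F) N ⟶ Z) {Y : WalOrd}
    (g : (⟨walObj p⟩ : KUWB k (-ε)) ⟶ ⟨Y⟩) (x : F.val (op ⟨walObj p⟩)) :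
    termAt (walSym p) (thetaComp δ F e ≫ (LMod.restr (ups k δ (-ε))).map φ) ⟨Y⟩
      (bmk (walSym p) F ⟨Y⟩ g x) =
      termAt (dirSym N) φ ⟨unW.obj Y⟩ (thetaFun F δ g x (splitInv e)) :=
  congrArg (termAt (dirSym N) φ ⟨unW.obj Y⟩) (thetaLin_bmk e Y g x)

theorem dsumIncl_theta (N : ℕ) (p : Bideg N)
    (φ : dirTerm k δ ε ((dJCoind k δ ε).obj F) N ⟶ Z) :
    LMod.dsumIncl (fun p : Bideg N => walTerm k ε F p.1) p ≫ theta δ F N ≫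
      (LMod.restr (ups k δ (-ε))).map φ =
      thetaComp δ F (stdSplit p) ≫ (LMod.restr (ups k δ (-ε))).map φ :=
  (Category.assoc _ _ _).symm.trans
    (congrArg (· ≫ (LMod.restr (ups k δ (-ε))).map φ) (LMod.dsumIncl_desc _ p))

/-- Inserting the identity as `splitInv e` followed by `splitHom e` exhibits the class as the image,
under a morphism, of a value of the comparison at an identity. Values of this kind therefore
determine morphisms on all such classes. -/
theorem bmk_act_splitInv_iota {p : ℕ × ℕ} {N : ℕ} (e : Fin p.1 ⊕ Fin p.2 ≃ Fin N)
    {Y : KUB k δ (-ε)} (g : (⟨dirObj N⟩ : KUB k δ (-ε)) ⟶ Y) (x : F.val (op ⟨walObj p⟩)) :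
    bmk (dirSym N) ((dJCoind k δ ε).obj F) Y g
      (((dJCoind k δ ε).obj F).act (gen k (undirRel δ ε) (splitInv e)).op
        (iota F (walObj p) x)) =
      balAct (dirSym N) ((dJCoind k δ ε).obj F) (gen k _ (splitHom e) ≫ g)
        (thetaFun F δ (𝟙 (⟨walObj p⟩ : KUWB k (-ε))) x (splitInv e)) := by
  rw [thetaFun_eq, balAct_bmk, undHom_id, Category.comp_id, ← Category.assoc, ← gen_comp,
    splitInv_splitHom, gen_id, Category.id_comp]

/-- The composite with `theta` fixes a morphism on the classes `g ⊗ splitInv e (iota x)`, and by the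
decomposition of elements into components these span the term. -/
theorem theta_map_injective (N : ℕ) :
    Function.Injective fun φ : dirTerm k δ ε ((dJCoind k δ ε).obj F) N ⟶ Z =>
      theta δ F N ≫ (LMod.restr (ups k δ (-ε))).map φ := by
  intro φ φ' h
  have h1 : ∀ (p : Bideg N) (e : Fin p.1.1 ⊕ Fin p.1.2 ≃ Fin N) (x : F.val (op ⟨walObj p.1⟩)),
      termAt (dirSym N) φ ⟨unW.obj (walObj p.1)⟩ (thetaFun F δ (𝟙 _) x (splitInv e)) =
        termAt (dirSym N) φ' ⟨unW.obj (walObj p.1)⟩ (thetaFun F δ (𝟙 _) x (splitInv e)) :=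
    fun p e x => by
      -- `theta` involves only the standard splittings; independence of the splitting extends the
      -- equality to all of them.
      rw [thetaFun_splitInv _ _ e (stdSplit p), ← termAt_thetaComp_map, ← termAt_thetaComp_map,
        ← dsumIncl_theta, ← dsumIncl_theta]
      exact congrArg (fun t => termAt (walSym p.1)
        (LMod.dsumIncl (fun p : Bideg N => walTerm k ε F p.1) p ≫ t) ⟨walObj p.1⟩
        (bmk (walSym p.1) F ⟨walObj p.1⟩ (𝟙 _) x)) h
  have h2 : ∀ {Y Y' : KUB k δ (-ε)} (t : Y ⟶ Y')
      (φ : dirTerm k δ ε ((dJCoind k δ ε).obj F) N ⟶ Z) (b),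
      termAt (dirSym N) φ Y' (balAct (dirSym N) _ t b) = Z.act t (termAt (dirSym N) φ Y b) :=
    fun t φ b => LMod.homAt_act φ t b
  have h3 : ∀ {Y : KUB k δ (-ε)} (g : (⟨dirObj N⟩ : KUB k δ (-ε)) ⟶ Y) (p : Bideg N)
      (e : Fin p.1.1 ⊕ Fin p.1.2 ≃ Fin N) (x : F.val (op ⟨walObj p.1⟩)),
      termAt (dirSym N) φ Y (bmk (dirSym N) ((dJCoind k δ ε).obj F) Y g
        (((dJCoind k δ ε).obj F).act (gen k (undirRel δ ε) (splitInv e)).op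
        (iota F (walObj p.1) x))) =
      termAt (dirSym N) φ' Y (bmk (dirSym N) ((dJCoind k δ ε).obj F) Y g
        (((dJCoind k δ ε).obj F).act (gen k (undirRel δ ε) (splitInv e)).op
        (iota F (walObj p.1) x))) := fun g p e x => by
    rw [bmk_act_splitInv_iota, h2, h2, h1]
  refine term_ext _ fun Y g m => ?_
  let b : ((dJCoind k δ ε).obj F).val (op ⟨dirObj N⟩) →ₗ[k] Bal (dirSym N) _ Y :=
    { toFun := fun m => bmk (dirSym N) ((dJCoind k δ ε).obj F) Y g m
      map_add' := fun m m' => bmk_add' _ _ _ g m m'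
      map_smul' := fun c m => bmk_smul' _ _ _ c g m }
  change (termAt (dirSym N) φ Y ∘ₗ b) m = (termAt (dirSym N) φ' Y ∘ₗ b) m
  rw [← sum_act_splitInv_iota m]
  simp only [map_sum, map_smul]
  refine Finset.sum_congr rfl fun p _ => congrArg _ (Finset.sum_congr rfl fun e _ => ?_)
  exact h3 g p e _

/-- The values of a morphism out of `walTerm` on the generators. -/
def genVal {p : ℕ × ℕ} (ψ : walTerm k ε F p ⟶ (LMod.restr (ups k δ (-ε))).obj Z) :
    F.val (op ⟨walObj p⟩) →ₗ[k] Z.val ⟨unW.obj (walObj p)⟩ where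
  toFun x := termAt (walSym p) ψ ⟨walObj p⟩ (bmk (walSym p) F ⟨walObj p⟩ (𝟙 _) x)
  map_add' x y := (congrArg _ (bmk_add' _ _ _ _ x y)).trans (map_add (termAt (walSym p) ψ _) _ _)
  map_smul' c x :=
    (congrArg _ (bmk_smul' _ _ _ c _ x)).trans (map_smul (termAt (walSym p) ψ _) c _)

/-- Yoneda: every class `g ⊗ x` is the image of `1 ⊗ x` under `g`. -/
theorem termAt_eq_genVal {p : ℕ × ℕ} (ψ : walTerm k ε F p ⟶ (LMod.restr (ups k δ (-ε))).obj Z)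
    {Y : WalOrd} (g : (⟨walObj p⟩ : KUWB k (-ε)) ⟶ ⟨Y⟩) (x : F.val (op ⟨walObj p⟩)) :
    termAt (walSym p) ψ ⟨Y⟩ (bmk (walSym p) F ⟨Y⟩ g x) =
      Z.act (undHom k δ (-ε) (walObj p) Y g) (genVal ψ x) := by
  have h : bmk (walSym p) F ⟨Y⟩ g x =
      balAct (walSym p) F g (bmk (walSym p) F ⟨walObj p⟩ (𝟙 _) x) := by
    rw [balAct_bmk, Category.id_comp]
  rw [h]
  exact LMod.inAt_act (ups k δ (-ε)) ψ g (bmk (walSym p) F ⟨walObj p⟩ (𝟙 _) x)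

/-- The balancing over `S_m × S_n`, moved through a morphism to the target. This is the invariance
that `avgVal_iota` requires of the prescribed values. -/
theorem act_genVal {p : ℕ × ℕ} (ψ : walTerm k ε F p ⟶ (LMod.restr (ups k δ (-ε))).obj Z)
    (σ : Equiv.Perm (Fin p.1) × Equiv.Perm (Fin p.2)) (x : F.val (op ⟨walObj p⟩)) :
    Z.act (gen k _ (unW.map (walSym p σ)))
      (genVal ψ (F.act (gen k (walRel ε) (walSym p σ)).op x)) = genVal ψ x := by
  have h : walSym p σ⁻¹ ≫ walSym p σ = 𝟙 (walObj p) := by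
    rw [← End.mul_def, ← map_mul, mul_inv_cancel, map_one]
    rfl
  rw [← undHom_gen, ← termAt_eq_genVal]
  refine congrArg (termAt (walSym p) ψ ⟨walObj p⟩) ?_
  have h1 := bmk_rel (walSym p) F (⟨walObj p⟩ : KUWB k (-ε)) σ (𝟙 _)
    (F.act (gen k (walRel ε) (walSym p σ)).op x)
  rw [Category.comp_id, ← LMod.act_comp, ← op_comp, ← gen_comp, h, gen_id, op_id,
    LMod.act_id] at h1
  exact h1

/-! ### Extending prescribed values on the components by averaging over splittings -/

section Extension

variable {N : ℕ}
  (v : ∀ p : Bideg N, F.val (op ⟨walObj p.1⟩) →ₗ[k] Z.val ⟨unW.obj (walObj p.1)⟩)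

/-- The average over all splittings of the values of a family of maps on the components. -/
def avgVal : ((dJCoind k δ ε).obj F).val (op ⟨dirObj N⟩) →ₗ[k] Z.val ⟨dirObj N⟩ :=
  ∑ p : Bideg N, splitWt k p.1 • ∑ e : Fin p.1.1 ⊕ Fin p.1.2 ≃ Fin N,
    Z.act (gen k (undirRel δ (-ε)) (splitHom e)) ∘ₗ v p ∘ₗ
      (ev F (dirObj N) p.1).flip (gen k (dirRel ε) (splitHom e))

theorem avgVal_apply (m : ((dJCoind k δ ε).obj F).val (op ⟨dirObj N⟩)) :
    avgVal v m = ∑ p : Bideg N, splitWt k p.1 • ∑ e : Fin p.1.1 ⊕ Fin p.1.2 ≃ Fin N,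
      Z.act (gen k (undirRel δ (-ε)) (splitHom e))
        (v p (ev F (dirObj N) p.1 m (gen k (dirRel ε) (splitHom e)))) := by
  simp only [avgVal, LinearMap.sum_apply, LinearMap.smul_apply, LinearMap.comp_apply,
    LinearMap.flip_apply]

/-- Postcomposition with `σ` permutes the splittings of each bidegree, and the weight depends only
on the bidegree. The equivariance is what makes `g ⊗ m ↦ g (avgVal m)` balanced over `S_N`. -/
theorem act_dirSym_avgVal (σ : Equiv.Perm (Fin N))
    (m : ((dJCoind k δ ε).obj F).val (op ⟨dirObj N⟩)) :
    Z.act (gen k (undirRel δ (-ε)) (dirSym N σ)) (avgVal v m) =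
      avgVal v (((dJCoind k δ ε).obj F).act (gen k (undirRel δ ε) (dirSym N σ⁻¹)).op m) := by
  rw [avgVal_apply, avgVal_apply, map_sum]
  refine Finset.sum_congr rfl fun p _ => ?_
  rw [map_smul, map_sum]
  congr 1
  rw [← Equiv.sum_comp (postEquiv σ) fun e => Z.act (gen k (undirRel δ (-ε)) (splitHom e)) _]
  refine Finset.sum_congr rfl fun e _ => ?_
  have h1 : splitHom (p := p.1) (postEquiv σ e) = splitHom e ≫ dirSym N σ :=
    (splitHom_dirSym e σ).symm
  have h2 : splitHom (p := p.1) (postEquiv σ e) ≫ dirSym N σ⁻¹ = splitHom e := by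
    rw [splitHom_dirSym]
    refine congrArg splitHom ?_
    ext z
    exact congrArg Fin.val (σ.symm_apply_apply (e z))
  rw [ev_act, trMap_of_deg_zero k δ ε (dirSym N σ⁻¹) rfl, ← gen_comp, h2, h1, gen_comp,
    LMod.act_comp]

/-- A splitting detects the element only if it induces the same labelling as `e₀`. It is then `e₀`
preceded by a pair of permutations, the invariance `hv` makes all these summands equal, and their
total weight is one. Thus averaging really extends the prescribed values. -/
theorem avgVal_iota {p : Bideg N}
    (hv : ∀ (σ : Equiv.Perm (Fin p.1.1) × Equiv.Perm (Fin p.1.2)) (x : F.val (op ⟨walObj p.1⟩)),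
      Z.act (gen k _ (unW.map (walSym p.1 σ)))
        (v p (F.act (gen k (walRel ε) (walSym p.1 σ)).op x)) = v p x)
    (e₀ : Fin p.1.1 ⊕ Fin p.1.2 ≃ Fin N) (x : F.val (op ⟨walObj p.1⟩)) :
    avgVal v (((dJCoind k δ ε).obj F).act (gen k (undirRel δ ε) (splitInv e₀)).op
      (iota F (walObj p.1) x)) = Z.act (gen k _ (splitHom e₀)) (v p x) := by
  rw [avgVal_apply]
  have hs : ∀ (p' : Bideg N) (e : Fin p'.1.1 ⊕ Fin p'.1.2 ≃ Fin N),
      ev F (dirObj N) p'.1 (((dJCoind k δ ε).obj F).act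
        (gen k (undirRel δ ε) (splitInv e₀)).op (iota F (walObj p.1) x))
        (gen k (dirRel ε) (splitHom e)) =
      F.act (Quiver.Hom.op (X := (⟨walObj p'.1⟩ : KUWB k ε)) (Y := ⟨walObj p.1⟩)
        (walPart k ε (splitHom e ≫ splitInv e₀))) x := fun p' e => by
    rw [ev_act, ev_iota, trMap_splitInv, ← gen_comp, retr_gen]
  simp only [hs]
  refine sum_splitting k (fun n => (e₀.symm n).isLeft) _ (fun s : Splitting N =>
    Z.act (gen k (undirRel δ (-ε)) (splitHom s.2)) (v s.1
      (F.act (Quiver.Hom.op (X := (⟨walObj s.1.1⟩ : KUWB k ε)) (Y := ⟨walObj p.1⟩)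
        (walPart k ε (splitHom s.2 ≫ splitInv e₀))) x))) (fun s h => ?_) (fun s h => ?_)
  · obtain ⟨p', e⟩ := s
    -- Equal labellings force equal bidegrees; only after this identification can the two splittings
    -- be compared by permutations.
    obtain rfl : p' = p := bideg_eq_of_label (s := ⟨p', e⟩) (s' := ⟨p, e₀⟩) h
    obtain ⟨σ₁, σ₂, hσ⟩ := exists_eq_sumCongr (e.trans e₀.symm) fun z => by
      have h' := h (e z)
      rw [Equiv.symm_apply_apply] at h'
      exact h'.symm
    have he : e = (Equiv.sumCongr σ₁ σ₂).trans e₀ := by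
      rw [← hσ, Equiv.trans_assoc, Equiv.symm_trans_self, Equiv.trans_refl]
    have h1 : splitHom e = unW.map (walSym p'.1 (σ₁, σ₂)) ≫ splitHom e₀ := by
      rw [he]
      exact (unW_walSym_splitHom e₀ (σ₁, σ₂)).symm
    have h2 : splitHom e ≫ splitInv e₀ = unW.map (walSym p'.1 (σ₁, σ₂)) := by
      rw [h1, Category.assoc, splitHom_splitInv, Category.comp_id]
    change Z.act (gen k (undirRel δ (-ε)) (splitHom e)) (v p'
      (F.act (Quiver.Hom.op (X := (⟨walObj p'.1⟩ : KUWB k ε)) (Y := ⟨walObj p'.1⟩)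
        (walPart k ε (splitHom e ≫ splitInv e₀))) x)) = _
    rw [h2, h1, gen_comp, LMod.act_comp]
    refine congrArg (Z.act (gen k (undirRel δ (-ε)) (splitHom e₀))) ?_
    -- The component along `e` is the translate of `x` by the permutations, which cancels against
    -- their action in `Z`.
    refine Eq.trans ?_ (hv (σ₁, σ₂) x)
    exact congrArg (fun t : (⟨walObj p'.1⟩ : KUWB k ε) ⟶ ⟨walObj p'.1⟩ =>
      Z.act (gen k _ (unW.map (walSym p'.1 (σ₁, σ₂)))) (v p' (F.act t.op x)))
      (walPart_unW k ε (walSym p'.1 (σ₁, σ₂)))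
  · have h0 : walPart k ε (P := walObj s.1.1) (Q := walObj p.1) (splitHom s.2 ≫ splitInv e₀) = 0 :=
      walPart_of_not k ε _ fun h' => h fun n => by
        obtain ⟨z, rfl⟩ := s.2.surjective n
        have h1 := h' (Sum.inl z)
        rw [Equiv.symm_apply_apply]
        exact h1.symm
    have h1 : F.act (Quiver.Hom.op (X := (⟨walObj s.1.1⟩ : KUWB k ε)) (Y := ⟨walObj p.1⟩)
        (walPart k ε (splitHom s.2 ≫ splitInv e₀))) x = 0 :=
      (congrArg (fun t : (⟨walObj s.1.1⟩ : KUWB k ε) ⟶ ⟨walObj p.1⟩ => F.act t.op x) h0).trans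
        (LinearMap.congr_fun (ModuleCat.hom_ext_iff.1 (F.obj.map_zero _ _)) x)
    rw [h1, map_zero, map_zero]

/-- The linear map `g ⊗ m ↦ g (avgVal m)`. -/
def termDescLin (Y : KUB k δ (-ε)) : Bal (dirSym N) ((dJCoind k δ ε).obj F) Y →ₗ[k] Z.val Y :=
  balLift (dirSym N)
    (LinearMap.mk₂ k (fun g m => Z.act g (avgVal v m))
      (fun g g' _ => LMod.act_add Z g g' _) (fun c g _ => LMod.act_smul Z c g _)
      (fun g m m' => by rw [map_add, map_add]) (fun c g m => by rw [map_smul, map_smul]))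
    (fun σ g m => by
      rw [LinearMap.mk₂_apply, LinearMap.mk₂_apply, LMod.act_comp, act_dirSym_avgVal])

theorem termDescLin_bmk (Y : KUB k δ (-ε)) (g : (⟨dirObj N⟩ : KUB k δ (-ε)) ⟶ Y)
    (m : ((dJCoind k δ ε).obj F).val (op ⟨dirObj N⟩)) :
    termDescLin v Y (bmk (dirSym N) _ Y g m) = Z.act g (avgVal v m) :=
  balLift_bmk _ _ _ g m

/-- The morphism out of a term of the Koszul complex with given values on the components. -/
def termDesc : dirTerm k δ ε ((dJCoind k δ ε).obj F) N ⟶ Z :=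
  LMod.mkHom (fun Y => termDescLin v Y) (fun {Y Y'} t =>
    LinearMap.congr_fun (f := termDescLin v Y' ∘ₗ balAct (dirSym N) _ t)
      (g := Z.act t ∘ₗ termDescLin v Y) (bal_ext _ fun g m => by
        rw [LinearMap.comp_apply, LinearMap.comp_apply, balAct_bmk, termDescLin_bmk,
          termDescLin_bmk, LMod.act_comp]))

theorem termAt_termDesc (Y : KUB k δ (-ε)) (g : (⟨dirObj N⟩ : KUB k δ (-ε)) ⟶ Y)
    (m : ((dJCoind k δ ε).obj F).val (op ⟨dirObj N⟩)) :
    termAt (dirSym N) (termDesc v) Y (bmk (dirSym N) _ Y g m) = Z.act g (avgVal v m) :=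
  termDescLin_bmk v Y g m

end Extension

/-- The preimage is the morphism induced by averaging the values of `ψ` on the classes `1 ⊗ x`;
`avgVal_iota` shows that it restricts to `ψ`. -/
theorem theta_map_surjective (N : ℕ) :
    Function.Surjective fun φ : dirTerm k δ ε ((dJCoind k δ ε).obj F) N ⟶ Z =>
      theta δ F N ≫ (LMod.restr (ups k δ (-ε))).map φ := by
  intro ψ
  let ψ' : ∀ p : Bideg N, walTerm k ε F p.1 ⟶ (LMod.restr (ups k δ (-ε))).obj Z := fun p =>
    LMod.dsumIncl (fun p : Bideg N => walTerm k ε F p.1) p ≫ ψ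
  refine ⟨termDesc fun p => genVal (ψ' p), LMod.dsum_hom_ext fun p => ?_⟩
  refine (dsumIncl_theta N p _).trans ?_
  refine term_ext _ fun Y g x => ?_
  refine (termAt_thetaComp_map (stdSplit p) _ g x).trans ?_
  refine Eq.trans ?_ (termAt_eq_genVal (ψ' p) g x).symm
  rw [thetaFun_eq, termAt_termDesc, avgVal_iota (fun p => genVal (ψ' p)) (act_genVal (ψ' p)), LMod.act_comp,
    ← LMod.act_comp Z (gen k _ (splitHom _)), ← gen_comp, splitHom_splitInv, gen_id, LMod.act_id]

theorem theta_map_bijective (N : ℕ) (Z : LMod k (KUB k δ (-ε))) :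
    Function.Bijective fun φ : dirTerm k δ ε ((dJCoind k δ ε).obj F) N ⟶ Z =>
      theta δ F N ≫ (LMod.restr (ups k δ (-ε))).map φ :=
  ⟨theta_map_injective N, theta_map_surjective N⟩

end Universal

/-! ### Compatibility with the differentials -/

/-- The left block precedes the right one. Since Koszul pairs satisfy `i < j`, mixed pairs are
automatically directed from left to right, and no reversal with sign `χ_δ` is needed. -/
theorem stdSplit_inl_lt_inr {N : ℕ} (p : Bideg N) (i : Fin p.1.1) (j : Fin p.1.2) :
    stdSplit p (Sum.inl i) < stdSplit p (Sum.inr j) := by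
  have h1 : (stdSplit p (Sum.inl i)).val = i.val := by simp [stdSplit]
  have h2 : (stdSplit p (Sum.inr j)).val = p.1.1 + j.val := by simp [stdSplit]
  rw [Fin.lt_def, h1, h2]
  omega

theorem stdSplit_symm_pair {n : ℕ} (p : Bideg (n + 2)) (q : Pairs n) :
    ((stdSplit p).symm q.1.1).isLeft = ((stdSplit p).symm q.1.2).isLeft ∨
      ∃ (i : Fin p.1.1) (j : Fin p.1.2),
        q.1 = (stdSplit p (Sum.inl i), stdSplit p (Sum.inr j)) := by
  obtain ⟨⟨a, b⟩, hab⟩ := q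
  obtain ⟨a, rfl⟩ := (stdSplit p).surjective a
  obtain ⟨b, rfl⟩ := (stdSplit p).surjective b
  rcases a with i | j <;> rcases b with i' | j'
  · exact Or.inl (by simp)
  · exact Or.inr ⟨i, j', rfl⟩
  · exact absurd hab (stdSplit_inl_lt_inr p i' j).asymm
  · exact Or.inl (by simp)

section Chain

variable {k : Type u} [Field k] [CharZero k] {δ ε : ℤˣ} {F : LMod k (KUWB k ε)ᵒᵖ}

theorem alpha_splitInv {p : ℕ × ℕ} {n : ℕ} (q : Pairs n)
    (e : Fin p.1 ⊕ Fin p.2 ≃ Fin (n + 2)) :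
    alpha q ≫ splitInv e =
      (dirOne ((alphaEquiv q).trans e.symm) : dirObj n ⟶ unW.obj (walObj p)) :=
  dirOne_ofEquiv (alphaEquiv q) e.symm

/-- Degree-one diagrams with the same directed pair differ by a permutation of the source, which is
absorbed by the balancing over `S_N`. -/
theorem thetaFun_dirOne_eq {N : ℕ} {P Y : WalOrd} (g : (⟨P⟩ : KUWB k (-ε)) ⟶ ⟨Y⟩)
    (x : F.val (op ⟨P⟩)) {e e' : Fin N ⊕ (Fin 2 × Fin 1) ≃ P.fst ⊕ P.snd}
    (h0 : e (Sum.inr (0, 0)) = e' (Sum.inr (0, 0)))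
    (h1 : e (Sum.inr (1, 0)) = e' (Sum.inr (1, 0))) :
    thetaFun F δ g x (dirOne e) = thetaFun F δ g x (dirOne e') := by
  obtain ⟨π, rfl⟩ := exists_perm_of_agree (inr_ext h0 h1)
  exact (congrArg (thetaFun F δ g x) (ofEquiv_dirOne π e').symm).trans
    (thetaFun_dirSym g x π (dirOne e'))

theorem thetaFun_dirOne_eq_zero {N : ℕ} {P Y : WalOrd} (g : (⟨P⟩ : KUWB k (-ε)) ⟶ ⟨Y⟩)
    (x : F.val (op ⟨P⟩)) {e : Fin N ⊕ (Fin 2 × Fin 1) ≃ P.fst ⊕ P.snd}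
    (h : (e (Sum.inr (0, 0))).isLeft = (e (Sum.inr (1, 0))).isLeft) :
    thetaFun F δ g x (dirOne e) = 0 := by
  rw [thetaFun_eq, act_iota_eq_zero (dirOne e : dirObj N ⟶ unW.obj P) x (0 : Fin 1) h, bmk,
    TensorProduct.tmul_zero, map_zero]

/-- Both arguments are diagrams of degree one with the directed pair `(inl i, inr j)`. Their
orderings of the remaining points may differ, but `thetaFun` does not see this. -/
theorem thetaFun_splitInv_beta {p : ℕ × ℕ} {n : ℕ} {Y : WalOrd}
    (g : (⟨walObj (p.1 + 1, p.2 + 1)⟩ : KUWB k (-ε)) ⟶ ⟨Y⟩)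
    (x : F.val (op ⟨walObj (p.1 + 1, p.2 + 1)⟩)) (e' : Fin p.1 ⊕ Fin p.2 ≃ Fin n)
    (e : Fin (p.1 + 1) ⊕ Fin (p.2 + 1) ≃ Fin (n + 2)) (ij : Fin (p.1 + 1) × Fin (p.2 + 1))
    (q : Pairs n) (hq : q.1 = (e (Sum.inl ij.1), e (Sum.inr ij.2))) :
    thetaFun F δ g x (splitInv e' ≫ unW.map (beta ij)) =
      thetaFun F δ g x (alpha q ≫ splitInv (p := (p.1 + 1, p.2 + 1)) e) := by
  rw [alpha_splitInv]
  refine (congrArg (thetaFun F δ g x)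
    (ofEquiv_dirOne e'.symm (unwHom (beta ij)).e)).trans (thetaFun_dirOne_eq g x ?_ ?_)
  · refine Eq.trans ?_ (congrArg e.symm (congrArg Prod.fst hq)).symm
    exact (e.symm_apply_apply _).symm
  · refine Eq.trans ?_ (congrArg e.symm (congrArg Prod.snd hq)).symm
    exact (e.symm_apply_apply _).symm

theorem termAt_thetaComp_dirDiff {p : ℕ × ℕ} {n : ℕ} (e : Fin p.1 ⊕ Fin p.2 ≃ Fin (n + 2))
    {Y : WalOrd} (g : (⟨walObj p⟩ : KUWB k (-ε)) ⟶ ⟨Y⟩) (x : F.val (op ⟨walObj p⟩)) :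
    termAt (walSym p) (thetaComp δ F e ≫ (LMod.restr (ups k δ (-ε))).map
      (dirDiff k δ ε ((dJCoind k δ ε).obj F) n)) ⟨Y⟩ (bmk (walSym p) F ⟨Y⟩ g x) =
      ∑ q : Pairs n, thetaFun F δ g x (alpha q ≫ splitInv e) := by
  refine (termAt_thetaComp_map e _ g x).trans ?_
  rw [thetaFun_eq]
  refine (balDiff_bmk _ _ (dir_sumInv k δ ε n) _ _ _ _).trans (Finset.sum_congr rfl fun q _ => ?_)
  rw [thetaFun_eq, gen_comp, gen_comp, op_comp, LMod.act_comp, Category.assoc]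

/-- Of the pairs `i < j`, those inside a block contribute zero and the mixed ones match the terms of
the walled differential one by one. -/
theorem thetaComp_dirDiff {n : ℕ} (p : Bideg (n + 2)) :
    thetaComp δ F (stdSplit p) ≫ (LMod.restr (ups k δ (-ε))).map
      (dirDiff k δ ε ((dJCoind k δ ε).obj F) n) = walComp k ε F n p.1 ≫ theta δ F n := by
  -- If one block is empty there are no mixed pairs, so every term vanishes, in accordance with the
  -- value zero of `walComp` in these bidegrees.
  have hzero : (∀ (i : Fin p.1.1) (j : Fin p.1.2), False) →
      thetaComp δ F (stdSplit p) ≫ (LMod.restr (ups k δ (-ε))).map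
        (dirDiff k δ ε ((dJCoind k δ ε).obj F) n) = 0 := fun hp =>
    term_ext _ fun Y g x => by
      refine (termAt_thetaComp_dirDiff (stdSplit p) g x).trans ?_
      refine Finset.sum_eq_zero fun q _ => ?_
      rw [alpha_splitInv]
      refine thetaFun_dirOne_eq_zero g x ?_
      exact (stdSplit_symm_pair p q).resolve_right fun ⟨i, j, _⟩ => hp i j
  obtain ⟨⟨_ | a, _ | b⟩, hp⟩ := p
  · exact (hzero fun i _ => i.elim0).trans Limits.zero_comp.symm
  · exact (hzero fun i _ => i.elim0).trans Limits.zero_comp.symm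
  · exact (hzero fun _ j => j.elim0).trans Limits.zero_comp.symm
  · have h1 : a + b = n := by omega
    rw [walComp, dif_pos h1]
    have h2 : LMod.dsumIncl (fun p : Bideg n => walTerm k ε F p.1) ⟨(a, b), h1⟩ ≫ theta δ F n =
        thetaComp δ F (stdSplit ⟨(a, b), h1⟩) := LMod.dsumIncl_desc _ _
    refine Eq.trans ?_ (Category.assoc _ _ _).symm
    refine Eq.trans ?_ (congrArg (walDiff k ε F (a, b) ≫ ·) h2.symm)
    refine term_ext _ fun Y g x => ?_
    refine (termAt_thetaComp_dirDiff (stdSplit ⟨(a + 1, b + 1), hp⟩) g x).trans (Eq.symm ?_)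
    refine (congrArg (thetaLin F δ (stdSplit ⟨(a, b), h1⟩) Y.as)
      (balDiff_bmk _ _ (wal_sumInv k ε (a, b)) _ _ _ _)).trans ?_
    rw [map_sum]
    -- The walled pairs `(i, j)` are embedded as the mixed pairs; outside the image both ends lie in
    -- one block and the summand is zero.
    refine Fintype.sum_of_injective (fun ij : Fin (a + 1) × Fin (b + 1) =>
      (⟨(stdSplit ⟨(a + 1, b + 1), hp⟩ (Sum.inl ij.1),
        stdSplit ⟨(a + 1, b + 1), hp⟩ (Sum.inr ij.2)),
        stdSplit_inl_lt_inr ⟨(a + 1, b + 1), hp⟩ ij.1 ij.2⟩ : Pairs n)) ?_ _ _ ?_ ?_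
    · intro ij ij' h
      have h' := Prod.ext_iff.1 (Subtype.ext_iff.1 h)
      exact Prod.ext (Sum.inl_injective ((stdSplit _).injective h'.1))
        (Sum.inr_injective ((stdSplit _).injective h'.2))
    · intro q hq
      rw [alpha_splitInv]
      refine thetaFun_dirOne_eq_zero g x ?_
      refine (stdSplit_symm_pair ⟨(a + 1, b + 1), hp⟩ q).resolve_right fun ⟨i, j, h⟩ => hq ?_
      exact ⟨(i, j), Subtype.ext h.symm⟩
    · intro ij
      refine (thetaLin_bmk _ _ _ _).trans ?_
      rw [← thetaFun_comp]
      exact thetaFun_splitInv_beta (p := (a, b)) g x _ (stdSplit ⟨(a + 1, b + 1), hp⟩) ij _ rfl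

variable (F) in
theorem theta_dirDiff (n : ℕ) : theta δ F (n + 2) ≫ (LMod.restr (ups k δ (-ε))).map
    (dirDiff k δ ε ((dJCoind k δ ε).obj F) n) =
      (LMod.dsumDesc fun p : Bideg (n + 2) => walComp k ε F n p.1) ≫ theta δ F n :=
  LMod.dsum_hom_ext fun p => by
    rw [dsumIncl_theta, thetaComp_dirDiff, ← Category.assoc, LMod.dsumIncl_desc]

/-- Naturality in `F` comes down to that of `iota`, since the first tensor factor does not involve
`F`. -/
theorem theta_termMap {F' : LMod k (KUWB k ε)ᵒᵖ} (φ : F ⟶ F') (N : ℕ) :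
    theta δ F N ≫ (LMod.restr (ups k δ (-ε))).map
      (termMap (dirSym N) ((dJCoind k δ ε).map φ)) = walMap k ε φ N ≫ theta δ F' N := by
  refine LMod.dsum_hom_ext fun p => ?_
  have h : LMod.dsumIncl (fun p : Bideg N => walTerm k ε F p.1) p ≫ walMap k ε φ N ≫ theta δ F' N =
      termMap (walSym p.1) φ ≫ thetaComp δ F' (stdSplit p) := by
    rw [walMap, ← Category.assoc, LMod.dsumIncl_desc, Category.assoc]
    exact congrArg (termMap (walSym p.1) φ ≫ ·) (LMod.dsumIncl_desc _ _)
  refine (dsumIncl_theta N p _).trans (Eq.trans ?_ h.symm)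
  refine term_ext _ fun Y g x => ?_
  refine (termAt_thetaComp_map (stdSplit p) _ g x).trans ?_
  refine Eq.trans ?_ (congrArg (thetaLin F' δ (stdSplit p) Y.as) (balMap_bmk _ φ Y g x)).symm
  refine Eq.trans ?_ (thetaLin_bmk _ _ _ _).symm
  rw [thetaFun_eq, thetaFun_eq]
  refine (balMap_bmk _ _ _ _ _).trans ?_
  rw [LMod.homAt_act, iota_nat]

end Chain

/-- The universal arrows `theta` are natural and commute with the differentials, so the criterion
for a left adjoint of a complex applies to the concrete model; `nonempty_dJ_iso` then transports the
result to `dJ`. -/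
theorem nonempty_firstKoszul_iso (k : Type u) [Field k] [CharZero k] (δ ε : ℤˣ) :
    Nonempty (dJCoind k δ ε ⋙ firstKoszul k δ ε ≅
      walledFirstKoszul k ε ⋙
        (scrL k δ (-ε)).mapHomologicalComplex (ComplexShape.down' 2)) := by
  refine nonempty_iso_of_universal (L := scrL k δ (-ε))
    (Adjunction.ofIsRightAdjoint (LMod.restr (k := k) (ups k δ (-ε)))) (ComplexShape.down' 2)
    (walledFirstKoszul k ε) (dJCoind k δ ε ⋙ firstKoszul k δ ε) (fun F N => theta δ F N)
    (fun F N Z => theta_map_bijective N Z) (fun F i j hij => ?_) (fun φ N => theta_termMap φ N)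
  obtain rfl : j + 2 = i := hij
  refine Eq.trans (congrArg (fun t => theta δ F (j + 2) ≫ (LMod.restr (ups k δ (-ε))).map t) ?_)
    (theta_dirDiff F j)
  refine (dif_pos rfl).trans ?_
  rw [eqToHom_refl, Category.id_comp]

end WalledBrauer

end

theorem mainTheorem7 {k : Type u} [Field k] [CharZero k] (δ ε : ℤˣ) :
    Nonempty (WalledBrauer.dJ k δ ε ⋙ WalledBrauer.firstKoszul k δ ε ≅
      WalledBrauer.walledFirstKoszul k ε ⋙
        (WalledBrauer.scrL k δ (-ε)).mapHomologicalComplex (ComplexShape.down' 2)) := by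
  obtain ⟨i⟩ := WalledBrauer.nonempty_dJ_iso k δ ε
  obtain ⟨j⟩ := WalledBrauer.nonempty_firstKoszul_iso k δ ε
  exact ⟨Functor.isoWhiskerRight i (WalledBrauer.firstKoszul k δ ε) ≪≫ j⟩
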